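/- Let $a_0,a_1,a_2,a_3,b_1,b_2,b_3\in\mathbb R$. For a differentiable $f:\mathbb R^2\to\mathbb R$ put $g=f+x\,\partial_yf-y\,\partial_xf$ and consider, for a real parameter $\varepsilon$, the piecewise smooth vector field on $\mathbb R^3$ with switching plane $\{y=0\}$ $$X_\varepsilon(x,y,z)=\begin{cases}\bigl(-y+\varepsilon(a_0+a_1z)+\varepsilon^2(a_2+a_3z),\;x,\;-z+g(x,y)\bigr),&y>0,\\ \bigl(-y,\;x+\varepsilon b_1z+\varepsilon^2(b_2+b_3z),\;-z+g(x,y)\bigr),&y<0.\end{cases}$$ Its orbits through a point of $\{y=0\}$ at which the second components of the two fields are nonzero with the same sign (a crossing point) are obtained by concatenating trajectories of the two fields. A crossing limit cycle is a nonconstant periodic orbit that meets $\{y=0\}$ only in crossing points and has a neighbourhood containing no other periodic orbit; its period is its minimal period. Let $$f_1(r)=a_1\int_0^{\pi}f(r\cos\phi,r\sin\phi)\cos\phi\,d\phi+b_1\int_\pi^{2\pi}f(r\cos\phi,r\sin\phi)\sin\phi\,d\phi .$$ For $r>0$, say that a limit cycle bifurcates at radius $r$ if there are $\varepsilon_0>0$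 and $C$ such that for every $\varepsilon$ with $0<|\varepsilon|<\varepsilon_0$ the field $X_\varepsilon$ has a crossing limit cycle $\varphi(t,\varepsilon)$ of period $T_\varepsilon$ with $|T_\varepsilon-2\pi|\le C|\varepsilon|$ and $$\bigl|\varphi(t,\varepsilon)-\bigl(r\cos t,\,r\sin t,\,f(r\cos t,r\sin t)\bigr)\bigr|\le C|\varepsilon|\qquad\text{for all }t\in[0,T_\varepsilon].$$ (a) Let $f(x,y)=\cos x$. Then $f_1(r)=-2b_1\sin r/r$ for $r>0$, and if $b_1\ne0$, then for every integer $n\ge1$ a limit cycle bifurcates at radius $n\pi$. (b) Let $f(x,y)=\sin x$. Then $f_1(r)=a_1\pi J_1(r)$ for $r>0$, where $J_1(r)=\sum_{m\ge0}\frac{(-1)^m}{m!\,(m+1)!}(r/2)^{2m+1}$ is the Bessel function of the first kind of order $1$. The positive zeros of $J_1$ form a strictly increasing infinite sequence $(r_n)$, and if $a_1\ne0$, then for every $n$ a limit cycle bifurcates at radius $r_n$. -/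

import Mathlib

noncomputable section

/-- Phase space `ℝ³`, a point being `(x, y, z)`. -/
abbrev Space3 : Type := ℝ × ℝ × ℝ

/-! ### Piecewise smooth vector fields with switching plane `y = 0`

`Xp` is the field on `y > 0` and `Xm` the field on `y < 0`. For `h (x, y, z) = y` the Lie
derivative `X h` is the second component of `X`. -/

/-- `p` lies on `y = 0` and both fields traverse that plane at `p` in the same direction. -/
def IsCrossingPoint (Xp Xm : Space3 → Space3) (p : Space3) : Prop :=
  p.2.1 = 0 ∧ 0 < (Xp p).2.1 * (Xm p).2.1

/-- `γ` is a complete orbit that meets the plane `y = 0` only at crossing points: a trajectory of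
`Xp` while `y > 0`, a trajectory of `Xm` while `y < 0`, and, at each time at which `y = 0`, the
concatenation of a trajectory of the field that it leaves and one of the field that it enters. -/
structure IsCrossingOrbit (Xp Xm : Space3 → Space3) (γ : ℝ → Space3) : Prop where
  upper : ∀ t, 0 < (γ t).2.1 → HasDerivAt γ (Xp (γ t)) t
  lower : ∀ t, (γ t).2.1 < 0 → HasDerivAt γ (Xm (γ t)) t
  crossing : ∀ t, (γ t).2.1 = 0 → IsCrossingPoint Xp Xm (γ t)
  upward : ∀ t, (γ t).2.1 = 0 → 0 < (Xp (γ t)).2.1 →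
    HasDerivWithinAt γ (Xm (γ t)) (Set.Iic t) t ∧ HasDerivWithinAt γ (Xp (γ t)) (Set.Ici t) t
  downward : ∀ t, (γ t).2.1 = 0 → (Xp (γ t)).2.1 < 0 →
    HasDerivWithinAt γ (Xp (γ t)) (Set.Iic t) t ∧ HasDerivWithinAt γ (Xm (γ t)) (Set.Ici t) t

/-- `γ` is a nonconstant periodic crossing orbit with minimal period `T`. -/
structure IsPeriodicCrossingOrbit (Xp Xm : Space3 → Space3) (γ : ℝ → Space3) (T : ℝ) :
    Prop where
  orbit : IsCrossingOrbit Xp Xm γ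
  pos : 0 < T
  periodic : Function.Periodic γ T
  minimal : ∀ S, 0 < S → Function.Periodic γ S → T ≤ S

/-- A crossing limit cycle of minimal period `T`: a periodic crossing orbit with a neighbourhood
that contains no other periodic orbit. (The crossing points are open in the plane `y = 0`, so
a small neighbourhood of `γ` meets that plane in crossing points only, and periodic orbits inside
it are crossing orbits.) -/
def IsCrossingLimitCycle (Xp Xm : Space3 → Space3) (γ : ℝ → Space3) (T : ℝ) : Prop :=
  IsPeriodicCrossingOrbit Xp Xm γ T ∧
    ∃ U : Set Space3, IsOpen U ∧ Set.range γ ⊆ U ∧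
      ∀ (η : ℝ → Space3) (S : ℝ), IsPeriodicCrossingOrbit Xp Xm η S →
        Set.range η ⊆ U → Set.range η = Set.range γ

/-! ### The perturbed three-dimensional system -/

/-- `g = f + x ∂f/∂y - y ∂f/∂x`. -/
def forcing (f : ℝ → ℝ → ℝ) (x y : ℝ) : ℝ :=
  f x y + x * deriv (fun v => f x v) y - y * deriv (fun u => f u y) x

/-- The field on `y > 0`. -/
def upperField (f : ℝ → ℝ → ℝ) (a₀ a₁ a₂ a₃ ε : ℝ) (p : Space3) : Space3 :=
  (-p.2.1 + ε * (a₀ + a₁ * p.2.2) + ε ^ 2 * (a₂ + a₃ * p.2.2),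
    p.1,
    -p.2.2 + forcing f p.1 p.2.1)

/-- The field on `y < 0`. -/
def lowerField (f : ℝ → ℝ → ℝ) (b₁ b₂ b₃ ε : ℝ) (p : Space3) : Space3 :=
  (-p.2.1,
    p.1 + ε * (b₁ * p.2.2) + ε ^ 2 * (b₂ + b₃ * p.2.2),
    -p.2.2 + forcing f p.1 p.2.1)

/-- The first order bifurcation function. -/
def bifurcationFunction (f : ℝ → ℝ → ℝ) (a₁ b₁ r : ℝ) : ℝ :=
  a₁ * (∫ φ in (0 : ℝ)..Real.pi, f (r * Real.cos φ) (r * Real.sin φ) * Real.cos φ) +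
    b₁ * (∫ φ in Real.pi..(2 * Real.pi), f (r * Real.cos φ) (r * Real.sin φ) * Real.sin φ)

/-- For all sufficiently small `ε ≠ 0` the perturbed system has a crossing limit cycle `φ ε` of
period `T ε = 2π + O(ε)` which, over one period, is `O(ε)`-close to the closed curve
`(r cos t, r sin t, f (r cos t, r sin t))` of the unperturbed system. -/
def LimitCycleBifurcatesAt (f : ℝ → ℝ → ℝ) (a₀ a₁ a₂ a₃ b₁ b₂ b₃ r : ℝ) : Prop :=
  ∃ (φ : ℝ → ℝ → Space3) (T : ℝ → ℝ) (C ε₀ : ℝ), 0 < ε₀ ∧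
    ∀ ε : ℝ, ε ≠ 0 → |ε| < ε₀ →
      IsCrossingLimitCycle (upperField f a₀ a₁ a₂ a₃ ε) (lowerField f b₁ b₂ b₃ ε) (φ ε) (T ε) ∧
      |T ε - 2 * Real.pi| ≤ C * |ε| ∧
      ∀ t ∈ Set.Icc (0 : ℝ) (T ε),
        ‖φ ε t - ((r * Real.cos t, r * Real.sin t,
          f (r * Real.cos t) (r * Real.sin t)) : Space3)‖ ≤ C * |ε|

/-- Bessel function of the first kind of order `n`, for a natural number `n`. -/
def besselJ (n : ℕ) (x : ℝ) : ℝ :=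
  ∑' m : ℕ, (-1 : ℝ) ^ m / ((m.factorial : ℝ) * ((m + n).factorial : ℝ)) * (x / 2) ^ (2 * m + n)

end

open Real intervalIntegral MeasureTheory Set Filter Topology

/-! When `f` depends on `x` only, the forcing is `f - y f'`. At `ε = 0` the coordinate `w = z - f x`
then satisfies `w' = -w`, so the graph of `f` is invariant, attracting and filled with closed orbits
of period `2π`. In polar coordinates, with the angle as independent variable, the perturbed system
becomes `R' = ε F`, `w' = -w + ε G`. Here `F` and `G` are smooth on each half-plane and may jump
only where `sin θ = 0`. The integral of `F` over a turn at `ε = w = 0` is the bifurcation function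
(`integral_radialRate_eq_bifurcationFunction`), so the matter reduces to its simple zeros.

Existence (`exists_isPeriodicSolution`) is a Lyapunov–Schmidt reduction. For every base radius `ρ`,
a contraction on continuous functions on the circle solves the system with the mean of `F`
subtracted from the radial equation. The remaining scalar equation, mean equal to zero, is
`O(ε)`-close to the bifurcation equation and is solved by the intermediate value theorem near the
simple zero. Only Lipschitz bounds uniform in the angle are needed, so the jumps are harmless.

Isolation (`IsPolarOrbit.eq_isPeriodicSolution`) is a maximum principle applied to the difference of
two periodic solutions. The decay in `w` bounds the transversal difference by `O(ε)` times the
radial one. After multiplication by a factor `1 - ε Φ` that averages the linearised radial equation,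
the square of the radial difference is strictly monotone near its maximum unless the difference
vanishes. The argument runs in time, so it also covers orbits that close up only after several
turns.

`exists_clock` recovers time from the angle, and `isPeriodicCrossingOrbit_polarPoint` turns the
polar solution into a crossing orbit. `exists_crossingLimitCycle` combines these results.

For the cosine the bifurcation function is a multiple of `sin r / r`, whose positive zeros are
plainly simple. For the sine it is a multiple of `J₁`. Its zeros are simple because `J₀` and `J₁`
have no common zero, and they are unbounded because the Bessel system oscillates. -/

theorem hasDerivAt_integral_of_continuous_bounded {a b C : ℝ} {F F' : ℝ → ℝ → ℝ}
    (hF : ∀ x, Continuous (F x)) (hF' : ∀ x, Continuous (F' x)) (hC : ∀ x t, |F' x t| ≤ C)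
    (h : ∀ x t, HasDerivAt (fun x => F x t) (F' x t) x) (x : ℝ) :
    HasDerivAt (fun x => ∫ t in a..b, F x t) (∫ t in a..b, F' x t) x :=
  (hasDerivAt_integral_of_dominated_loc_of_deriv_le (bound := fun _ => C) (s := univ)
    univ_mem (Eventually.of_forall fun x => (hF x).aestronglyMeasurable)
    ((hF x).intervalIntegrable _ _) (hF' x).aestronglyMeasurable
    (Eventually.of_forall fun t _ x _ => by simpa using hC x t) intervalIntegrable_const
    (Eventually.of_forall fun t _ x _ => h x t)).2

/-! ### Bessel functions -/

/-- `π J₀`. -/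
noncomputable def besselIntegralZero (r : ℝ) : ℝ := ∫ φ in (0 : ℝ)..π, cos (r * cos φ)

/-- `π J₁`. -/
noncomputable def besselIntegralOne (r : ℝ) : ℝ := ∫ φ in (0 : ℝ)..π, sin (r * cos φ) * cos φ

theorem hasDerivAt_besselIntegralZero (r : ℝ) :
    HasDerivAt besselIntegralZero (-besselIntegralOne r) r := by
  have := hasDerivAt_integral_of_continuous_bounded (a := 0) (b := π) (C := 1)
    (F := fun r φ => cos (r * cos φ)) (F' := fun r φ => -(sin (r * cos φ) * cos φ))
    (fun x => by fun_prop) (fun x => by fun_prop)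
    (fun x t => by
      rw [abs_neg, abs_mul]
      exact mul_le_one₀ (abs_sin_le_one _) (abs_nonneg _) (abs_cos_le_one _))
    (fun x t => by
      have := ((hasDerivAt_id x).mul_const (cos t)).cos
      simpa [neg_mul] using this) r
  rwa [intervalIntegral.integral_neg] at this

theorem hasDerivAt_besselIntegralOne' (r : ℝ) :
    HasDerivAt besselIntegralOne (∫ φ in (0 : ℝ)..π, cos (r * cos φ) * cos φ ^ 2) r := by
  refine hasDerivAt_integral_of_continuous_bounded (a := 0) (b := π) (C := 1)
    (F := fun r φ => sin (r * cos φ) * cos φ) (F' := fun r φ => cos (r * cos φ) * cos φ ^ 2)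
    (fun x => by fun_prop) (fun x => by fun_prop)
    (fun x t => by
      rw [abs_mul, abs_pow]
      exact mul_le_one₀ (abs_cos_le_one _) (by positivity)
        (pow_le_one₀ (abs_nonneg _) (abs_cos_le_one _)))
    (fun x t => by
      have := (((hasDerivAt_id x).mul_const (cos t)).sin).mul_const (cos t)
      refine this.congr_deriv ?_
      simp only [id, one_mul]; ring) r

/-- Integrate the derivative of `sin φ * sin (r cos φ)` over `[0, π]`; the boundary terms vanish.
This is the Bessel equation in first order form. -/
theorem besselIntegralOne_eq (r : ℝ) : besselIntegralOne r =
    r * (besselIntegralZero r - ∫ φ in (0 : ℝ)..π, cos (r * cos φ) * cos φ ^ 2) := by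
  have h1 : ∀ φ : ℝ, HasDerivAt (fun φ => sin φ * sin (r * cos φ))
      (sin (r * cos φ) * cos φ - r * (cos (r * cos φ) - cos (r * cos φ) * cos φ ^ 2)) φ := by
    intro φ
    have := (hasDerivAt_sin φ).mul (((hasDerivAt_cos φ).const_mul r).sin)
    refine this.congr_deriv ?_
    linear_combination (-r * cos (r * cos φ)) * (sin_sq φ)
  have h2 := integral_eq_sub_of_hasDerivAt (a := 0) (b := π) (fun φ _ => h1 φ)
    (Continuous.intervalIntegrable (by fun_prop) _ _)
  rw [intervalIntegral.integral_sub (Continuous.intervalIntegrable (by fun_prop) _ _)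
    (Continuous.intervalIntegrable (by fun_prop) _ _), intervalIntegral.integral_const_mul,
    intervalIntegral.integral_sub (Continuous.intervalIntegrable (by fun_prop) _ _)
    (Continuous.intervalIntegrable (by fun_prop) _ _)] at h2
  simp only [sin_pi, sin_zero, zero_mul, sub_zero] at h2
  unfold besselIntegralOne besselIntegralZero
  linarith

theorem hasDerivAt_besselIntegralOne {r : ℝ} (hr : r ≠ 0) :
    HasDerivAt besselIntegralOne (besselIntegralZero r - besselIntegralOne r / r) r := by
  refine (hasDerivAt_besselIntegralOne' r).congr_deriv ?_
  rw [besselIntegralOne_eq r, mul_div_cancel_left₀ _ hr]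
  ring

theorem hasDerivAt_mul_besselIntegralOne (r : ℝ) :
    HasDerivAt (fun r => r * besselIntegralOne r) (r * besselIntegralZero r) r := by
  refine ((hasDerivAt_id r).mul (hasDerivAt_besselIntegralOne' r)).congr_deriv ?_
  have := besselIntegralOne_eq r
  simp only [id]
  linarith

theorem continuous_besselIntegralOne : Continuous besselIntegralOne :=
  continuous_iff_continuousAt.2 fun r => (hasDerivAt_besselIntegralOne' r).continuousAt

theorem continuous_besselIntegralZero : Continuous besselIntegralZero :=
  continuous_iff_continuousAt.2 fun r => (hasDerivAt_besselIntegralZero r).continuousAt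

theorem besselIntegralZero_zero : besselIntegralZero 0 = π := by
  simp [besselIntegralZero]

/-- The functions `J₀` and `J₁` have no common zero. -/
theorem besselIntegralZero_ne_zero {r : ℝ} (hr : 0 ≤ r) (h : besselIntegralOne r = 0) :
    besselIntegralZero r ≠ 0 := by
  intro h0
  -- The energy `s² M² + (s K)²`, with `M = π J₀` and `K = π J₁`, is nonnegative and has derivative
  -- `2 s M² ≥ 0`. A common zero at `r` makes it vanish on all of `[0, r]`.
  have hd : ∀ s : ℝ, HasDerivAt
      (fun s => s ^ 2 * besselIntegralZero s ^ 2 + (s * besselIntegralOne s) ^ 2)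
      (2 * s * besselIntegralZero s ^ 2) s := by
    intro s
    refine (((hasDerivAt_pow 2 s).mul ((hasDerivAt_besselIntegralZero s).pow 2)).add
      ((hasDerivAt_mul_besselIntegralOne s).pow 2)).congr_deriv ?_
    simp; ring
  have hmono : MonotoneOn
      (fun s => s ^ 2 * besselIntegralZero s ^ 2 + (s * besselIntegralOne s) ^ 2) (Icc 0 r) := by
    refine monotoneOn_of_deriv_nonneg (convex_Icc 0 r)
      (fun s _ => (hd s).continuousAt.continuousWithinAt)
      (fun s _ => (hd s).differentiableAt.differentiableWithinAt) ?_
    intro s hs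
    rw [interior_Icc] at hs
    rw [(hd s).deriv]
    have := hs.1
    positivity
  have hz : ∀ s ∈ Icc 0 r, s * besselIntegralZero s = 0 := by
    intro s hs
    have := hmono hs (right_mem_Icc.2 hr) hs.2
    simp only [h, h0] at this
    nlinarith [sq_nonneg (s * besselIntegralZero s), sq_nonneg (s * besselIntegralOne s)]
  rcases hr.eq_or_lt with rfl | hr
  · rw [besselIntegralZero_zero] at h0
    exact pi_ne_zero h0
  -- The factor `s` leaves the value at `0` undecided; continuity from the right settles it and
  -- contradicts the value `π` there.
  · have : Tendsto besselIntegralZero (𝓝[>] 0) (𝓝 (besselIntegralZero 0)) :=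
      (continuous_besselIntegralZero.tendsto 0).mono_left nhdsWithin_le_nhds
    have h3 : Tendsto besselIntegralZero (𝓝[>] 0) (𝓝 0) := by
      refine tendsto_const_nhds.congr' ?_
      filter_upwards [Ioo_mem_nhdsGT hr] with s hs
      exact ((mul_eq_zero.1 (hz s ⟨hs.1.le, hs.2.le⟩)).resolve_left hs.1.ne').symm
    have := tendsto_nhds_unique this h3
    rw [besselIntegralZero_zero] at this
    exact pi_ne_zero this

/-- A solution of `M' = -K`, `(r K)' = r M` oscillates: `K` is not eventually positive. -/
theorem not_eventually_pos_of_bessel_system {M K : ℝ → ℝ}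
    (hM : ∀ r, HasDerivAt M (-K r) r) (hK : ∀ r, HasDerivAt (fun r => r * K r) (r * M r) r)
    {a : ℝ} (ha : 0 < a) (hpos : ∀ r, a ≤ r → 0 < K r) : False := by
  have hMc : Continuous M := continuous_iff_continuousAt.2 fun r => (hM r).continuousAt
  have hanti : AntitoneOn M (Ici a) := by
    refine antitoneOn_of_deriv_nonpos (convex_Ici a) hMc.continuousOn
      (fun s _ => (hM s).differentiableAt.differentiableWithinAt) ?_
    intro s hs
    rw [interior_Ici] at hs
    rw [(hM s).deriv]
    linarith [hpos s hs.le]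
  -- `M` decreases. If it becomes negative at `b`, then `r K` falls at least linearly with slope `b
  -- M b` and cannot stay positive. If it stays nonnegative, then `r K` increases, so `K ≥ c / r`
  -- and `M` falls at least like `-c log r`.
  by_cases hneg : ∃ b, a ≤ b ∧ M b < 0
  · obtain ⟨b, hab, hb⟩ := hneg
    have hb0 : 0 < b := ha.trans_le hab
    have h1 : AntitoneOn (fun r => r * K r - b * M b * r) (Ici b) := by
      have hd : ∀ s, HasDerivAt (fun r => r * K r - b * M b * r) (s * M s - b * M b) s :=
        fun s => ((hK s).sub ((hasDerivAt_id s).const_mul (b * M b))).congr_deriv (by simp)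
      refine antitoneOn_of_deriv_nonpos (convex_Ici b)
        (fun s _ => (hd s).continuousAt.continuousWithinAt)
        (fun s _ => (hd s).differentiableAt.differentiableWithinAt) ?_
      intro s hs
      rw [interior_Ici] at hs
      have hs : b < s := hs
      rw [(hd s).deriv]
      have : M s ≤ M b := hanti hab (hab.trans hs.le) hs.le
      nlinarith
    have hc : 0 < -(b * M b) := by nlinarith
    -- The zero of the line through `(b, b K b)` with slope `b M b`, which lies above `r K` to the
    -- right of `b`.
    set s := b + (b * K b) / (-(b * M b)) with hs
    have hKb := hpos b hab
    have hbs : b ≤ s := by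
      have : 0 ≤ (b * K b) / (-(b * M b)) := by positivity
      linarith
    have h2 := h1 self_mem_Ici hbs hbs
    have h3 : (-(b * M b)) * (s - b) = b * K b := by
      rw [hs, add_sub_cancel_left, mul_div_cancel₀ _ hc.ne']
    have h4 : 0 < s * K s := mul_pos (hb0.trans_le hbs) (hpos s (hab.trans hbs))
    simp only at h2
    nlinarith
  · push Not at hneg
    have h1 : MonotoneOn (fun r => r * K r) (Ici a) := by
      refine monotoneOn_of_deriv_nonneg (convex_Ici a)
        (fun s _ => (hK s).continuousAt.continuousWithinAt)
        (fun s _ => (hK s).differentiableAt.differentiableWithinAt) ?_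
      intro s hs
      rw [interior_Ici] at hs
      rw [(hK s).deriv]
      exact mul_nonneg (ha.trans hs).le (hneg s hs.le)
    set c := a * K a with hc
    have hcpos : 0 < c := mul_pos ha (hpos a le_rfl)
    have h2 : AntitoneOn (fun r => M r + c * log r) (Ici a) := by
      have hd : ∀ s ∈ Ici a, HasDerivAt (fun r => M r + c * log r) (-K s + c * s⁻¹) s :=
        fun s hs => (hM s).add ((hasDerivAt_log (ha.trans_le hs).ne').const_mul c)
      refine antitoneOn_of_deriv_nonpos (convex_Ici a)
        (fun s hs => (hd s hs).continuousAt.continuousWithinAt)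
        (fun s hs => (hd s (interior_subset hs)).differentiableAt.differentiableWithinAt) ?_
      intro s hs
      have hs := interior_subset hs
      have hs0 : 0 < s := ha.trans_le hs
      rw [(hd s hs).deriv]
      have : c ≤ s * K s := h1 self_mem_Ici hs hs
      have : c * s⁻¹ ≤ K s := by
        rw [← div_eq_mul_inv, div_le_iff₀ hs0]; linarith
      linarith
    have h3 : Tendsto (fun r => c * log r) atTop atTop :=
      tendsto_log_atTop.const_mul_atTop hcpos
    obtain ⟨s, hs, hsa⟩ := ((h3.eventually_gt_atTop (M a + c * log a)).and
      (eventually_ge_atTop a)).exists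
    have := h2 self_mem_Ici hsa hsa
    have := hneg s hsa
    simp only at *
    linarith

theorem exists_besselIntegralOne_eq_zero (a : ℝ) : ∃ r, a < r ∧ besselIntegralOne r = 0 := by
  by_contra! hne
  set b := max a 0 + 1 with hb
  have hb0 : 0 < b := by positivity
  have hba : a < b := by linarith [le_max_left a 0]
  have hsign : ∀ r, b ≤ r → 0 < besselIntegralOne b * besselIntegralOne r := by
    intro r hr
    by_contra! hle
    have hr1 := hne r (hba.trans_le hr)
    have hb1 := hne b hba
    have : (0 : ℝ) ∈ besselIntegralOne '' uIcc b r := by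
      refine intermediate_value_uIcc continuous_besselIntegralOne.continuousOn ?_
      rw [mem_uIcc]
      rcases le_total 0 (besselIntegralOne b) with h | h
      · right
        have := lt_of_le_of_ne h hb1.symm
        exact ⟨by nlinarith, h⟩
      · left
        have := lt_of_le_of_ne h hb1
        exact ⟨h, by nlinarith⟩
    obtain ⟨s, hs, hs0⟩ := this
    rw [uIcc_of_le hr] at hs
    exact hne s (hba.trans_le hs.1) hs0
  -- The system is linear and homogeneous, so multiplying by the value at `b` fixes the sign without
  -- a case distinction.
  refine not_eventually_pos_of_bessel_system
    (M := fun r => besselIntegralOne b * besselIntegralZero r)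
    (K := fun r => besselIntegralOne b * besselIntegralOne r) (fun r => ?_) (fun r => ?_)
    hb0 hsign
  · simpa using (hasDerivAt_besselIntegralZero r).const_mul (besselIntegralOne b)
  · simpa only [mul_left_comm] using
      (hasDerivAt_mul_besselIntegralOne r).const_mul (besselIntegralOne b)

/-- At a positive zero the derivative is `π J₀`, which cannot vanish there too; at `0` it is the
integral of `cos²`. So all nonnegative zeros are simple. -/
theorem hasDerivAt_besselIntegralOne_of_eq_zero {r : ℝ} (hr : 0 ≤ r)
    (h : besselIntegralOne r = 0) : ∃ d ≠ 0, HasDerivAt besselIntegralOne d r := by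
  rcases hr.eq_or_lt with rfl | hr'
  · refine ⟨_, ?_, hasDerivAt_besselIntegralOne' 0⟩
    simp
  · refine ⟨_, ?_, hasDerivAt_besselIntegralOne hr'.ne'⟩
    simpa [h] using besselIntegralZero_ne_zero hr h

/-- Simple zeros are isolated, and a compact discrete set is finite. -/
theorem finite_besselIntegralOne_zeros (b : ℝ) :
    {r ∈ Icc 0 b | besselIntegralOne r = 0}.Finite := by
  set Z := {r ∈ Icc 0 b | besselIntegralOne r = 0} with hZ
  have hZc : IsCompact Z := isCompact_Icc.inter_right
    (isClosed_eq continuous_besselIntegralOne continuous_const)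
  refine hZc.finite ?_
  rw [isDiscrete_iff_forall_mem_exists_isOpen]
  intro r hr
  obtain ⟨d, hd, h⟩ := hasDerivAt_besselIntegralOne_of_eq_zero hr.1.1 hr.2
  have := h.eventually_ne hd (c := 0)
  rw [eventually_nhdsWithin_iff] at this
  obtain ⟨U, hU, hUo, hrU⟩ := eventually_nhds_iff.1 this
  refine ⟨U, hUo, ?_⟩
  ext s
  constructor
  · rintro ⟨h1, h2⟩
    by_contra hne
    exact hU s h1 hne h2.2
  · rintro rfl
    exact ⟨hrU, hr⟩

/-- An unbounded set of positive reals with finitely many elements below each bound is the range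
of a strictly increasing sequence. -/
theorem exists_strictMono_range_eq {Z : Set ℝ}
    (hfin : ∀ b, (Z ∩ Iic b).Finite) (hunb : ∀ b, ∃ r ∈ Z, b < r) :
    ∃ ρ : ℕ → ℝ, StrictMono ρ ∧ range ρ = Z := by
  obtain ⟨m, hm, hmin⟩ : ∃ m ∈ Z, ∀ r ∈ Z, m ≤ r := by
    obtain ⟨r, hr, -⟩ := hunb 0
    obtain ⟨m, hm, hmin⟩ := (hfin r).exists_minimal ⟨r, hr, mem_Iic.2 le_rfl⟩
    refine ⟨m, hm.1, fun s hs => ?_⟩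
    by_contra! hlt
    exact absurd (hmin ⟨hs, hlt.le.trans hm.2⟩ hlt.le) (not_le.2 hlt)
  -- A locally finite linear order with a least and no greatest element is isomorphic to `ℕ`; the
  -- inverse isomorphism is the enumeration.
  let : LocallyFiniteOrder Z := LocallyFiniteOrder.ofFiniteIcc fun a b => by
    refine Set.Finite.of_finite_image (f := Subtype.val) ?_ Subtype.val_injective.injOn
    refine (hfin b).subset ?_
    rintro _ ⟨x, hx, rfl⟩
    exact ⟨x.2, hx.2⟩
  let : OrderBot Z := { bot := ⟨m, hm⟩, bot_le := fun x => hmin x x.2 }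
  have : NoMaxOrder Z := ⟨fun x => by
    obtain ⟨r, hr, h⟩ := hunb x
    exact ⟨⟨r, hr⟩, h⟩⟩
  let : SuccOrder Z := LinearLocallyFiniteOrder.succOrder Z
  let : PredOrder Z := LinearLocallyFiniteOrder.predOrder Z
  let e : Z ≃o ℕ := orderIsoNatOfLinearSuccPredArch
  refine ⟨fun n => (e.symm n : ℝ), fun i j hij => e.symm.strictMono hij, ?_⟩
  ext r
  constructor
  · rintro ⟨n, rfl⟩
    exact (e.symm n).2
  · intro hr
    exact ⟨e ⟨r, hr⟩, by simp⟩

/-- Wallis integrals, by the reduction formula. Denominators are cleared so that the induction stays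
polynomial. -/
theorem integral_cos_pow_even_add_two (m : ℕ) :
    ((m.factorial : ℝ) * ((m + 1).factorial : ℝ) * 2 ^ (2 * m + 1)) *
      ∫ φ in (0 : ℝ)..π, cos φ ^ (2 * m + 2) = π * ((2 * m + 1).factorial : ℝ) := by
  induction m with
  | zero =>
    rw [integral_cos_pow]
    simp
  | succ m ih =>
    rw [integral_cos_pow, show 2 * (m + 1) = 2 * m + 2 by ring]
    set I := ∫ φ in (0 : ℝ)..π, cos φ ^ (2 * m + 2)
    rw [Nat.factorial_succ (m + 1), Nat.factorial_succ (2 * m + 2),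
      Nat.factorial_succ (2 * m + 1)]
    rw [Nat.factorial_succ m] at ih ⊢
    push_cast at ih ⊢
    simp only [sin_pi, sin_zero, mul_zero, sub_zero, zero_div, zero_add]
    have h : (2 * (m : ℝ) + 2 + 2) ≠ 0 := by positivity
    field_simp
    linear_combination (4 * ((m : ℝ) + 1)) * ih

/-- Expand the sine and integrate termwise, dominated by the exponential series of `|r|`; the Wallis
integrals give the coefficients. -/
theorem besselIntegralOne_eq_pi_mul_besselJ (r : ℝ) : besselIntegralOne r = π * besselJ 1 r := by
  have h : HasSum (fun m : ℕ => ∫ φ in (0 : ℝ)..π,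
      (-1) ^ m * (r * cos φ) ^ (2 * m + 1) / ((2 * m + 1).factorial : ℝ) * cos φ)
      (besselIntegralOne r) := by
    refine hasSum_integral_of_dominated_convergence
      (fun m _ => |r| ^ (2 * m + 1) / ((2 * m + 1).factorial : ℝ))
      (fun m => (by fun_prop : Continuous _).aestronglyMeasurable) (fun m => ?_) ?_ ?_ ?_
    · refine Eventually.of_forall fun t _ => ?_
      rw [norm_mul, norm_div, norm_mul, norm_pow, norm_pow, norm_mul]
      simp only [norm_neg, norm_one, one_pow, one_mul, Real.norm_eq_abs, Nat.abs_cast]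
      have h1 : |cos t| ≤ 1 := abs_cos_le_one t
      have h2 : (|r| * |cos t|) ^ (2 * m + 1) ≤ |r| ^ (2 * m + 1) :=
        pow_le_pow_left₀ (by positivity) (mul_le_of_le_one_right (abs_nonneg _) h1) _
      calc _ ≤ (|r| * |cos t|) ^ (2 * m + 1) / ((2 * m + 1).factorial : ℝ) :=
            mul_le_of_le_one_right (by positivity) h1
        _ ≤ _ := by gcongr
    · refine Eventually.of_forall fun t _ => ?_
      exact (Real.summable_pow_div_factorial |r|).comp_injective
        (i := fun m : ℕ => 2 * m + 1) (fun a b h => by simpa using h)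
    · exact intervalIntegrable_const
    · exact Eventually.of_forall fun t _ => (Real.hasSum_sin _).mul_right _
  rw [besselJ, ← tsum_mul_left, ← h.tsum_eq]
  congr 1
  ext m
  have h1 : ∀ φ : ℝ, (-1) ^ m * (r * cos φ) ^ (2 * m + 1) / ((2 * m + 1).factorial : ℝ) * cos φ
      = (-1) ^ m * r ^ (2 * m + 1) / ((2 * m + 1).factorial : ℝ) * cos φ ^ (2 * m + 2) := by
    intro φ; ring
  simp_rw [h1]
  rw [intervalIntegral.integral_const_mul]
  have h2 := integral_cos_pow_even_add_two m
  have h3 : ((2 * m + 1).factorial : ℝ) ≠ 0 := by positivity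
  have h4 : (m.factorial : ℝ) ≠ 0 := by positivity
  have h5 : ((m + 1).factorial : ℝ) ≠ 0 := by positivity
  rw [div_pow]
  field_simp
  linear_combination r ^ (2 * m + 1) * h2

/-! ### Evaluation of the bifurcation functions and zeros of `J₁` -/

/-- The reflection `φ ↦ π - φ` makes the upper integrand odd. The lower one has the explicit
primitive `-sin (r cos φ) / r`. -/
theorem bifurcationFunction_cos {r : ℝ} (hr : r ≠ 0) (a₁ b₁ : ℝ) :
    bifurcationFunction (fun x _ => cos x) a₁ b₁ r = -(2 * b₁ * sin r) / r := by
  have h1 : ∫ φ in (0 : ℝ)..π, cos (r * cos φ) * cos φ = 0 := by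
    have := intervalIntegral.integral_comp_sub_left (a := 0) (b := π)
      (fun φ => cos (r * cos φ) * cos φ) π
    simp only [cos_pi_sub, mul_neg, cos_neg, sub_self, sub_zero,
      intervalIntegral.integral_neg] at this
    linarith
  have h2 : ∫ φ in π..(2 * π), cos (r * cos φ) * sin φ = -(2 * sin r) / r := by
    have hd : ∀ φ : ℝ, HasDerivAt (fun φ => -sin (r * cos φ) / r) (cos (r * cos φ) * sin φ) φ := by
      intro φ
      refine ((((hasDerivAt_cos φ).const_mul r).sin).neg.div_const r).congr_deriv ?_
      field_simp
    rw [integral_eq_sub_of_hasDerivAt (fun φ _ => hd φ)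
      (Continuous.intervalIntegrable (by fun_prop) _ _)]
    simp
    ring
  rw [bifurcationFunction, h1, h2]
  ring

/-- On the lower arc the integrand is odd under `φ ↦ 3π - φ`, the reflection of `[π, 2π]` about its
midpoint. -/
theorem bifurcationFunction_sin (a₁ b₁ r : ℝ) :
    bifurcationFunction (fun x _ => sin x) a₁ b₁ r = a₁ * besselIntegralOne r := by
  have h1 : ∫ φ in π..(2 * π), sin (r * cos φ) * sin φ = 0 := by
    have := intervalIntegral.integral_comp_sub_left (a := π) (b := 2 * π)
      (fun φ => sin (r * cos φ) * sin φ) (3 * π)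
    have hs : ∀ φ, sin (3 * π - φ) = sin φ := fun φ => by
      rw [show 3 * π - φ = (π - φ) + 2 * π by ring, sin_add_two_pi, sin_pi_sub]
    have hc : ∀ φ, cos (3 * π - φ) = -cos φ := fun φ => by
      rw [show 3 * π - φ = (π - φ) + 2 * π by ring, cos_add_two_pi, cos_pi_sub]
    rw [show 3 * π - 2 * π = π by ring, show 3 * π - π = 2 * π by ring] at this
    simp only [hs, hc, mul_neg, sin_neg, neg_mul, intervalIntegral.integral_neg] at this
    linarith
  rw [bifurcationFunction, h1, besselIntegralOne]
  ring

/-- The positive zeros of `J₁` form a strictly increasing infinite sequence. -/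
theorem exists_strictMono_range_eq_besselJ_one_zeros :
    ∃ ρ : ℕ → ℝ, StrictMono ρ ∧ range ρ = {r : ℝ | 0 < r ∧ besselJ 1 r = 0} := by
  have hiff : ∀ r, besselJ 1 r = 0 ↔ besselIntegralOne r = 0 := fun r => by
    simp [besselIntegralOne_eq_pi_mul_besselJ, pi_ne_zero]
  refine exists_strictMono_range_eq (fun b => ?_) (fun b => ?_)
  · refine (finite_besselIntegralOne_zeros b).subset ?_
    rintro r ⟨⟨h1, h2⟩, h3⟩
    exact ⟨⟨h1.le, h3⟩, (hiff r).1 h2⟩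
  · obtain ⟨r, hr, h⟩ := exists_besselIntegralOne_eq_zero (max b 0)
    exact ⟨r, ⟨(le_max_right _ _).trans_lt hr, (hiff r).2 h⟩, (le_max_left _ _).trans_lt hr⟩

/-! ### Tools -/

/-- One-sided maximum principle. -/
theorem false_of_isMax_of_deriv_pos {k : ℝ → ℝ} (hk : Continuous k) {t₀ : ℝ}
    (hmax : ∀ t, k t ≤ k t₀) (h : ∀ᶠ t in 𝓝[≠] t₀, ∃ k', HasDerivAt k k' t ∧ 0 < k') : False := by
  have h' : ∀ᶠ t in 𝓝[>] t₀, ∃ k', HasDerivAt k k' t ∧ 0 < k' :=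
    h.filter_mono (nhdsWithin_mono _ fun t ht => ne_of_gt ht)
  obtain ⟨b, hb, hIoo⟩ := mem_nhdsGT_iff_exists_Ioo_subset.1 h'
  have hb : t₀ < b := hb
  have hmono : StrictMonoOn k (Icc t₀ b) := by
    refine strictMonoOn_of_deriv_pos (convex_Icc _ _) hk.continuousOn fun t ht => ?_
    rw [interior_Icc] at ht
    obtain ⟨k', hk', hpos⟩ := hIoo ht
    rwa [hk'.deriv]
  exact absurd (hmono (left_mem_Icc.2 hb.le) (right_mem_Icc.2 hb.le) hb) (not_lt.2 (hmax b))

/-- A derivative of one strict sign on a punctured neighbourhood excludes a maximum. Reversing time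
reduces the negative sign to the positive one, and the derivative at the point itself, which may be
a switching time, is never used. -/
theorem false_of_isMax_of_deriv_ne {k : ℝ → ℝ} (hk : Continuous k) {t₀ σ : ℝ}
    (hmax : ∀ t, k t ≤ k t₀)
    (h : ∀ᶠ t in 𝓝[≠] t₀, ∃ k', HasDerivAt k k' t ∧ 0 < σ * k') : False := by
  rcases le_or_gt σ 0 with hσ | hσ
  · refine false_of_isMax_of_deriv_pos (k := fun t => k (-t)) (t₀ := -t₀) (by fun_prop)
      (fun t => by simpa using hmax (-t)) ?_
    have htend : Tendsto (fun t : ℝ => -t) (𝓝[≠] (-t₀)) (𝓝[≠] t₀) := by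
      refine tendsto_nhdsWithin_of_tendsto_nhds_of_eventually_within _ ?_ ?_
      · exact ((continuous_neg.tendsto (-t₀)).mono_left nhdsWithin_le_nhds).trans (by simp)
      · filter_upwards [self_mem_nhdsWithin] with t ht hn
        exact ht (by simp [← (show -t = t₀ from hn)])
    filter_upwards [htend.eventually h] with t ⟨k', hk', hpos⟩
    refine ⟨-k', ?_, ?_⟩
    · exact (HasDerivAt.scomp t hk' (hasDerivAt_neg t)).congr_deriv (by simp)
    · rcases hσ.eq_or_lt with rfl | hσ
      · simp at hpos
      · nlinarith
  · refine false_of_isMax_of_deriv_pos hk hmax ?_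
    filter_upwards [h] with t ⟨k', hk', hpos⟩
    exact ⟨k', hk', (mul_pos_iff_of_pos_left hσ).1 hpos⟩

/-- The continuous map on the circle induced by a continuous periodic function. -/
noncomputable def circleLift {E : Type*} [TopologicalSpace E] {φ : ℝ → E} (hc : Continuous φ)
    (hp : Function.Periodic φ (2 * π)) : C(AddCircle (2 * π), E) :=
  ⟨hp.lift, continuous_coinduced_dom.2 hc⟩

/-- The argument jumps by `2π` across the negative real axis, but its class modulo `2π` is
continuous off the origin. -/
theorem continuousAt_periodic_comp_arg {E : Type*} [TopologicalSpace E] {φ : ℝ → E}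
    (hc : Continuous φ) (hp : Function.Periodic φ (2 * π)) {z : ℂ} (hz : z ≠ 0) :
    ContinuousAt (fun z => φ (Complex.arg z)) z :=
  (circleLift hc hp).continuous.continuousAt.comp (Complex.continuousAt_arg_coe_angle hz)

theorem exists_bound_of_periodic {φ : ℝ → ℝ} (hc : Continuous φ)
    (hp : Function.Periodic φ (2 * π)) : ∃ C, 0 < C ∧ ∀ θ, |φ θ| ≤ C := by
  obtain ⟨C, hC⟩ := (isCompact_Icc (a := 0) (b := 2 * π)).exists_bound_of_continuousOn
    hc.continuousOn
  refine ⟨|C| + 1, by positivity, fun θ => ?_⟩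
  obtain ⟨s, hs, h⟩ := hp.exists_mem_Ico₀ two_pi_pos θ
  rw [h]
  exact (hC s (Ico_subset_Icc_self hs)).trans (by linarith [le_abs_self C])

/-! ### Functions that are smooth along a circle of base points -/

section SmoothAlong

variable {E : Type*} [NormedAddCommGroup E] [NormedSpace ℝ E]

/-- `H θ p` is `2π`-periodic in `θ`, and `C¹` near the points `(θ, e)`. -/
structure SmoothAlong (H : ℝ → E → ℝ) (e : E) : Prop where
  contDiffAt : ∀ θ, ContDiffAt ℝ 1 (Function.uncurry H) (θ, e)
  periodic : Function.Periodic H (2 * π)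

/-- The derivative of `H θ` at `e`. -/
noncomputable def sliceDeriv (H : ℝ → E → ℝ) (e : E) (θ : ℝ) : E →L[ℝ] ℝ :=
  (fderiv ℝ (Function.uncurry H) (θ, e)).comp (ContinuousLinearMap.inr ℝ ℝ E)

/-- The function that is `Hp` for angles in the upper half plane and `Hm` in the lower one. -/
noncomputable def piecewiseAngle {α : Type*} (Hp Hm : ℝ → α) (θ : ℝ) : α :=
  if 0 < sin θ then Hp θ else Hm θ

theorem piecewiseAngle_periodic {α : Type*} {Hp Hm : ℝ → α} (hp : Function.Periodic Hp (2 * π))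
    (hm : Function.Periodic Hm (2 * π)) :
    Function.Periodic (piecewiseAngle Hp Hm) (2 * π) := fun θ => by
  simp [piecewiseAngle, hp θ, hm θ]

theorem forall_of_forall_mem_Icc_of_periodic {α : Type*} {H : ℝ → α}
    (hp : Function.Periodic H (2 * π)) {P : α → Prop} (h : ∀ θ ∈ Icc 0 (2 * π), P (H θ)) (θ : ℝ) :
    P (H θ) := by
  obtain ⟨s, hs, h'⟩ := hp.exists_mem_Ico₀ two_pi_pos θ
  rw [h']
  exact h s (Ico_subset_Icc_self hs)

variable {H Hp Hm : ℝ → E → ℝ} {e : E}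

theorem SmoothAlong.continuous_sliceDeriv (hH : SmoothAlong H e) :
    Continuous (sliceDeriv H e) := by
  refine continuous_iff_continuousAt.2 fun θ => ?_
  have h1 : ContinuousAt (fderiv ℝ (Function.uncurry H)) (θ, e) :=
    ((hH.contDiffAt θ).fderiv_right (m := 0) (by simp)).continuousAt
  have h2 : ContinuousAt (fun s : ℝ => fderiv ℝ (Function.uncurry H) (s, e)) θ :=
    ContinuousAt.comp (f := fun s : ℝ => (s, e)) h1 (by fun_prop)
  exact ((ContinuousLinearMap.compL ℝ E (ℝ × E) ℝ).flip
    (ContinuousLinearMap.inr ℝ ℝ E)).continuous.continuousAt.comp h2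

theorem SmoothAlong.sliceDeriv_eq (hH : SmoothAlong H e) (θ : ℝ) :
    sliceDeriv H e θ = fderiv ℝ (H θ) e := by
  have h1 := ((hH.contDiffAt θ).differentiableAt (by simp)).hasFDerivAt
  have h2 : HasFDerivAt (fun p : E => (θ, p)) (ContinuousLinearMap.inr ℝ ℝ E) e :=
    hasFDerivAt_prodMk_right θ e
  exact (h1.comp e h2).fderiv.symm

theorem SmoothAlong.periodic_sliceDeriv (hH : SmoothAlong H e) :
    Function.Periodic (sliceDeriv H e) (2 * π) := fun θ => by
  rw [hH.sliceDeriv_eq, hH.sliceDeriv_eq, hH.periodic θ]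

/-- A `C¹` function is strictly differentiable at each point of the base circle. Compactness of one
period makes the estimate uniform in the angle. -/
theorem SmoothAlong.linearize (hH : SmoothAlong H e) {κ : ℝ} (hκ : 0 < κ) :
    ∀ᶠ p in 𝓝 (e, e), ∀ θ, |H θ p.1 - H θ p.2 - sliceDeriv H e θ (p.1 - p.2)| ≤
      κ * ‖p.1 - p.2‖ := by
  have hK : ∀ᶠ p in 𝓝 (e, e), ∀ θ ∈ Icc 0 (2 * π),
      |H θ p.1 - H θ p.2 - sliceDeriv H e θ (p.1 - p.2)| ≤ κ * ‖p.1 - p.2‖ := by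
    refine isCompact_Icc.eventually_forall_of_forall_eventually fun θ₀ _ => ?_
    have h1 := ((hH.contDiffAt θ₀).hasStrictFDerivAt (by simp)).isLittleO.def (half_pos hκ)
    have h2 : Tendsto (fun z : (E × E) × ℝ => ((z.2, z.1.1), (z.2, z.1.2))) (𝓝 ((e, e), θ₀))
        (𝓝 ((θ₀, e), (θ₀, e))) :=
      Continuous.tendsto' (by fun_prop) _ _ rfl
    have h3 : ∀ᶠ z : (E × E) × ℝ in 𝓝 ((e, e), θ₀),
        ‖sliceDeriv H e z.2 - sliceDeriv H e θ₀‖ < κ / 2 := by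
      have : ContinuousAt (fun z : (E × E) × ℝ => ‖sliceDeriv H e z.2 - sliceDeriv H e θ₀‖)
          ((e, e), θ₀) := by
        have := hH.continuous_sliceDeriv
        fun_prop
      exact this.eventually (gt_mem_nhds (by simpa using half_pos hκ))
    filter_upwards [h2.eventually h1, h3] with z hz1 hz2
    simp only [Function.uncurry_apply_pair, Prod.mk_sub_mk, sub_self, Prod.norm_mk, norm_zero,
      norm_nonneg, sup_of_le_right] at hz1
    have h4 : (fderiv ℝ (Function.uncurry H) (θ₀, e)) (0, z.1.1 - z.1.2) =
      sliceDeriv H e θ₀ (z.1.1 - z.1.2) := rfl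
    rw [h4] at hz1
    have h5 := (sliceDeriv H e z.2 - sliceDeriv H e θ₀).le_of_opNorm_le hz2.le (z.1.1 - z.1.2)
    rw [sub_apply] at h5
    rw [Real.norm_eq_abs] at hz1 h5
    rw [abs_le] at *
    constructor <;> linarith
  filter_upwards [hK] with p hp
  refine forall_of_forall_mem_Icc_of_periodic (H := fun θ => (H θ, sliceDeriv H e θ))
    (P := fun q => |q.1 p.1 - q.1 p.2 - q.2 (p.1 - p.2)| ≤ κ * ‖p.1 - p.2‖) ?_ hp
  intro θ
  simp only [hH.periodic θ, hH.periodic_sliceDeriv θ]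

theorem SmoothAlong.exists_norm_sliceDeriv_le (hH : SmoothAlong H e) :
    ∃ C, 0 < C ∧ ∀ θ, ‖sliceDeriv H e θ‖ ≤ C := by
  obtain ⟨C, hC, h⟩ := exists_bound_of_periodic (φ := fun θ => ‖sliceDeriv H e θ‖)
    hH.continuous_sliceDeriv.norm (fun θ => by simp only [hH.periodic_sliceDeriv θ])
  exact ⟨C, hC, fun θ => (le_abs_self _).trans (h θ)⟩

theorem SmoothAlong.exists_bound (hH : SmoothAlong H e) :
    ∃ L, 0 < L ∧ (∀ᶠ p in 𝓝 (e, e), ∀ θ, |H θ p.1 - H θ p.2| ≤ L * ‖p.1 - p.2‖) ∧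
      ∀ᶠ p in 𝓝 e, ∀ θ, |H θ p| ≤ L := by
  obtain ⟨C, hC, hD⟩ := hH.exists_norm_sliceDeriv_le
  have hc : Continuous (fun θ => H θ e) := continuous_iff_continuousAt.2 fun θ =>
    ContinuousAt.comp (f := fun θ : ℝ => (θ, e)) (hH.contDiffAt θ).continuousAt (by fun_prop)
  obtain ⟨B, hB, hb⟩ := exists_bound_of_periodic hc (fun θ => by simp only [hH.periodic θ])
  have hlip : ∀ᶠ p in 𝓝 (e, e), ∀ θ, |H θ p.1 - H θ p.2| ≤ (C + 1) * ‖p.1 - p.2‖ := by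
    filter_upwards [hH.linearize one_pos] with p hp θ
    have h1 := hp θ
    have h2 := (sliceDeriv H e θ).le_of_opNorm_le (hD θ) (p.1 - p.2)
    rw [Real.norm_eq_abs] at h2
    rw [abs_le] at *
    constructor <;> linarith
  refine ⟨C + 1 + B, by positivity, ?_, ?_⟩
  · filter_upwards [hlip] with p hp θ
    have := norm_nonneg (p.1 - p.2)
    exact (hp θ).trans (by gcongr ?_ * _; linarith)
  · have h1 : Tendsto (fun p : E => (p, e)) (𝓝 e) (𝓝 (e, e)) :=
      Continuous.tendsto' (by fun_prop) _ _ rfl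
    filter_upwards [h1.eventually hlip, Metric.closedBall_mem_nhds e one_pos] with p hp hp1 θ
    have h2 := hp θ
    have h3 := hb θ
    rw [Metric.mem_closedBall, dist_eq_norm] at hp1
    have h4 : (C + 1) * ‖p - e‖ ≤ C + 1 := mul_le_of_le_one_right (by positivity) hp1
    rw [abs_le] at *
    constructor <;> linarith

theorem SmoothAlong.eventually_continuousAt (hH : SmoothAlong H e) :
    ∀ᶠ p in 𝓝 e, ∀ θ, ContinuousAt (Function.uncurry H) (θ, p) := by
  have hK : ∀ᶠ p in 𝓝 e, ∀ θ ∈ Icc (-π) (3 * π), ContinuousAt (Function.uncurry H) (θ, p) := by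
    refine isCompact_Icc.eventually_forall_of_forall_eventually fun θ₀ _ => ?_
    have h1 := (hH.contDiffAt θ₀).eventually (by simp)
    have h2 : Tendsto (fun z : E × ℝ => (z.2, z.1)) (𝓝 (e, θ₀)) (𝓝 (θ₀, e)) :=
      Continuous.tendsto' (by fun_prop) _ _ rfl
    filter_upwards [h2.eventually h1] with z hz using hz.continuousAt
  filter_upwards [hK] with p hp θ
  obtain ⟨n, hn, -⟩ := existsUnique_add_zsmul_mem_Ico two_pi_pos θ 0
  have h1 := hp (θ + n • (2 * π)) ⟨by linarith [hn.1, pi_pos], by linarith [hn.2, pi_pos]⟩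
  have h2 : (Function.uncurry H) = fun z : ℝ × E => Function.uncurry H (z.1 + n • (2 * π), z.2) := by
    ext z
    simp only [Function.uncurry]
    rw [(hH.periodic.zsmul n) z.1]
  rw [h2]
  exact ContinuousAt.comp (f := fun z : ℝ × E => (z.1 + n • (2 * π), z.2)) (x := (θ, p)) h1
    (by fun_prop)

/-- Uniform bounds on a ball around the base point. -/
structure UniformOn (Hp Hm : ℝ → E → ℝ) (e : E) (δ L : ℝ) : Prop where
  bound : ∀ θ p, ‖p - e‖ ≤ δ → |piecewiseAngle Hp Hm θ p| ≤ L
  lipschitz : ∀ θ p q, ‖p - e‖ ≤ δ → ‖q - e‖ ≤ δ →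
    |piecewiseAngle Hp Hm θ p - piecewiseAngle Hp Hm θ q| ≤ L * ‖p - q‖
  continuous_upper : ∀ θ p, ‖p - e‖ ≤ δ → ContinuousAt (Function.uncurry Hp) (θ, p)
  continuous_lower : ∀ θ p, ‖p - e‖ ≤ δ → ContinuousAt (Function.uncurry Hm) (θ, p)

theorem UniformOn.mono {δ L δ' L' : ℝ} (h : UniformOn Hp Hm e δ L) (hδ : δ' ≤ δ) (hL : L ≤ L') :
    UniformOn Hp Hm e δ' L' where
  bound θ p hp := (h.bound θ p (hp.trans hδ)).trans hL
  lipschitz θ p q hp hq := (h.lipschitz θ p q (hp.trans hδ) (hq.trans hδ)).trans (by gcongr)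
  continuous_upper θ p hp := h.continuous_upper θ p (hp.trans hδ)
  continuous_lower θ p hp := h.continuous_lower θ p (hp.trans hδ)

theorem exists_forall_norm_le_of_eventually {P : E → Prop} (h : ∀ᶠ p in 𝓝 e, P p) :
    ∃ δ, 0 < δ ∧ ∀ p, ‖p - e‖ ≤ δ → P p := by
  obtain ⟨δ, hδ, h⟩ := Metric.nhds_basis_closedBall.eventually_iff.1 h
  exact ⟨δ, hδ, fun p hp => h (by rwa [Metric.mem_closedBall, dist_eq_norm])⟩

theorem exists_forall_norm_le_of_eventually_prod {P : E × E → Prop} (h : ∀ᶠ p in 𝓝 (e, e), P p) :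
    ∃ δ, 0 < δ ∧ ∀ p q, ‖p - e‖ ≤ δ → ‖q - e‖ ≤ δ → P (p, q) := by
  obtain ⟨δ, hδ, h⟩ := exists_forall_norm_le_of_eventually h
  exact ⟨δ, hδ, fun p q hp hq => h (p, q) (by simp [Prod.norm_def, hp, hq])⟩

theorem exists_uniformOn (hp : SmoothAlong Hp e) (hm : SmoothAlong Hm e) :
    ∃ δ L, 0 < δ ∧ 0 < L ∧ UniformOn Hp Hm e δ L := by
  obtain ⟨L₁, hL₁, hl₁, hb₁⟩ := hp.exists_bound
  obtain ⟨L₂, hL₂, hl₂, hb₂⟩ := hm.exists_bound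
  obtain ⟨δ₁, hδ₁, h₁⟩ := exists_forall_norm_le_of_eventually_prod (hl₁.and hl₂)
  obtain ⟨δ₂, hδ₂, h₂⟩ := exists_forall_norm_le_of_eventually ((hb₁.and hb₂).and
    (hp.eventually_continuousAt.and hm.eventually_continuousAt))
  refine ⟨min δ₁ δ₂, max L₁ L₂, lt_min hδ₁ hδ₂, lt_max_of_lt_left hL₁, ?_, ?_, ?_, ?_⟩
  · intro θ p h
    have := h₂ p (h.trans (min_le_right _ _))
    unfold piecewiseAngle
    split_ifs
    · exact (this.1.1 θ).trans (le_max_left _ _)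
    · exact (this.1.2 θ).trans (le_max_right _ _)
  · intro θ p q h h'
    have := h₁ p q (h.trans (min_le_left _ _)) (h'.trans (min_le_left _ _))
    unfold piecewiseAngle
    split_ifs
    · exact (this.1 θ).trans (by gcongr; exact le_max_left _ _)
    · exact (this.2 θ).trans (by gcongr; exact le_max_right _ _)
  · exact fun θ p h => (h₂ p (h.trans (min_le_right _ _))).2.1 θ
  · exact fun θ p h => (h₂ p (h.trans (min_le_right _ _))).2.2 θ

theorem exists_linearize (hp : SmoothAlong Hp e) (hm : SmoothAlong Hm e) {κ : ℝ} (hκ : 0 < κ) :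
    ∃ δ, 0 < δ ∧ ∀ p q, ‖p - e‖ ≤ δ → ‖q - e‖ ≤ δ → ∀ θ,
      |piecewiseAngle Hp Hm θ p - piecewiseAngle Hp Hm θ q -
        piecewiseAngle (sliceDeriv Hp e) (sliceDeriv Hm e) θ (p - q)| ≤ κ * ‖p - q‖ := by
  obtain ⟨δ, hδ, h⟩ := exists_forall_norm_le_of_eventually_prod
    ((hp.linearize hκ).and (hm.linearize hκ))
  refine ⟨δ, hδ, fun p q h₁ h₂ θ => ?_⟩
  unfold piecewiseAngle
  split_ifs
  · exact (h p q h₁ h₂).1 θ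
  · exact (h p q h₁ h₂).2 θ

end SmoothAlong

/-! ### Periodic solutions of averaged systems -/

section Primitives

variable {g g₁ g₂ : ℝ → ℝ} {B : ℝ}

theorem intervalIntegrable_of_measurable_of_bound (hm : Measurable g) (hB : ∀ s, |g s| ≤ B)
    (a b : ℝ) : IntervalIntegrable g volume a b :=
  (intervalIntegrable_const (c := B)).mono_fun' hm.aestronglyMeasurable
    (Eventually.of_forall hB)

/-- The periodic primitive of `g` minus its mean that vanishes at `0`. -/
noncomputable def centredPrimitive (g : ℝ → ℝ) (θ : ℝ) : ℝ :=
  (∫ s in (0 : ℝ)..θ, g s) - θ / (2 * π) * ∫ s in (0 : ℝ)..(2 * π), g s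

/-- The periodic solution of `w' = -w + g`. -/
noncomputable def decayPrimitive (g : ℝ → ℝ) (θ : ℝ) : ℝ :=
  (exp (2 * π) - 1)⁻¹ * (exp (-θ) * ((∫ s in (0 : ℝ)..(θ + 2 * π), exp s * g s) -
    ∫ s in (0 : ℝ)..θ, exp s * g s))

/-- A common bound of the norms of the two primitive operators. -/
noncomputable def primitiveBound : ℝ := 4 * π + (exp (2 * π) - 1)⁻¹ * (exp (2 * π) * (2 * π))

theorem exp_two_pi_sub_one_pos : 0 < exp (2 * π) - 1 :=
  sub_pos.2 (one_lt_exp_iff.2 two_pi_pos)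

theorem primitiveBound_pos : 0 < primitiveBound := by
  have := exp_two_pi_sub_one_pos
  have := pi_pos
  unfold primitiveBound
  positivity

theorem continuous_centredPrimitive (hm : Measurable g) (hB : ∀ s, |g s| ≤ B) :
    Continuous (centredPrimitive g) :=
  (intervalIntegral.continuous_primitive (intervalIntegrable_of_measurable_of_bound hm hB) 0).sub
    (by fun_prop)

theorem centredPrimitive_periodic (hm : Measurable g) (hB : ∀ s, |g s| ≤ B)
    (hp : Function.Periodic g (2 * π)) : Function.Periodic (centredPrimitive g) (2 * π) := by
  intro θ
  have hi := intervalIntegrable_of_measurable_of_bound hm hB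
  unfold centredPrimitive
  rw [← integral_add_adjacent_intervals (hi 0 θ) (hi θ (θ + 2 * π)),
    hp.intervalIntegral_add_eq θ 0, zero_add, add_div, div_self two_pi_pos.ne']
  ring

theorem centredPrimitive_sub (hm₁ : Measurable g₁) (hB₁ : ∀ s, |g₁ s| ≤ B)
    (hm₂ : Measurable g₂) (hB₂ : ∀ s, |g₂ s| ≤ B) (θ : ℝ) :
    centredPrimitive g₁ θ - centredPrimitive g₂ θ = centredPrimitive (fun s => g₁ s - g₂ s) θ := by
  have h1 := intervalIntegrable_of_measurable_of_bound hm₁ hB₁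
  have h2 := intervalIntegrable_of_measurable_of_bound hm₂ hB₂
  unfold centredPrimitive
  rw [integral_sub (h1 _ _) (h2 _ _), integral_sub (h1 _ _) (h2 _ _)]
  ring

theorem abs_centredPrimitive_le (hm : Measurable g) (hB : ∀ s, |g s| ≤ B)
    (hp : Function.Periodic g (2 * π)) (θ : ℝ) : |centredPrimitive g θ| ≤ primitiveBound * B := by
  have hB0 : 0 ≤ B := (abs_nonneg _).trans (hB 0)
  refine forall_of_forall_mem_Icc_of_periodic (centredPrimitive_periodic hm hB hp)
    (P := fun x => |x| ≤ primitiveBound * B) (fun θ hθ => ?_) θ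
  have h1 : ‖∫ s in (0 : ℝ)..θ, g s‖ ≤ B * |θ - 0| :=
    intervalIntegral.norm_integral_le_of_norm_le_const fun s _ => hB s
  have h2 : ‖∫ s in (0 : ℝ)..(2 * π), g s‖ ≤ B * |2 * π - 0| :=
    intervalIntegral.norm_integral_le_of_norm_le_const fun s _ => hB s
  rw [sub_zero, abs_of_nonneg hθ.1] at h1
  rw [sub_zero, abs_of_pos two_pi_pos] at h2
  have h3 : |θ / (2 * π)| ≤ 1 := by
    rw [abs_of_nonneg (div_nonneg hθ.1 two_pi_pos.le), div_le_one two_pi_pos]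
    exact hθ.2
  calc |centredPrimitive g θ| ≤ |∫ s in (0 : ℝ)..θ, g s| +
        |θ / (2 * π) * ∫ s in (0 : ℝ)..(2 * π), g s| := abs_sub _ _
    _ ≤ B * θ + 1 * (B * (2 * π)) := by
        rw [abs_mul]
        exact add_le_add h1 (mul_le_mul h3 h2 (abs_nonneg _) zero_le_one)
    _ ≤ B * (2 * π) + 1 * (B * (2 * π)) := by gcongr; exact hθ.2
    _ = 4 * π * B := by ring
    _ ≤ primitiveBound * B := by
        have := exp_two_pi_sub_one_pos
        have := pi_pos
        gcongr
        unfold primitiveBound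
        exact le_add_of_nonneg_right (by positivity)

theorem hasDerivAt_centredPrimitive (hm : Measurable g) (hB : ∀ s, |g s| ≤ B) {θ : ℝ}
    (hc : ContinuousAt g θ) : HasDerivAt (centredPrimitive g)
      (g θ - (2 * π)⁻¹ * ∫ s in (0 : ℝ)..(2 * π), g s) θ := by
  have h1 := intervalIntegral.integral_hasDerivAt_right
    (intervalIntegrable_of_measurable_of_bound hm hB 0 θ)
    hm.stronglyMeasurable.stronglyMeasurableAtFilter hc
  refine (h1.sub (((hasDerivAt_id θ).div_const (2 * π)).mul_const _)).congr_deriv ?_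
  simp

theorem intervalIntegrable_exp_mul (hm : Measurable g) (hB : ∀ s, |g s| ≤ B) (a b : ℝ) :
    IntervalIntegrable (fun s => exp s * g s) volume a b :=
  (intervalIntegrable_of_measurable_of_bound hm hB a b).continuousOn_mul continuous_exp.continuousOn

theorem continuous_decayPrimitive (hm : Measurable g) (hB : ∀ s, |g s| ≤ B) :
    Continuous (decayPrimitive g) := by
  have h := intervalIntegral.continuous_primitive (intervalIntegrable_exp_mul hm hB) 0
  unfold decayPrimitive
  exact continuous_const.mul ((by fun_prop : Continuous fun θ : ℝ => exp (-θ)).mul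
    ((h.comp (by fun_prop : Continuous fun θ : ℝ => θ + 2 * π)).sub h))

/-- Written over one fixed period, the integral shows both periodicity and the uniform bound. -/
theorem decayPrimitive_eq (hm : Measurable g) (hB : ∀ s, |g s| ≤ B) (θ : ℝ) :
    decayPrimitive g θ = (exp (2 * π) - 1)⁻¹ * ∫ s in (0 : ℝ)..(2 * π), exp s * g (θ + s) := by
  have hi := intervalIntegrable_exp_mul hm hB
  unfold decayPrimitive
  rw [integral_interval_sub_left (hi _ _) (hi _ _)]
  congr 1
  have h := intervalIntegral.integral_comp_add_left (a := 0) (b := 2 * π)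
    (fun s => exp s * g s) θ
  rw [add_zero] at h
  rw [← h, ← intervalIntegral.integral_const_mul]
  congr 1
  ext s
  rw [exp_add, exp_neg]
  field_simp

theorem decayPrimitive_periodic (hm : Measurable g) (hB : ∀ s, |g s| ≤ B)
    (hp : Function.Periodic g (2 * π)) : Function.Periodic (decayPrimitive g) (2 * π) := by
  intro θ
  rw [decayPrimitive_eq hm hB, decayPrimitive_eq hm hB]
  simp_rw [add_right_comm θ (2 * π), hp _]

theorem decayPrimitive_sub (hm₁ : Measurable g₁) (hB₁ : ∀ s, |g₁ s| ≤ B)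
    (hm₂ : Measurable g₂) (hB₂ : ∀ s, |g₂ s| ≤ B) (θ : ℝ) :
    decayPrimitive g₁ θ - decayPrimitive g₂ θ = decayPrimitive (fun s => g₁ s - g₂ s) θ := by
  have h1 := intervalIntegrable_exp_mul hm₁ hB₁
  have h2 := intervalIntegrable_exp_mul hm₂ hB₂
  unfold decayPrimitive
  simp_rw [mul_sub (exp _) (g₁ _)]
  rw [integral_sub (h1 _ _) (h2 _ _), integral_sub (h1 _ _) (h2 _ _)]
  ring

theorem abs_decayPrimitive_le (hm : Measurable g) (hB : ∀ s, |g s| ≤ B) (θ : ℝ) :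
    |decayPrimitive g θ| ≤ primitiveBound * B := by
  have hB0 : 0 ≤ B := (abs_nonneg _).trans (hB 0)
  have hE := exp_two_pi_sub_one_pos
  have hpi := pi_pos
  have h1 : ‖∫ s in (0 : ℝ)..(2 * π), exp s * g (θ + s)‖ ≤ (exp (2 * π) * B) * |2 * π - 0| := by
    refine intervalIntegral.norm_integral_le_of_norm_le_const fun s hs => ?_
    rw [uIoc_of_le two_pi_pos.le] at hs
    rw [norm_mul, Real.norm_eq_abs, abs_exp]
    exact mul_le_mul (exp_le_exp.2 hs.2) (hB _) (norm_nonneg _) (exp_pos _).le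
  rw [sub_zero, abs_of_pos two_pi_pos, Real.norm_eq_abs] at h1
  rw [decayPrimitive_eq hm hB, abs_mul, abs_of_pos (inv_pos.2 hE)]
  calc _ ≤ (exp (2 * π) - 1)⁻¹ * (exp (2 * π) * B * (2 * π)) := by gcongr
    _ = (exp (2 * π) - 1)⁻¹ * (exp (2 * π) * (2 * π)) * B := by ring
    _ ≤ primitiveBound * B := by
        gcongr
        unfold primitiveBound
        exact le_add_of_nonneg_left (by positivity)

theorem hasDerivAt_decayPrimitive (hm : Measurable g) (hB : ∀ s, |g s| ≤ B)
    (hp : Function.Periodic g (2 * π)) {θ : ℝ} (hc : ContinuousAt g θ) :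
    HasDerivAt (decayPrimitive g) (-decayPrimitive g θ + g θ) θ := by
  have hm' : Measurable fun s => exp s * g s := measurable_exp.mul hm
  have hc' : ContinuousAt g (θ + 2 * π) := by
    have : g = fun s => g (s - 2 * π) := by
      ext s
      rw [hp.sub_eq]
    rw [this]
    exact ContinuousAt.comp (f := fun s : ℝ => s - 2 * π) (by simpa using hc) (by fun_prop)
  have h1 := intervalIntegral.integral_hasDerivAt_right (intervalIntegrable_exp_mul hm hB 0 θ)
    hm'.stronglyMeasurable.stronglyMeasurableAtFilter (continuous_exp.continuousAt.mul hc)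
  have h2 := intervalIntegral.integral_hasDerivAt_right
    (intervalIntegrable_exp_mul hm hB 0 (θ + 2 * π))
    hm'.stronglyMeasurable.stronglyMeasurableAtFilter (continuous_exp.continuousAt.mul hc')
  have h2 := h2.comp_add_const θ (2 * π)
  have h3 := (((hasDerivAt_neg θ).exp).mul (h2.sub h1)).const_mul (exp (2 * π) - 1)⁻¹
  refine h3.congr_deriv ?_
  have hE := exp_two_pi_sub_one_pos.ne'
  have hθ : exp (-θ) * exp θ = 1 := by rw [← exp_add]; simp
  simp only [decayPrimitive, Pi.sub_apply]
  rw [hp θ, exp_add]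
  field_simp
  linear_combination (g θ * (exp (2 * π) - 1)) * hθ

end Primitives

/-! ### The contraction behind the averaged system -/

section Picard

/-- A planar system that is measurable, bounded, Lipschitz and periodic in `θ`. -/
structure BoundedSystem (F : ℝ → ℝ × ℝ → ℝ) (L : ℝ) : Prop where
  measurable : ∀ u : ℝ → ℝ × ℝ, Continuous u → Measurable fun s => F s (u s)
  bound : ∀ s p, |F s p| ≤ L
  lipschitz : ∀ s p q, |F s p - F s q| ≤ L * ‖p - q‖
  periodic : Function.Periodic F (2 * π)

variable {F G : ℝ → ℝ × ℝ → ℝ} {L : ℝ}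

theorem continuous_coe_circle (u : C(AddCircle (2 * π), ℝ × ℝ)) :
    Continuous fun s : ℝ => u (s : AddCircle (2 * π)) :=
  u.continuous.comp (AddCircle.continuous_mk' _)

theorem BoundedSystem.periodic_comp (hF : BoundedSystem F L) {u : ℝ → ℝ × ℝ}
    (hu : Function.Periodic u (2 * π)) : Function.Periodic (fun s => F s (u s)) (2 * π) :=
  fun s => by simp only [hF.periodic s, hu s]

theorem periodic_coe_circle (u : C(AddCircle (2 * π), ℝ × ℝ)) :
    Function.Periodic (fun s : ℝ => u (s : AddCircle (2 * π))) (2 * π) := fun s => by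
  simp

/-- The Picard map whose fixed points solve the system up to the mean of `F`. -/
noncomputable def picardStep (hF : BoundedSystem F L) (hG : BoundedSystem G L) (ε ρ : ℝ)
    (u : C(AddCircle (2 * π), ℝ × ℝ)) : C(AddCircle (2 * π), ℝ × ℝ) :=
  circleLift (φ := fun θ : ℝ => (ρ + ε * centredPrimitive (fun s => F s (u s)) θ,
    ε * decayPrimitive (fun s => G s (u s)) θ))
    ((continuous_const.add (continuous_const.mul (continuous_centredPrimitive
      (hF.measurable _ (continuous_coe_circle u)) (fun s => hF.bound s _)))).prodMk
      (continuous_const.mul (continuous_decayPrimitive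
      (hG.measurable _ (continuous_coe_circle u)) (fun s => hG.bound s _))))
    (fun θ => by
      have h1 := centredPrimitive_periodic (hF.measurable _ (continuous_coe_circle u))
        (fun s => hF.bound s _) (hF.periodic_comp (periodic_coe_circle u)) θ
      have h2 := decayPrimitive_periodic (hG.measurable _ (continuous_coe_circle u))
        (fun s => hG.bound s _) (hG.periodic_comp (periodic_coe_circle u)) θ
      simp only [h1, h2])

theorem picardStep_coe (hF : BoundedSystem F L) (hG : BoundedSystem G L) (ε ρ : ℝ)
    (u : C(AddCircle (2 * π), ℝ × ℝ)) (θ : ℝ) : picardStep hF hG ε ρ u (θ : AddCircle (2 * π)) =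
      (ρ + ε * centredPrimitive (fun s => F s (u s)) θ,
        ε * decayPrimitive (fun s => G s (u s)) θ) := rfl

theorem dist_picardStep_le [Fact (0 < 2 * π)] (hL : 0 ≤ L) (hF : BoundedSystem F L) (hG : BoundedSystem G L)
    {ε : ℝ} (hε : |ε| * (primitiveBound * L) ≤ 1 / 2) (ρ : ℝ)
    (u v : C(AddCircle (2 * π), ℝ × ℝ)) :
    dist (picardStep hF hG ε ρ u) (picardStep hF hG ε ρ v) ≤ 1 / 2 * dist u v := by
  have hb := primitiveBound_pos
  rw [ContinuousMap.dist_le (by positivity)]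
  intro x
  obtain ⟨θ, rfl⟩ := QuotientAddGroup.mk_surjective x
  have hd : ∀ s : ℝ, ‖u (s : AddCircle (2 * π)) - v (s : AddCircle (2 * π))‖ ≤ dist u v :=
    fun s => by
      rw [← dist_eq_norm]
      exact ContinuousMap.dist_apply_le_dist _
  have hFd : ∀ s : ℝ, |F s (u s) - F s (v s)| ≤ L * dist u v := fun s =>
    (hF.lipschitz s _ _).trans (by gcongr; exact hd s)
  have hGd : ∀ s : ℝ, |G s (u s) - G s (v s)| ≤ L * dist u v := fun s =>
    (hG.lipschitz s _ _).trans (by gcongr; exact hd s)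
  have hFu := hF.measurable _ (continuous_coe_circle u)
  have hFv := hF.measurable _ (continuous_coe_circle v)
  have hGu := hG.measurable _ (continuous_coe_circle u)
  have hGv := hG.measurable _ (continuous_coe_circle v)
  have key : |ε| * (primitiveBound * (L * dist u v)) ≤ 1 / 2 * dist u v := by
    have := mul_le_mul_of_nonneg_right hε (dist_nonneg (x := u) (y := v))
    linarith
  change dist (picardStep hF hG ε ρ u (θ : AddCircle (2 * π)))
    (picardStep hF hG ε ρ v (θ : AddCircle (2 * π))) ≤ _
  rw [picardStep_coe, picardStep_coe, Prod.dist_eq, Real.dist_eq, Real.dist_eq, max_le_iff]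
  constructor
  · rw [add_sub_add_left_eq_sub, ← mul_sub,
      centredPrimitive_sub hFu (fun s => hF.bound s _) hFv (fun s => hF.bound s _), abs_mul]
    refine le_trans ?_ key
    gcongr
    exact abs_centredPrimitive_le (hFu.sub hFv) hFd (fun s => by
      have h1 := hF.periodic_comp (periodic_coe_circle u) s
      have h2 := hF.periodic_comp (periodic_coe_circle v) s
      exact congrArg₂ (· - ·) h1 h2) θ
  · rw [← mul_sub,
      decayPrimitive_sub hGu (fun s => hG.bound s _) hGv (fun s => hG.bound s _), abs_mul]
    refine le_trans ?_ key
    gcongr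
    exact abs_decayPrimitive_le (hGu.sub hGv) hGd θ

/-- The Picard map contracts by `1/2` for small `ε`, so each base radius has its own fixed point.
The mean of `F` along it is the only obstruction to a true solution, and its continuity in `ρ`
prepares the intermediate value argument. -/
theorem exists_averaged_family (hL : 0 ≤ L) (hF : BoundedSystem F L) (hG : BoundedSystem G L)
    {ε : ℝ} (hε : |ε| * (primitiveBound * L) ≤ 1 / 2) :
    ∃ u : ℝ → ℝ → ℝ × ℝ, (∀ ρ, Continuous (u ρ) ∧ Function.Periodic (u ρ) (2 * π) ∧
      ∀ θ, u ρ θ = (ρ + ε * centredPrimitive (fun s => F s (u ρ s)) θ,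
        ε * decayPrimitive (fun s => G s (u ρ s)) θ)) ∧
      Continuous fun ρ => ∫ s in (0 : ℝ)..(2 * π), F s (u ρ s) := by
  have : Fact (0 < 2 * π) := ⟨two_pi_pos⟩
  have hc : ∀ ρ, ContractingWith (1 / 2) (picardStep hF hG ε ρ) := fun ρ =>
    ⟨by rw [← NNReal.coe_lt_coe]; norm_num, LipschitzWith.of_dist_le_mul fun u v => by
      simpa using dist_picardStep_le hL hF hG hε ρ u v⟩
  set U := fun ρ => ContractingWith.fixedPoint (picardStep hF hG ε ρ) (hc ρ) with hU
  have hfix : ∀ ρ, picardStep hF hG ε ρ (U ρ) = U ρ := fun ρ => (hc ρ).fixedPoint_isFixedPt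
  have hlip : ∀ ρ ρ', dist (U ρ) (U ρ') ≤ 2 * |ρ - ρ'| := by
    intro ρ ρ'
    have := (hc ρ).fixedPoint_lipschitz_in_map (hc ρ') (C := |ρ - ρ'|) fun z => by
      rw [ContinuousMap.dist_le (abs_nonneg _)]
      intro x
      obtain ⟨θ, rfl⟩ := QuotientAddGroup.mk_surjective x
      change dist (picardStep hF hG ε ρ z (θ : AddCircle (2 * π)))
        (picardStep hF hG ε ρ' z (θ : AddCircle (2 * π))) ≤ _
      rw [picardStep_coe, picardStep_coe, Prod.dist_eq, Real.dist_eq, Real.dist_eq]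
      simp
    refine this.trans (le_of_eq ?_)
    norm_num
    ring
  refine ⟨fun ρ s => U ρ (s : AddCircle (2 * π)), fun ρ => ⟨continuous_coe_circle _,
    periodic_coe_circle _, fun θ => ?_⟩, ?_⟩
  · change U ρ (θ : AddCircle (2 * π)) = _
    conv_lhs => rw [← hfix ρ]
    rfl
  · have hi : ∀ ρ, IntervalIntegrable (fun s => F s (U ρ (s : AddCircle (2 * π)))) volume 0
        (2 * π) := fun ρ => intervalIntegrable_of_measurable_of_bound
      (hF.measurable _ (continuous_coe_circle _)) (fun s => hF.bound s _) _ _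
    have hlip' : LipschitzWith (Real.toNNReal (L * 2 * (2 * π)))
        fun ρ => ∫ s in (0 : ℝ)..(2 * π), F s (U ρ (s : AddCircle (2 * π))) := by
      refine LipschitzWith.of_dist_le_mul fun ρ ρ' => ?_
      rw [Real.dist_eq, ← integral_sub (hi ρ) (hi ρ'), Real.coe_toNNReal _ (by positivity),
        Real.dist_eq]
      have := intervalIntegral.norm_integral_le_of_norm_le_const (a := 0) (b := 2 * π)
        (f := fun s => F s (U ρ (s : AddCircle (2 * π))) - F s (U ρ' (s : AddCircle (2 * π))))
        (C := L * (2 * |ρ - ρ'|)) fun s _ => by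
          refine (hF.lipschitz s _ _).trans ?_
          gcongr
          rw [← dist_eq_norm]
          exact (ContinuousMap.dist_apply_le_dist _).trans (hlip ρ ρ')
      rw [sub_zero, abs_of_pos two_pi_pos, Real.norm_eq_abs] at this
      linarith
    exact hlip'.continuous

end Picard

/-! ### Truncation to a box and first order averaging -/

/-- Truncation of `(ε, p)` to a box around `(0, r, 0)`. -/
noncomputable def boxClamp (r δ ε : ℝ) (p : ℝ × ℝ) : ℝ × ℝ × ℝ :=
  (ε, max (r - δ) (min (r + δ) p.1), max (-δ) (min δ p.2))

theorem abs_max_min_sub_le (a b x y : ℝ) : |max a (min b x) - max a (min b y)| ≤ |x - y| := by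
  refine (abs_max_sub_max_le_max _ _ _ _).trans ?_
  rw [sub_self, abs_zero, max_eq_right (abs_nonneg _)]
  refine (abs_min_sub_min_le_max _ _ _ _).trans ?_
  rw [sub_self, abs_zero, max_eq_right (abs_nonneg _)]

theorem norm_boxClamp_sub_le (r δ ε : ℝ) (p q : ℝ × ℝ) :
    ‖boxClamp r δ ε p - boxClamp r δ ε q‖ ≤ ‖p - q‖ := by
  simp only [boxClamp, Prod.mk_sub_mk, Prod.norm_def, sub_self, norm_zero, Real.norm_eq_abs,
    Prod.fst_sub, Prod.snd_sub]
  refine max_le (le_max_of_le_left (abs_nonneg _)) ?_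
  exact max_le_max (abs_max_min_sub_le _ _ _ _) (abs_max_min_sub_le _ _ _ _)

theorem norm_boxClamp_sub_base_le {r δ ε : ℝ} (hε : |ε| ≤ δ) (p : ℝ × ℝ) :
    ‖boxClamp r δ ε p - ((0, r, 0) : ℝ × ℝ × ℝ)‖ ≤ δ := by
  have hδ : 0 ≤ δ := (abs_nonneg _).trans hε
  simp only [boxClamp, Prod.mk_sub_mk, Prod.norm_def, sub_zero, Real.norm_eq_abs]
  refine max_le hε (max_le ?_ ?_)
  · rw [abs_le]
    constructor
    · linarith [le_max_left (r - δ) (min (r + δ) p.1)]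
    · have : max (r - δ) (min (r + δ) p.1) ≤ r + δ := max_le (by linarith) (min_le_left _ _)
      linarith
  · rw [abs_le]
    exact ⟨le_max_left _ _, max_le (by linarith) (min_le_left _ _)⟩

theorem boxClamp_eq {r δ ε : ℝ} {p : ℝ × ℝ} (h1 : |p.1 - r| ≤ δ) (h2 : |p.2| ≤ δ) :
    boxClamp r δ ε p = (ε, p.1, p.2) := by
  rw [abs_le] at h1 h2
  simp only [boxClamp]
  rw [min_eq_right (by linarith), max_eq_right (by linarith), min_eq_right h2.2,
    max_eq_right h2.1]

theorem continuous_boxClamp (r δ ε : ℝ) : Continuous (boxClamp r δ ε) := by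
  unfold boxClamp
  fun_prop

theorem measurable_piecewiseAngle {p m : ℝ → ℝ} (hp : Continuous p) (hm : Continuous m) :
    Measurable (piecewiseAngle p m) :=
  Measurable.ite (measurableSet_lt measurable_const measurable_sin) hp.measurable hm.measurable

theorem continuousAt_piecewiseAngle {p m : ℝ → ℝ} (hp : Continuous p) (hm : Continuous m) {θ : ℝ}
    (hθ : sin θ ≠ 0) : ContinuousAt (piecewiseAngle p m) θ := by
  rcases hθ.lt_or_gt with h | h
  · refine hm.continuousAt.congr ?_
    filter_upwards [continuous_sin.continuousAt.eventually (gt_mem_nhds h)] with s hs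
    simp [piecewiseAngle, hs.le.not_gt]
  · refine hp.continuousAt.congr ?_
    filter_upwards [continuous_sin.continuousAt.eventually (lt_mem_nhds h)] with s hs
    simp [piecewiseAngle, hs]

theorem UniformOn.continuous_upper_comp {Fp Fm : ℝ → ℝ × ℝ × ℝ → ℝ} {e : ℝ × ℝ × ℝ} {δ L : ℝ}
    (h : UniformOn Fp Fm e δ L) {u : ℝ → ℝ × ℝ × ℝ} (hu : Continuous u)
    (hδ : ∀ s, ‖u s - e‖ ≤ δ) : Continuous fun s => Fp s (u s) :=
  continuous_iff_continuousAt.2 fun s => ContinuousAt.comp (f := fun s : ℝ => (s, u s))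
    (h.continuous_upper s _ (hδ s)) (by fun_prop)

theorem UniformOn.continuous_lower_comp {Fp Fm : ℝ → ℝ × ℝ × ℝ → ℝ} {e : ℝ × ℝ × ℝ} {δ L : ℝ}
    (h : UniformOn Fp Fm e δ L) {u : ℝ → ℝ × ℝ × ℝ} (hu : Continuous u)
    (hδ : ∀ s, ‖u s - e‖ ≤ δ) : Continuous fun s => Fm s (u s) :=
  continuous_iff_continuousAt.2 fun s => ContinuousAt.comp (f := fun s : ℝ => (s, u s))
    (h.continuous_lower s _ (hδ s)) (by fun_prop)

theorem piecewiseAngle_apply (Fp Fm : ℝ → ℝ × ℝ × ℝ → ℝ) (u : ℝ → ℝ × ℝ × ℝ) :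
    (fun s => piecewiseAngle Fp Fm s (u s)) =
      piecewiseAngle (fun s => Fp s (u s)) (fun s => Fm s (u s)) := by
  ext s
  unfold piecewiseAngle
  split_ifs <;> rfl

theorem UniformOn.measurable_comp {Fp Fm : ℝ → ℝ × ℝ × ℝ → ℝ} {e : ℝ × ℝ × ℝ} {δ L : ℝ}
    (h : UniformOn Fp Fm e δ L) {u : ℝ → ℝ × ℝ × ℝ} (hu : Continuous u)
    (hδ : ∀ s, ‖u s - e‖ ≤ δ) : Measurable fun s => piecewiseAngle Fp Fm s (u s) := by
  rw [piecewiseAngle_apply]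
  exact measurable_piecewiseAngle (h.continuous_upper_comp hu hδ) (h.continuous_lower_comp hu hδ)

theorem UniformOn.continuousAt_comp {Fp Fm : ℝ → ℝ × ℝ × ℝ → ℝ} {e : ℝ × ℝ × ℝ} {δ L : ℝ}
    (h : UniformOn Fp Fm e δ L) {u : ℝ → ℝ × ℝ × ℝ} (hu : Continuous u)
    (hδ : ∀ s, ‖u s - e‖ ≤ δ) {θ : ℝ} (hθ : sin θ ≠ 0) :
    ContinuousAt (fun s => piecewiseAngle Fp Fm s (u s)) θ := by
  rw [piecewiseAngle_apply]
  exact continuousAt_piecewiseAngle (h.continuous_upper_comp hu hδ)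
    (h.continuous_lower_comp hu hδ) hθ

/-- Clamping replaces local bounds near the base circle by global ones, as the contraction needs,
without changing the system inside the box. -/
theorem UniformOn.boundedSystem {Fp Fm : ℝ → ℝ × ℝ × ℝ → ℝ} {r δ L ε : ℝ} (hL : 0 ≤ L)
    (h : UniformOn Fp Fm (0, r, 0) δ L) (hp : Function.Periodic Fp (2 * π))
    (hm : Function.Periodic Fm (2 * π)) (hε : |ε| ≤ δ) :
    BoundedSystem (fun s p => piecewiseAngle Fp Fm s (boxClamp r δ ε p)) L where
  measurable u hu := h.measurable_comp ((continuous_boxClamp r δ ε).comp hu)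
    fun s => norm_boxClamp_sub_base_le hε _
  bound s p := h.bound s _ (norm_boxClamp_sub_base_le hε _)
  lipschitz s p q := (h.lipschitz s _ _ (norm_boxClamp_sub_base_le hε _)
    (norm_boxClamp_sub_base_le hε _)).trans (by gcongr; exact norm_boxClamp_sub_le _ _ _ _ _)
  periodic s := by simp only [piecewiseAngle_periodic hp hm s]

/-- If `f` has a simple zero at `r` then every function that is `O(η)`-close to `f` has a zero in
an `O(η)`-neighbourhood of `r`. -/
theorem exists_zero_near_simple_zero {f : ℝ → ℝ} {r d C : ℝ} (hd : d ≠ 0) (hC : 0 ≤ C)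
    (hf : HasDerivAt f d r) (h0 : f r = 0) : ∃ k η, 0 < k ∧ 0 < η ∧ ∀ s, 0 ≤ s → s ≤ η →
      ∀ m : ℝ → ℝ, Continuous m → (∀ x, |x - r| ≤ k * s → |m x - f x| ≤ C * s) →
        ∃ x, |x - r| ≤ k * s ∧ m x = 0 := by
  have hd' : 0 < |d| := abs_pos.2 hd
  have h1 := (hasDerivAt_iff_isLittleO.1 hf).def (half_pos hd')
  obtain ⟨η, hη, h2⟩ := Metric.nhds_basis_closedBall.eventually_iff.1 h1
  -- With this `k` the linear term `|d| k s` is at least the sum of the differentiability error `|d|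
  -- k s / 2` and the perturbation `C s`, so `m` has opposite weak signs at `r ± k s`.
  set k := 2 * C / |d| + 1 with hk
  have hk0 : 0 < k := by positivity
  refine ⟨k, η / k, hk0, by positivity, fun s hs hsη m hm hclose => ?_⟩
  rw [le_div_iff₀ hk0, mul_comm] at hsη
  have hks : 0 ≤ k * s := by positivity
  have hCk : C * s ≤ |d| / 2 * (k * s) := by
    have : |d| / 2 * k = C + |d| / 2 := by rw [hk]; field_simp
    rw [← mul_assoc, this, add_mul]
    nlinarith
  have h3 : ∀ x, |x - r| ≤ k * s → |m x - d * (x - r)| ≤ |d| / 2 * |x - r| + C * s := by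
    intro x hx
    have h4 := h2 (x := x) (by rw [Metric.mem_closedBall, Real.dist_eq]; linarith)
    have h5 := hclose x hx
    simp only [h0, sub_zero, smul_eq_mul, Real.norm_eq_abs] at h4
    rw [mul_comm (x - r) d] at h4
    calc _ = |(m x - f x) + (f x - d * (x - r))| := by ring_nf
      _ ≤ _ := (abs_add_le _ _).trans (by linarith)
  have hp := h3 (r + k * s) (by rw [add_sub_cancel_left, abs_of_nonneg hks])
  have hn := h3 (r - k * s) (by rw [sub_sub_cancel_left, abs_neg, abs_of_nonneg hks])
  rw [add_sub_cancel_left, abs_of_nonneg hks, abs_le] at hp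
  rw [sub_sub_cancel_left, abs_neg, abs_of_nonneg hks, abs_le] at hn
  have hmem : (0 : ℝ) ∈ m '' uIcc (r - k * s) (r + k * s) := by
    refine intermediate_value_uIcc hm.continuousOn ?_
    rw [mem_uIcc]
    rcases hd.lt_or_gt with h | h
    · rw [abs_of_neg h] at *
      right
      constructor <;> nlinarith
    · rw [abs_of_pos h] at *
      left
      constructor <;> nlinarith
  obtain ⟨x, hx, hx0⟩ := hmem
  rw [uIcc_of_le (by linarith)] at hx
  exact ⟨x, by rw [abs_le]; constructor <;> linarith [hx.1, hx.2], hx0⟩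

theorem integral_sub_le {g₁ g₂ : ℝ → ℝ} {a b B : ℝ} (hab : a ≤ b)
    (h₁ : IntervalIntegrable g₁ volume a b) (h₂ : IntervalIntegrable g₂ volume a b)
    (h : ∀ s, |g₁ s - g₂ s| ≤ B) : |(∫ s in a..b, g₁ s) - ∫ s in a..b, g₂ s| ≤ B * (b - a) := by
  rw [← integral_sub h₁ h₂]
  have := intervalIntegral.norm_integral_le_of_norm_le_const (a := a) (b := b)
    (f := fun s => g₁ s - g₂ s) (C := B) fun s _ => h s
  rwa [abs_of_nonneg (sub_nonneg.2 hab)] at this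

/-- `R` and `w` form a periodic solution of `R' = ε F`, `w' = -w + ε G`. -/
structure IsPeriodicSolution (Fp Fm Gp Gm : ℝ → ℝ × ℝ × ℝ → ℝ) (ε : ℝ) (R w : ℝ → ℝ) : Prop where
  continuous_fst : Continuous R
  continuous_snd : Continuous w
  periodic_fst : Function.Periodic R (2 * π)
  periodic_snd : Function.Periodic w (2 * π)
  hasDerivAt_fst : ∀ θ, sin θ ≠ 0 →
    HasDerivAt R (ε * piecewiseAngle Fp Fm θ (ε, R θ, w θ)) θ
  hasDerivAt_snd : ∀ θ, sin θ ≠ 0 →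
    HasDerivAt w (-w θ + ε * piecewiseAngle Gp Gm θ (ε, R θ, w θ)) θ

/-- First order averaging. -/
theorem exists_isPeriodicSolution {Fp Fm Gp Gm : ℝ → ℝ × ℝ × ℝ → ℝ} {r d : ℝ}
    (hFp : SmoothAlong Fp (0, r, 0)) (hFm : SmoothAlong Fm (0, r, 0))
    (hGp : SmoothAlong Gp (0, r, 0)) (hGm : SmoothAlong Gm (0, r, 0)) (hd : d ≠ 0)
    (hderiv : HasDerivAt
      (fun ρ => ∫ s in (0 : ℝ)..(2 * π), piecewiseAngle Fp Fm s (0, ρ, 0)) d r)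
    (hzero : ∫ s in (0 : ℝ)..(2 * π), piecewiseAngle Fp Fm s (0, r, 0) = 0) :
    ∃ C ε₀, 0 < C ∧ 0 < ε₀ ∧ ∀ ε, |ε| < ε₀ → ∃ R w : ℝ → ℝ,
      IsPeriodicSolution Fp Fm Gp Gm ε R w ∧ (∀ θ, |R θ - r| ≤ C * |ε|) ∧
      ∀ θ, |w θ| ≤ C * |ε| := by
  obtain ⟨δ₁, L₁, hδ₁, hL₁, hF⟩ := exists_uniformOn hFp hFm
  obtain ⟨δ₂, L₂, hδ₂, hL₂, hG⟩ := exists_uniformOn hGp hGm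
  set δ := min δ₁ δ₂
  set L := max L₁ L₂
  have hδ : 0 < δ := lt_min hδ₁ hδ₂
  have hL : 0 < L := lt_max_of_lt_left hL₁
  replace hF := hF.mono (min_le_left _ _ : δ ≤ δ₁) (le_max_left _ _ : L₁ ≤ L)
  replace hG := hG.mono (min_le_right _ _ : δ ≤ δ₂) (le_max_right _ _ : L₂ ≤ L)
  have hPB := primitiveBound_pos
  set P := primitiveBound * L with hP
  have hP0 : 0 < P := by positivity
  -- The points `(ε, R, w)` on the fixed point and `(0, ρ, 0)` differ by at most `(1 + P)|ε|`. The
  -- Lipschitz constant `L` and the length `2π` of the period give the rest of the constant.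
  obtain ⟨k, η, hk, hη, hIVT⟩ := exists_zero_near_simple_zero (C := L * (1 + P) * (2 * π)) hd
    (by positivity) hderiv hzero
  set C := k + P with hC
  have hC0 : 0 < C := by positivity
  -- The four bounds serve, in order, the zero lemma, the size of the box, the inactivity of the
  -- truncation on the solution found, and the contraction.
  refine ⟨C, min (min η δ) (min (δ / C) (1 / 2 / P)), hC0, by positivity, fun ε hε => ?_⟩
  simp only [lt_min_iff] at hε
  obtain ⟨⟨hεη, hεδ⟩, hεC, hεP⟩ := hε
  rw [lt_div_iff₀ hC0, mul_comm] at hεC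
  rw [lt_div_iff₀ hP0] at hεP
  have hFb := hF.boundedSystem hL.le hFp.periodic hFm.periodic hεδ.le
  have hGb := hG.boundedSystem hL.le hGp.periodic hGm.periodic hεδ.le
  obtain ⟨u, hu, hmean⟩ := exists_averaged_family hL.le hFb hGb hεP.le
  have hFm' : ∀ ρ, Measurable fun s => piecewiseAngle Fp Fm s (boxClamp r δ ε (u ρ s)) :=
    fun ρ => hFb.measurable _ (hu ρ).1
  have hGm' : ∀ ρ, Measurable fun s => piecewiseAngle Gp Gm s (boxClamp r δ ε (u ρ s)) :=
    fun ρ => hGb.measurable _ (hu ρ).1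
  have hFper : ∀ ρ, Function.Periodic (fun s => piecewiseAngle Fp Fm s (boxClamp r δ ε (u ρ s)))
      (2 * π) := fun ρ => hFb.periodic_comp (hu ρ).2.1
  have hGper : ∀ ρ, Function.Periodic (fun s => piecewiseAngle Gp Gm s (boxClamp r δ ε (u ρ s)))
      (2 * π) := fun ρ => hGb.periodic_comp (hu ρ).2.1
  have hu1 : ∀ ρ θ, |(u ρ θ).1 - ρ| ≤ P * |ε| := by
    intro ρ θ
    rw [(hu ρ).2.2 θ, add_sub_cancel_left, abs_mul, mul_comm]
    gcongr
    exact abs_centredPrimitive_le (hFm' ρ) (fun s => hFb.bound s _) (hFper ρ) θ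
  have hu2 : ∀ ρ θ, |(u ρ θ).2| ≤ P * |ε| := by
    intro ρ θ
    rw [(hu ρ).2.2 θ, abs_mul, mul_comm]
    gcongr
    exact abs_decayPrimitive_le (hGm' ρ) (fun s => hGb.bound s _) θ
  have hCε : k * |ε| + P * |ε| ≤ δ := by
    rw [hC, add_mul] at hεC
    exact hεC.le
  have hPε : P * |ε| ≤ δ := le_trans (le_add_of_nonneg_left (by positivity)) hCε
  have hbox : ∀ ρ θ, |ρ - r| ≤ k * |ε| → boxClamp r δ ε (u ρ θ) = (ε, (u ρ θ).1, (u ρ θ).2) := by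
    intro ρ θ hρ
    refine boxClamp_eq ?_ ((hu2 ρ θ).trans hPε)
    calc _ ≤ |(u ρ θ).1 - ρ| + |ρ - r| := abs_sub_le _ _ _
      _ ≤ δ := by linarith [hu1 ρ θ]
  obtain ⟨ρ, hρ, hρ0⟩ := hIVT |ε| (abs_nonneg _) hεη.le _ hmean fun ρ hρ => by
    have hbase : ‖((0, ρ, 0) : ℝ × ℝ × ℝ) - (0, r, 0)‖ ≤ δ := by
      have : 0 ≤ P * |ε| := by positivity
      have h1 : |ρ - r| ≤ δ := by linarith
      simpa [Prod.norm_def, hδ.le] using h1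
    refine (integral_sub_le (B := L * ((1 + P) * |ε|)) two_pi_pos.le
      (intervalIntegrable_of_measurable_of_bound (hFm' ρ) (fun s => hFb.bound s _) _ _)
      (intervalIntegrable_of_measurable_of_bound (B := L)
        (hF.measurable_comp (u := fun _ => (0, ρ, 0)) continuous_const fun _ => hbase)
        (fun s => hF.bound s _ hbase) _ _) fun s => ?_).trans (le_of_eq (by ring))
    refine (hF.lipschitz s _ _ (norm_boxClamp_sub_base_le hεδ.le _) hbase).trans ?_
    gcongr
    rw [hbox ρ s hρ]
    have hPn : 0 ≤ P * |ε| := by positivity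
    simp only [Prod.mk_sub_mk, sub_zero, Prod.norm_def, Real.norm_eq_abs]
    rw [add_mul, one_mul]
    exact max_le (by linarith) (max_le (by linarith [hu1 ρ s, abs_nonneg ε])
      (by linarith [hu2 ρ s, abs_nonneg ε]))
  have hR : ∀ θ, (u ρ θ).1 = ρ + ε *
      centredPrimitive (fun s => piecewiseAngle Fp Fm s (boxClamp r δ ε (u ρ s))) θ :=
    fun θ => congrArg Prod.fst ((hu ρ).2.2 θ)
  have hw : ∀ θ, (u ρ θ).2 = ε *
      decayPrimitive (fun s => piecewiseAngle Gp Gm s (boxClamp r δ ε (u ρ s))) θ :=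
    fun θ => congrArg Prod.snd ((hu ρ).2.2 θ)
  refine ⟨fun θ => (u ρ θ).1, fun θ => (u ρ θ).2, ⟨(hu ρ).1.fst, (hu ρ).1.snd,
    fun θ => by simp only [(hu ρ).2.1 θ], fun θ => by simp only [(hu ρ).2.1 θ],
    fun θ hθ => ?_, fun θ hθ => ?_⟩, fun θ => ?_, fun θ => ?_⟩
  · have h1 := hF.continuousAt_comp ((continuous_boxClamp r δ ε).comp (hu ρ).1)
      (fun s => norm_boxClamp_sub_base_le hεδ.le _) hθ
    have h2 := ((hasDerivAt_centredPrimitive (hFm' ρ) (fun s => hFb.bound s _) h1).const_mul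
      ε).const_add ρ
    rw [funext hR]
    refine h2.congr_deriv ?_
    rw [hρ0, mul_zero, sub_zero]
    simp only [hbox ρ θ hρ]
  · have h1 := hG.continuousAt_comp ((continuous_boxClamp r δ ε).comp (hu ρ).1)
      (fun s => norm_boxClamp_sub_base_le hεδ.le _) hθ
    have h2 := (hasDerivAt_decayPrimitive (hGm' ρ) (fun s => hGb.bound s _) (hGper ρ) h1).const_mul
      ε
    rw [funext hw]
    refine h2.congr_deriv ?_
    simp only [hbox ρ θ hρ]
    linear_combination hw θ
  · calc _ ≤ |(u ρ θ).1 - ρ| + |ρ - r| := abs_sub_le _ _ _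
      _ ≤ C * |ε| := by rw [hC, add_mul]; linarith [hu1 ρ θ]
  · exact (hu2 ρ θ).trans (by gcongr; exact le_add_of_nonneg_left hk.le)

/-! ### Uniqueness of periodic solutions -/

/-- The radial derivative of a piecewise function at the base circle. -/
noncomputable def radialDeriv (Fp Fm : ℝ → ℝ × ℝ × ℝ → ℝ) (r θ : ℝ) : ℝ :=
  piecewiseAngle (sliceDeriv Fp (0, r, 0)) (sliceDeriv Fm (0, r, 0)) θ (0, 1, 0)

/-- The transversal derivative of a piecewise function at the base circle. -/
noncomputable def transDeriv (Fp Fm : ℝ → ℝ × ℝ × ℝ → ℝ) (r θ : ℝ) : ℝ :=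
  piecewiseAngle (sliceDeriv Fp (0, r, 0)) (sliceDeriv Fm (0, r, 0)) θ (0, 0, 1)

section

variable {Fp Fm Gp Gm : ℝ → ℝ × ℝ × ℝ → ℝ} {r : ℝ}

theorem piecewiseAngle_clm_apply (Dp Dm : ℝ → (ℝ × ℝ × ℝ →L[ℝ] ℝ)) (v : ℝ × ℝ × ℝ) :
    (fun θ => piecewiseAngle Dp Dm θ v) = piecewiseAngle (fun θ => Dp θ v) fun θ => Dm θ v := by
  ext θ
  unfold piecewiseAngle
  split_ifs <;> rfl

theorem continuous_sliceDeriv_apply (hFp : SmoothAlong Fp (0, r, 0)) (v : ℝ × ℝ × ℝ) :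
    Continuous fun θ => sliceDeriv Fp (0, r, 0) θ v :=
  hFp.continuous_sliceDeriv.clm_apply continuous_const

theorem measurable_radialDeriv (hFp : SmoothAlong Fp (0, r, 0)) (hFm : SmoothAlong Fm (0, r, 0)) :
    Measurable (radialDeriv Fp Fm r) := by
  unfold radialDeriv
  rw [piecewiseAngle_clm_apply]
  exact measurable_piecewiseAngle (continuous_sliceDeriv_apply hFp _)
    (continuous_sliceDeriv_apply hFm _)

theorem continuousAt_radialDeriv (hFp : SmoothAlong Fp (0, r, 0))
    (hFm : SmoothAlong Fm (0, r, 0)) {θ : ℝ} (hθ : sin θ ≠ 0) :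
    ContinuousAt (radialDeriv Fp Fm r) θ := by
  unfold radialDeriv
  rw [piecewiseAngle_clm_apply]
  exact continuousAt_piecewiseAngle (continuous_sliceDeriv_apply hFp _)
    (continuous_sliceDeriv_apply hFm _) hθ

theorem radialDeriv_periodic (hFp : SmoothAlong Fp (0, r, 0)) (hFm : SmoothAlong Fm (0, r, 0)) :
    Function.Periodic (radialDeriv Fp Fm r) (2 * π) := fun θ => by
  unfold radialDeriv
  rw [piecewiseAngle_periodic hFp.periodic_sliceDeriv hFm.periodic_sliceDeriv θ]

theorem exists_bound_derivs (hFp : SmoothAlong Fp (0, r, 0)) (hFm : SmoothAlong Fm (0, r, 0)) :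
    ∃ B, 0 < B ∧ (∀ θ, |radialDeriv Fp Fm r θ| ≤ B) ∧ ∀ θ, |transDeriv Fp Fm r θ| ≤ B := by
  obtain ⟨C₁, hC₁, h₁⟩ := hFp.exists_norm_sliceDeriv_le
  obtain ⟨C₂, hC₂, h₂⟩ := hFm.exists_norm_sliceDeriv_le
  have key : ∀ θ (v : ℝ × ℝ × ℝ), ‖v‖ ≤ 1 →
      |piecewiseAngle (sliceDeriv Fp (0, r, 0)) (sliceDeriv Fm (0, r, 0)) θ v| ≤ max C₁ C₂ := by
    intro θ v hv
    have h : ‖piecewiseAngle (sliceDeriv Fp (0, r, 0)) (sliceDeriv Fm (0, r, 0)) θ‖ ≤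
        max C₁ C₂ := by
      unfold piecewiseAngle
      split_ifs
      · exact (h₁ θ).trans (le_max_left _ _)
      · exact (h₂ θ).trans (le_max_right _ _)
    have := ContinuousLinearMap.le_of_opNorm_le _ h v
    rw [Real.norm_eq_abs] at this
    exact this.trans (mul_le_of_le_one_right (hC₁.le.trans (le_max_left _ _)) hv)
  exact ⟨max C₁ C₂, lt_max_of_lt_left hC₁, fun θ => key θ _ (by simp [Prod.norm_def]),
    fun θ => key θ _ (by simp [Prod.norm_def])⟩

theorem piecewiseAngle_sliceDeriv_apply (θ h v : ℝ) :
    piecewiseAngle (sliceDeriv Fp (0, r, 0)) (sliceDeriv Fm (0, r, 0)) θ (0, h, v) =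
      radialDeriv Fp Fm r θ * h + transDeriv Fp Fm r θ * v := by
  have : ((0, h, v) : ℝ × ℝ × ℝ) = h • ((0, 1, 0) : ℝ × ℝ × ℝ) + v • ((0, 0, 1) : ℝ × ℝ × ℝ) := by
    simp
  rw [this, map_add, map_smul, map_smul, radialDeriv, transDeriv]
  simp [mul_comm]

/-- The linearisation is uniform in the angle, so it may be integrated; the tolerance `c / (2π)`
becomes `c` over a period. -/
theorem hasDerivAt_integral_piecewiseAngle (hFp : SmoothAlong Fp (0, r, 0))
    (hFm : SmoothAlong Fm (0, r, 0)) :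
    HasDerivAt (fun ρ => ∫ s in (0 : ℝ)..(2 * π), piecewiseAngle Fp Fm s (0, ρ, 0))
      (∫ s in (0 : ℝ)..(2 * π), radialDeriv Fp Fm r s) r := by
  obtain ⟨δ, L, hδ, hL, hF⟩ := exists_uniformOn hFp hFm
  obtain ⟨B, hB, hN, -⟩ := exists_bound_derivs hFp hFm
  have hball : ∀ ρ : ℝ, |ρ - r| ≤ δ → ‖((0, ρ, 0) : ℝ × ℝ × ℝ) - (0, r, 0)‖ ≤ δ := fun ρ hρ => by
    simpa [Prod.norm_def, hδ.le] using hρ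
  have hi : ∀ ρ : ℝ, |ρ - r| ≤ δ → IntervalIntegrable
      (fun s => piecewiseAngle Fp Fm s (0, ρ, 0)) volume 0 (2 * π) := fun ρ hρ =>
    intervalIntegrable_of_measurable_of_bound (B := L)
      (hF.measurable_comp (u := fun _ => (0, ρ, 0)) continuous_const fun _ => hball ρ hρ)
      (fun s => hF.bound s _ (hball ρ hρ)) _ _
  have hiN := intervalIntegrable_of_measurable_of_bound (measurable_radialDeriv hFp hFm) hN 0
    (2 * π)
  rw [hasDerivAt_iff_isLittleO]
  refine Asymptotics.isLittleO_iff.2 fun c hc => ?_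
  obtain ⟨δ', hδ', hlin⟩ := exists_linearize hFp hFm (div_pos hc two_pi_pos)
  filter_upwards [Metric.closedBall_mem_nhds r (lt_min hδ hδ')] with ρ hρ
  rw [Metric.mem_closedBall, Real.dist_eq, le_min_iff] at hρ
  have h1 : ∀ s, |piecewiseAngle Fp Fm s (0, ρ, 0) -
      (piecewiseAngle Fp Fm s (0, r, 0) + (ρ - r) * radialDeriv Fp Fm r s)| ≤
      c / (2 * π) * |ρ - r| := by
    intro s
    have := hlin (0, ρ, 0) (0, r, 0) (by simpa [Prod.norm_def, hδ'.le] using hρ.2)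
      (by simp [hδ'.le]) s
    have h2 : ((0, ρ, 0) : ℝ × ℝ × ℝ) - (0, r, 0) = (0, ρ - r, 0) := by simp
    rw [h2, piecewiseAngle_sliceDeriv_apply, mul_zero, add_zero] at this
    have h3 : ‖((0, ρ - r, 0) : ℝ × ℝ × ℝ)‖ = |ρ - r| := by simp [Prod.norm_def]
    rw [h3] at this
    rw [← sub_sub, mul_comm (ρ - r)]
    exact this
  have h0 := hi r (by simp [hδ.le])
  have h2 := integral_sub_le two_pi_pos.le (hi ρ hρ.1) (h0.add (hiN.const_mul (ρ - r))) h1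
  rw [integral_add h0 (hiN.const_mul _), intervalIntegral.integral_const_mul, ← sub_sub,
    sub_zero] at h2
  rw [smul_eq_mul, Real.norm_eq_abs, Real.norm_eq_abs]
  refine h2.trans (le_of_eq ?_)
  field_simp

theorem exists_isMax_of_periodic {k : ℝ → ℝ} (hk : Continuous k) {T : ℝ} (hT : 0 < T)
    (hp : Function.Periodic k T) : ∃ t₀, ∀ t, k t ≤ k t₀ := by
  obtain ⟨t₀, -, h⟩ := isCompact_Icc.exists_isMaxOn (nonempty_Icc.2 hT.le) hk.continuousOn
  refine ⟨t₀, fun t => ?_⟩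
  obtain ⟨s, hs, hst⟩ := hp.exists_mem_Ico₀ hT t
  rw [hst]
  exact h (Ico_subset_Icc_self hs)

/-- A periodic motion in polar coordinates: angle `α`, radius `R` and transversal coordinate `w`
as functions of time. -/
structure IsPolarOrbit (Fp Fm Gp Gm : ℝ → ℝ × ℝ × ℝ → ℝ) (ε : ℝ) (α R w : ℝ → ℝ) (T : ℝ) :
    Prop where
  pos : 0 < T
  continuous_comp : ∀ φ : ℝ → ℝ, Continuous φ → Function.Periodic φ (2 * π) →
    Continuous fun t => φ (α t)
  continuous_radius : Continuous R
  continuous_trans : Continuous w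
  periodic_angle : Function.Periodic α T
  periodic_radius : Function.Periodic R T
  periodic_trans : Function.Periodic w T
  hasDerivAt : ∀ t, ∀ᶠ s in 𝓝[≠] t, sin (α s) ≠ 0 ∧ ∃ Ω, 0 < Ω ∧ HasDerivAt α Ω s ∧
    HasDerivAt R (ε * piecewiseAngle Fp Fm (α s) (ε, R s, w s) * Ω) s ∧
    HasDerivAt w ((-w s + ε * piecewiseAngle Gp Gm (α s) (ε, R s, w s)) * Ω) s

/-- If the bound failed, the decay `-v` would dominate `ε g` near the maximum of `v²`, and `v²`
would be strictly decreasing there. -/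
theorem trans_bound_of_max {h v : ℝ → ℝ} {Mh Mv c ε : ℝ} {t₀ : ℝ} (hv : Continuous v)
    (hMh : ∀ t, |h t| ≤ Mh) (hMv : ∀ t, |v t| ≤ Mv) (hmax : |v t₀| = Mv)
    (hd : ∀ᶠ s in 𝓝[≠] t₀, ∃ Ω g, 0 < Ω ∧ |g| ≤ c * max |h s| |v s| ∧
      HasDerivAt v ((-v s + ε * g) * Ω) s) (hc : 0 ≤ c) : Mv ≤ |ε| * c * (Mh + Mv) := by
  by_contra! hlt
  rw [← hmax] at hlt
  have hMh0 : 0 ≤ Mh := (abs_nonneg _).trans (hMh 0)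
  have hMv0 : 0 ≤ Mv := (abs_nonneg _).trans (hMv 0)
  refine false_of_isMax_of_deriv_ne (k := fun t => v t ^ 2) (t₀ := t₀) (σ := -1) (by fun_prop)
    (fun t => sq_le_sq.2 (by rw [hmax]; exact hMv t)) ?_
  have hnear : ∀ᶠ s in 𝓝[≠] t₀, |ε| * c * (Mh + |v t₀|) < |v s| :=
    (hv.abs.continuousAt.eventually (lt_mem_nhds hlt)).filter_mono nhdsWithin_le_nhds
  rw [hmax] at hnear
  filter_upwards [hd, hnear] with s ⟨Ω, g, hΩ, hg, hs⟩ hs'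
  refine ⟨_, hs.pow 2, ?_⟩
  have h1 : |ε * g| < |v s| := by
    rw [abs_mul]
    refine lt_of_le_of_lt ?_ hs'
    rw [mul_assoc]
    gcongr
    refine hg.trans ?_
    gcongr
    exact max_le ((hMh s).trans (by linarith)) ((hMv s).trans (by linarith))
  have h2 : v s * (ε * g) < v s * v s := by
    calc v s * (ε * g) ≤ |v s| * |ε * g| := by rw [← abs_mul]; exact le_abs_self _
      _ < |v s| * |v s| := by
        have : 0 < |v s| := (abs_nonneg _).trans_lt h1
        gcongr
      _ = v s * v s := abs_mul_abs_self _
  have h3 : 0 < Ω * (v s * v s - v s * (ε * g)) := mul_pos hΩ (by linarith)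
  simp only [Nat.cast_ofNat, Nat.add_one_sub_one, pow_one]
  linarith

/-- Near a maximum of the square of `h (1 - ε Φ)` one has `|h| > Mh / 8` when `Mh > 0`, because the
factor lies between `1/2` and `2`. Since `8 E < |D|`, the term `D h` dominates `g`, and the square
is strictly monotone in the direction given by the sign of `ε D`. -/
theorem radius_eq_zero_of_max {h Φ : ℝ → ℝ} {Mh E D ε : ℝ} {t₀ : ℝ} (hε : ε ≠ 0)
    (hh : Continuous h) (hΦ : Continuous Φ) (hMh : ∀ t, |h t| ≤ Mh) {t₁ : ℝ} (hMh' : |h t₁| = Mh)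
    (hεΦ : ∀ t, |ε * Φ t| ≤ 1 / 2) (hE0 : 0 ≤ E) (hE : 8 * E < |D|)
    (hmax : ∀ t, (h t * (1 - ε * Φ t)) ^ 2 ≤ (h t₀ * (1 - ε * Φ t₀)) ^ 2)
    (hd : ∀ᶠ s in 𝓝[≠] t₀, ∃ Ω g, 0 < Ω ∧ |g| ≤ E * Mh ∧
      HasDerivAt (fun t => h t * (1 - ε * Φ t)) (Ω * ε * (D * h s + g)) s) : Mh = 0 := by
  by_contra hne
  have hMh0 : 0 < Mh := lt_of_le_of_ne ((abs_nonneg _).trans (hMh 0)) (Ne.symm hne)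
  have hfac : ∀ t, 1 / 2 ≤ 1 - ε * Φ t ∧ 1 - ε * Φ t ≤ 2 := fun t => by
    have := abs_le.1 (hεΦ t)
    constructor <;> linarith [this.1, this.2]
  set k := fun t => h t * (1 - ε * Φ t) with hk
  have hkc : Continuous k := by fun_prop
  have hkt : ∀ t, |k t| = |h t| * (1 - ε * Φ t) := fun t => by
    rw [hk, abs_mul, abs_of_pos (by linarith [(hfac t).1] : 0 < 1 - ε * Φ t)]
  have hMk : Mh / 2 ≤ |k t₀| := by
    have h1 := sq_le_sq.1 (hmax t₁)
    refine le_trans ?_ h1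
    change Mh / 2 ≤ |k t₁|
    rw [hkt, hMh']
    nlinarith [(hfac t₁).1]
  refine false_of_isMax_of_deriv_ne (k := fun t => k t ^ 2) (t₀ := t₀) (σ := ε * D) (by fun_prop)
    hmax ?_
  have hnear : ∀ᶠ s in 𝓝[≠] t₀, Mh / 4 < |k s| :=
    (hkc.abs.continuousAt.eventually (lt_mem_nhds (by linarith : Mh / 4 < |k t₀|))).filter_mono
      nhdsWithin_le_nhds
  filter_upwards [hd, hnear] with s ⟨Ω, g, hΩ, hg, hs⟩ hs'
  refine ⟨_, hs.pow 2, ?_⟩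
  rw [hkt] at hs'
  have h1 : Mh / 8 < |h s| := by nlinarith [(hfac s).2, abs_nonneg (h s)]
  have h2 : |g| < |D * h s| := by
    rw [abs_mul]
    calc |g| ≤ E * Mh := hg
      _ = (8 * E) * (Mh / 8) := by ring
      _ < |D| * |h s| := by
        refine mul_lt_mul' hE.le h1 (by positivity) (lt_of_le_of_lt (by positivity) hE)
  have h3 : 0 < (D * h s) * (D * h s + g) := by
    have h4 : -((D * h s) * g) ≤ |D * h s| * |g| := by
      rw [← abs_mul]; exact neg_le_abs _
    have h5 : |D * h s| * |g| < |D * h s| * |D * h s| := by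
      have : 0 < |D * h s| := (abs_nonneg _).trans_lt h2
      gcongr
    rw [abs_mul_abs_self] at h5
    linarith
  have h6 : 0 < 2 * (ε ^ 2 * Ω * (1 - ε * Φ s)) * ((D * h s) * (D * h s + g)) := by
    have : 0 < 1 - ε * Φ s := by linarith [(hfac s).1]
    have : 0 < ε ^ 2 := by positivity
    positivity
  simp only [Nat.cast_ofNat, Nat.add_one_sub_one, pow_one, hk]
  linarith

/-- Near the base circle there is at most one periodic solution, even among those that close up
after several turns. -/
theorem IsPolarOrbit.eq_isPeriodicSolution (hFp : SmoothAlong Fp (0, r, 0))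
    (hFm : SmoothAlong Fm (0, r, 0)) (hGp : SmoothAlong Gp (0, r, 0))
    (hGm : SmoothAlong Gm (0, r, 0))
    (hD : ∫ s in (0 : ℝ)..(2 * π), radialDeriv Fp Fm r s ≠ 0) :
    ∃ δ, 0 < δ ∧ ∀ ε, ε ≠ 0 → |ε| ≤ δ → ∀ Rs ws : ℝ → ℝ,
      IsPeriodicSolution Fp Fm Gp Gm ε Rs ws → (∀ θ, |Rs θ - r| ≤ δ) → (∀ θ, |ws θ| ≤ δ) →
      ∀ α R w T, IsPolarOrbit Fp Fm Gp Gm ε α R w T → (∀ t, |R t - r| ≤ δ) → (∀ t, |w t| ≤ δ) →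
      ∀ t, R t = Rs (α t) ∧ w t = ws (α t) := by
  obtain ⟨B, hB, hN, hV⟩ := exists_bound_derivs hFp hFm
  obtain ⟨δ₁, L, hδ₁, hL, hG⟩ := exists_uniformOn hGp hGm
  have hmN := measurable_radialDeriv hFp hFm
  have hpN := radialDeriv_periodic hFp hFm
  set N := radialDeriv Fp Fm r
  set V := transDeriv Fp Fm r
  set D := (2 * π)⁻¹ * ∫ s in (0 : ℝ)..(2 * π), N s with hDdef
  have hD0 : 0 < |D| := abs_pos.2 (mul_ne_zero (inv_ne_zero two_pi_pos.ne') hD)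
  -- The tolerance `|D| / 128` and the later bound `|ε| K ≤ |D| / 32` make the total error
  -- coefficient `E` at most `|D| / 16`, within the requirement `8 E < |D|`.
  obtain ⟨δ₂, hδ₂, hF⟩ := exists_linearize hFp hFm (by positivity : 0 < |D| / 128)
  have hPB := primitiveBound_pos
  set P := primitiveBound * B with hP
  have hP0 : 0 < P := by positivity
  set K := P * B + 4 * B * L with hK
  have hK0 : 0 < K := by positivity
  set δ₃ := min (1 / 2 / P) (min (1 / 2 / L) (|D| / 32 / K)) with hδ₃
  have hδ₃0 : 0 < δ₃ := by positivity
  refine ⟨min (min δ₁ δ₂) δ₃, by positivity,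
    fun ε hε hεδ Rs ws hs hRs hws α R w T ho hR hw => ?_⟩
  simp only [le_min_iff, hδ₃] at hεδ hRs hws hR hw
  obtain ⟨⟨hε₁, hε₂⟩, hεP, hεL, hεK⟩ := hεδ
  rw [le_div_iff₀ hP0] at hεP
  rw [le_div_iff₀ hL] at hεL
  rw [le_div_iff₀ hK0] at hεK
  have hball : ∀ {δ' x y : ℝ}, |ε| ≤ δ' → |x - r| ≤ δ' → |y| ≤ δ' →
      ‖((ε, x, y) : ℝ × ℝ × ℝ) - (0, r, 0)‖ ≤ δ' := fun h1 h2 h3 => by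
    simp only [Prod.mk_sub_mk, sub_zero, Prod.norm_def, Real.norm_eq_abs]
    exact max_le h1 (max_le h2 h3)
  set h := fun t => R t - Rs (α t) with hh
  set v := fun t => w t - ws (α t) with hv
  have hhc : Continuous h :=
    ho.continuous_radius.sub (ho.continuous_comp _ hs.continuous_fst hs.periodic_fst)
  have hvc : Continuous v :=
    ho.continuous_trans.sub (ho.continuous_comp _ hs.continuous_snd hs.periodic_snd)
  have hhp : Function.Periodic h T := fun t => by
    simp only [hh, ho.periodic_radius t, ho.periodic_angle t]
  have hvp : Function.Periodic v T := fun t => by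
    simp only [hv, ho.periodic_trans t, ho.periodic_angle t]
  have hnorm : ∀ t, ((ε, R t, w t) : ℝ × ℝ × ℝ) - (ε, Rs (α t), ws (α t)) = (0, h t, v t) :=
    fun t => by simp [hh, hv]
  have hnorm' : ∀ t, ‖((0, h t, v t) : ℝ × ℝ × ℝ)‖ = max |h t| |v t| := fun t => by
    simp [Prod.norm_def]
  obtain ⟨t₁, hmax₁⟩ := exists_isMax_of_periodic hhc.abs ho.pos fun t => by simp only [hhp t]
  obtain ⟨t₂, hmax₂⟩ := exists_isMax_of_periodic hvc.abs ho.pos fun t => by simp only [hvp t]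
  have hMv := trans_bound_of_max (h := h) (ε := ε) (c := L) hvc hmax₁ hmax₂ rfl (by
    filter_upwards [ho.hasDerivAt t₂] with s ⟨hsin, Ω, hΩ, hα, _, hw'⟩
    refine ⟨Ω, _, hΩ, ?_, (hw'.sub ((hs.hasDerivAt_snd _ hsin).comp s hα)).congr_deriv
      (g' := (-v s + ε * (piecewiseAngle Gp Gm (α s) (ε, R s, w s) -
        piecewiseAngle Gp Gm (α s) (ε, Rs (α s), ws (α s)))) * Ω) ?_⟩
    · have := hG.lipschitz (α s) (ε, R s, w s) (ε, Rs (α s), ws (α s))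
        (hball hε₁ (hR s).1.1 (hw s).1.1) (hball hε₁ (hRs _).1.1 (hws _).1.1)
      rwa [hnorm, hnorm'] at this
    · simp only [hv]
      ring) hL.le
  set Mh := |h t₁|
  set Mv := |v t₂|
  have hMh0 : 0 ≤ Mh := abs_nonneg _
  have hMv0 : 0 ≤ Mv := abs_nonneg _
  -- Since `|ε| L ≤ 1/2`, the term in `Mv` on the right of `hMv` is absorbed on the left.
  have hMv2 : Mv ≤ 2 * (|ε| * L) * Mh := by nlinarith
  have hMv1 : Mv ≤ Mh := by nlinarith
  -- `Φ' = N - D`, so differentiating `h (1 - ε Φ)` replaces the oscillating coefficient `N` by its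
  -- mean `D` up to a further factor `ε`.
  set Φ := centredPrimitive N with hΦ
  have hΦc : Continuous fun t => Φ (α t) := ho.continuous_comp _
    (continuous_centredPrimitive hmN hN) (centredPrimitive_periodic hmN hN hpN)
  have hΦb : ∀ θ, |Φ θ| ≤ P := abs_centredPrimitive_le hmN hN hpN
  have hεΦ : ∀ t, |ε * Φ (α t)| ≤ 1 / 2 := fun t => by
    rw [abs_mul]
    exact (mul_le_mul_of_nonneg_left (hΦb _) (abs_nonneg _)).trans hεP
  obtain ⟨t₀, hmax⟩ := exists_isMax_of_periodic (k := fun t => (h t * (1 - ε * Φ (α t))) ^ 2)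
    ((hhc.mul (continuous_const.sub (continuous_const.mul hΦc))).pow 2) ho.pos
    fun t => by simp only [hhp t, ho.periodic_angle t]
  have hMh : Mh = 0 := by
    refine radius_eq_zero_of_max (E := |ε| * K + 4 * (|D| / 128)) (D := D) hε hhc hΦc hmax₁ rfl
      hεΦ (by positivity) (by linarith) hmax ?_
    filter_upwards [ho.hasDerivAt t₀] with s ⟨hsin, Ω, hΩ, hα, hR', _⟩
    set e := piecewiseAngle Fp Fm (α s) (ε, R s, w s) -
      piecewiseAngle Fp Fm (α s) (ε, Rs (α s), ws (α s)) -
      (N (α s) * h s + V (α s) * v s) with he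
    have he' : |e| ≤ |D| / 128 * max |h s| |v s| := by
      have := hF (ε, R s, w s) (ε, Rs (α s), ws (α s))
        (hball hε₂ (hR s).1.2 (hw s).1.2) (hball hε₂ (hRs _).1.2 (hws _).1.2) (α s)
      rwa [hnorm, hnorm', piecewiseAngle_sliceDeriv_apply] at this
    have hh' := hR'.sub ((hs.hasDerivAt_fst _ hsin).comp s hα)
    have hΦ' := (((hasDerivAt_centredPrimitive hmN hN
      (continuousAt_radialDeriv hFp hFm hsin)).comp s hα).const_mul ε).const_sub 1
    refine ⟨Ω, -(ε * Φ (α s)) * (N (α s) * h s) + (V (α s) * v s + e) * (1 - ε * Φ (α s)), hΩ,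
      ?_, (hh'.mul hΦ').congr_deriv ?_⟩
    · have hm : max |h s| |v s| ≤ Mh := max_le (hmax₁ s) ((hmax₂ s).trans hMv1)
      have hfac : |1 - ε * Φ (α s)| ≤ 2 := by
        have := abs_le.1 (hεΦ s)
        rw [abs_le]
        constructor <;> linarith [this.1, this.2]
      calc _ ≤ |ε| * |Φ (α s)| * (|N (α s)| * |h s|) +
            (|V (α s)| * |v s| + |e|) * |1 - ε * Φ (α s)| := by
            refine (abs_add_le _ _).trans ?_
            rw [abs_mul, abs_neg, abs_mul ε, abs_mul (N _), abs_mul (_ + e)]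
            gcongr
            exact (abs_add_le _ _).trans (by rw [abs_mul])
        _ ≤ |ε| * P * (B * Mh) + (B * (2 * (|ε| * L) * Mh) + |D| / 128 * Mh) * 2 := by
            gcongr
            · exact hΦb _
            · exact hN _
            · exact hmax₁ s
            · exact hV _
            · exact (hmax₂ s).trans hMv2
            · exact he'.trans (by gcongr)
        _ ≤ _ := by
            rw [hK]
            nlinarith [mul_nonneg hD0.le hMh0]
    · simp only [he, hh, Function.comp_apply, Pi.sub_apply]
      ring
  have hMv : Mv = 0 := le_antisymm (by rw [hMh] at hMv1; exact hMv1) hMv0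
  intro t
  have h1 := hmax₁ t
  have h2 := hmax₂ t
  constructor
  · exact sub_eq_zero.1 (abs_nonpos_iff.1 (h1.trans hMh.le))
  · exact sub_eq_zero.1 (abs_nonpos_iff.1 (h2.trans hMv.le))

end

/-! ### Polar form of the perturbed system -/

/-- A perturbation `(ε A, ε B, 0)` of the unperturbed field, with `A`, `B` functions of
`(ε, z)`. -/
noncomputable def halfField (f : ℝ → ℝ) (A B : ℝ × ℝ → ℝ) (ε : ℝ) (p : Space3) : Space3 :=
  (-p.2.1 + ε * A (ε, p.2.2), p.1 + ε * B (ε, p.2.2),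
    -p.2.2 + forcing (fun x _ => f x) p.1 p.2.1)

/-- The vertical coordinate, in terms of the angle and of `(ε, R, w)`. -/
noncomputable def polarHeight (f : ℝ → ℝ) (θ : ℝ) (q : ℝ × ℝ × ℝ) : ℝ :=
  q.2.2 + f (q.2.1 * cos θ)

noncomputable def radialPart (f : ℝ → ℝ) (A B : ℝ × ℝ → ℝ) (θ : ℝ) (q : ℝ × ℝ × ℝ) : ℝ :=
  cos θ * A (q.1, polarHeight f θ q) + sin θ * B (q.1, polarHeight f θ q)

noncomputable def angularPart (f : ℝ → ℝ) (A B : ℝ × ℝ → ℝ) (θ : ℝ) (q : ℝ × ℝ × ℝ) : ℝ :=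
  (cos θ * B (q.1, polarHeight f θ q) - sin θ * A (q.1, polarHeight f θ q)) / q.2.1

noncomputable def angularSpeed (f : ℝ → ℝ) (A B : ℝ × ℝ → ℝ) (θ : ℝ) (q : ℝ × ℝ × ℝ) : ℝ :=
  1 + q.1 * angularPart f A B θ q

noncomputable def radialRate (f : ℝ → ℝ) (A B : ℝ × ℝ → ℝ) (θ : ℝ) (q : ℝ × ℝ × ℝ) : ℝ :=
  radialPart f A B θ q / angularSpeed f A B θ q

noncomputable def transRate (f : ℝ → ℝ) (A B : ℝ × ℝ → ℝ) (θ : ℝ) (q : ℝ × ℝ × ℝ) : ℝ :=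
  (q.2.2 * angularPart f A B θ q - deriv f (q.2.1 * cos θ) * A (q.1, polarHeight f θ q)) /
    angularSpeed f A B θ q

section

variable {f : ℝ → ℝ} {A B : ℝ × ℝ → ℝ} {r : ℝ}

theorem contDiff_polarHeight (hf : ContDiff ℝ 2 f) :
    ContDiff ℝ 1 (Function.uncurry (polarHeight f)) := by
  have hf : ContDiff ℝ 1 f := hf.of_le (by norm_num)
  unfold polarHeight Function.uncurry
  fun_prop

theorem contDiff_radialPart (hf : ContDiff ℝ 2 f) (hA : ContDiff ℝ 1 A) (hB : ContDiff ℝ 1 B) :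
    ContDiff ℝ 1 (Function.uncurry (radialPart f A B)) := by
  have h := contDiff_polarHeight hf
  unfold Function.uncurry at h
  unfold radialPart Function.uncurry
  fun_prop

theorem contDiffAt_angularPart (hf : ContDiff ℝ 2 f) (hA : ContDiff ℝ 1 A) (hB : ContDiff ℝ 1 B)
    (hr : r ≠ 0) (θ : ℝ) : ContDiffAt ℝ 1 (Function.uncurry (angularPart f A B)) (θ, (0, r, 0)) := by
  have h := contDiff_polarHeight hf
  unfold Function.uncurry at h
  unfold angularPart Function.uncurry
  exact ContDiffAt.div (ContDiff.contDiffAt (by fun_prop)) (ContDiff.contDiffAt (by fun_prop)) hr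

theorem contDiffAt_angularSpeed (hf : ContDiff ℝ 2 f) (hA : ContDiff ℝ 1 A) (hB : ContDiff ℝ 1 B)
    (hr : r ≠ 0) (θ : ℝ) :
    ContDiffAt ℝ 1 (Function.uncurry (angularSpeed f A B)) (θ, (0, r, 0)) := by
  have h := contDiffAt_angularPart hf hA hB hr θ
  unfold Function.uncurry at h
  unfold angularSpeed Function.uncurry
  fun_prop

theorem angularSpeed_zero (f : ℝ → ℝ) (A B : ℝ × ℝ → ℝ) (θ R w : ℝ) :
    angularSpeed f A B θ (0, R, w) = 1 := by
  simp [angularSpeed]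

theorem polarHeight_periodic (f : ℝ → ℝ) : Function.Periodic (polarHeight f) (2 * π) := fun θ => by
  ext q
  simp [polarHeight]

theorem angularPart_periodic (f : ℝ → ℝ) (A B : ℝ × ℝ → ℝ) :
    Function.Periodic (angularPart f A B) (2 * π) := fun θ => by
  ext q
  simp [angularPart, polarHeight_periodic f θ]

theorem angularSpeed_periodic (f : ℝ → ℝ) (A B : ℝ × ℝ → ℝ) :
    Function.Periodic (angularSpeed f A B) (2 * π) := fun θ => by
  ext q
  simp [angularSpeed, angularPart_periodic f A B θ]

theorem radialRate_periodic (f : ℝ → ℝ) (A B : ℝ × ℝ → ℝ) :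
    Function.Periodic (radialRate f A B) (2 * π) := fun θ => by
  ext q
  simp [radialRate, radialPart, polarHeight_periodic f θ, angularSpeed_periodic f A B θ]

theorem transRate_periodic (f : ℝ → ℝ) (A B : ℝ × ℝ → ℝ) :
    Function.Periodic (transRate f A B) (2 * π) := fun θ => by
  ext q
  simp [transRate, angularPart_periodic f A B θ, polarHeight_periodic f θ,
    angularSpeed_periodic f A B θ]

theorem smoothAlong_angularSpeed (hf : ContDiff ℝ 2 f) (hA : ContDiff ℝ 1 A)
    (hB : ContDiff ℝ 1 B) (hr : r ≠ 0) : SmoothAlong (angularSpeed f A B) (0, r, 0) :=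
  ⟨contDiffAt_angularSpeed hf hA hB hr, angularSpeed_periodic f A B⟩

theorem smoothAlong_radialRate (hf : ContDiff ℝ 2 f) (hA : ContDiff ℝ 1 A)
    (hB : ContDiff ℝ 1 B) (hr : r ≠ 0) : SmoothAlong (radialRate f A B) (0, r, 0) :=
  ⟨fun θ => (contDiff_radialPart hf hA hB).contDiffAt.div (contDiffAt_angularSpeed hf hA hB hr θ)
    (by simp [angularSpeed_zero]), radialRate_periodic f A B⟩

theorem smoothAlong_transRate (hf : ContDiff ℝ 2 f) (hA : ContDiff ℝ 1 A)
    (hB : ContDiff ℝ 1 B) (hr : r ≠ 0) : SmoothAlong (transRate f A B) (0, r, 0) := by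
  refine ⟨fun θ => ContDiffAt.div ?_ (contDiffAt_angularSpeed hf hA hB hr θ)
    (by simp [angularSpeed_zero]), transRate_periodic f A B⟩
  have h := contDiff_polarHeight hf
  have h1 := contDiffAt_angularPart hf hA hB hr θ
  have hf' : ContDiff ℝ 1 (deriv f) := (contDiff_succ_iff_deriv (n := 1)).1 hf |>.2.2
  unfold Function.uncurry at h h1
  have h2 : ContDiff ℝ 1 fun p : ℝ × ℝ × ℝ × ℝ =>
      deriv f (p.2.2.1 * cos p.1) * A (p.2.1, polarHeight f p.1 p.2) := by fun_prop
  exact ContDiffAt.sub (ContDiffAt.mul (by fun_prop) h1) h2.contDiffAt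

/-- The planar part of a point as a complex number. -/
def planePart (p : Space3) : ℂ := ⟨p.1, p.2.1⟩

theorem continuous_planePart : Continuous planePart :=
  (Complex.equivRealProdCLM.symm.continuous.comp
    (by fun_prop : Continuous fun p : Space3 => (p.1, p.2.1)))

/-- The height above the graph of `f`. -/
def transCoord (f : ℝ → ℝ) (p : Space3) : ℝ := p.2.2 - f p.1

/-- The point with the given polar coordinates. -/
noncomputable def polarPoint (f : ℝ → ℝ) (θ R w : ℝ) : Space3 :=
  (R * cos θ, R * sin θ, w + f (R * cos θ))

theorem polarPoint_arg (f : ℝ → ℝ) (p : Space3) :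
    polarPoint f (Complex.arg (planePart p)) ‖planePart p‖ (transCoord f p) = p := by
  have h1 := Complex.norm_mul_cos_arg (planePart p)
  have h2 := Complex.norm_mul_sin_arg (planePart p)
  unfold polarPoint
  rw [h1, h2]
  simp [planePart, transCoord]

theorem forcing_eq (f : ℝ → ℝ) (x y : ℝ) : forcing (fun x _ => f x) x y = f x - y * deriv f x := by
  simp [forcing]

/-- Decomposition of the planar velocity into radial and angular parts. The third entry contains no
`ε`: the perturbation reaches `w` only through the derivative of `f x`. -/
theorem halfField_polarPoint (hR : (0 : ℝ) < r) (ε θ w : ℝ) :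
    halfField f A B ε (polarPoint f θ r w) =
      (ε * radialPart f A B θ (ε, r, w) * cos θ - angularSpeed f A B θ (ε, r, w) * (r * sin θ),
        ε * radialPart f A B θ (ε, r, w) * sin θ + angularSpeed f A B θ (ε, r, w) * (r * cos θ),
        -w - r * sin θ * deriv f (r * cos θ)) := by
  have hr := hR.ne'
  have h1 := sin_sq_add_cos_sq θ
  simp only [halfField, polarPoint, forcing_eq, radialPart, angularSpeed, angularPart,
    polarHeight]
  refine Prod.ext ?_ (Prod.ext ?_ ?_)
  · simp only
    field_simp
    linear_combination (-ε * A (ε, w + f (r * cos θ))) * h1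
  · simp only
    field_simp
    linear_combination (-ε * B (ε, w + f (r * cos θ))) * h1
  · simp only
    ring

theorem HasDerivAt.complex_of_re_im {x y : ℝ → ℝ} {x' y' t : ℝ} (hx : HasDerivAt x x' t)
    (hy : HasDerivAt y y' t) : HasDerivAt (fun t => (⟨x t, y t⟩ : ℂ)) ⟨x', y'⟩ t :=
  (Complex.equivRealProdCLM.symm.hasFDerivAt (x := (x t, y t))).comp_hasDerivAt t (hx.prodMk hy)

theorem HasDerivAt.space3_components {γ : ℝ → Space3} {v : Space3} {t : ℝ}
    (h : HasDerivAt γ v t) : HasDerivAt (fun t => (γ t).1) v.1 t ∧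
      HasDerivAt (fun t => (γ t).2.1) v.2.1 t ∧ HasDerivAt (fun t => (γ t).2.2) v.2.2 t := by
  have h2 := (ContinuousLinearMap.snd ℝ ℝ (ℝ × ℝ)).hasFDerivAt.comp_hasDerivAt t h
  exact ⟨(ContinuousLinearMap.fst ℝ ℝ (ℝ × ℝ)).hasFDerivAt.comp_hasDerivAt t h,
    (ContinuousLinearMap.fst ℝ ℝ ℝ).hasFDerivAt.comp_hasDerivAt t h2,
    (ContinuousLinearMap.snd ℝ ℝ ℝ).hasFDerivAt.comp_hasDerivAt t h2⟩

theorem norm_planePart (p : Space3) : ‖planePart p‖ = √(p.1 ^ 2 + p.2.1 ^ 2) := by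
  rw [Complex.norm_eq_sqrt_sq_add_sq]
  rfl

/-- As a complex number the velocity is the position times a factor: its real part is the relative
radial growth and its imaginary part the angular speed. This factor is the logarithmic derivative of
the position. -/
theorem planePart_halfField (ε : ℝ) {p : Space3} (hp : planePart p ≠ 0) {θ R w : ℝ}
    (hθ : θ = Complex.arg (planePart p)) (hR : R = ‖planePart p‖) (hw : w = transCoord f p) :
    planePart (halfField f A B ε p) =
      (⟨ε * radialPart f A B θ (ε, R, w) / R, angularSpeed f A B θ (ε, R, w)⟩ : ℂ) *
        planePart p := by
  have hR0 : 0 < R := hR ▸ norm_pos_iff.2 hp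
  have hpp : polarPoint f θ R w = p := by
    rw [hθ, hR, hw]
    exact polarPoint_arg f p
  rw [← hpp, halfField_polarPoint hR0]
  have := hR0.ne'
  apply Complex.ext
  · simp only [planePart, polarPoint, Complex.mul_re]
    field_simp
  · simp only [planePart, polarPoint, Complex.mul_im]
    field_simp

/-- Along a trajectory, every branch of the angle rotates with the angular speed. -/
theorem hasDerivAt_arg_mul_planePart {γ : ℝ → Space3} {ε t : ℝ}
    (h : HasDerivAt γ (halfField f A B ε (γ t)) t) {c : ℂ}
    (hc : c * planePart (γ t) ∈ Complex.slitPlane) :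
    HasDerivAt (fun t => Complex.arg (c * planePart (γ t)))
      (angularSpeed f A B (Complex.arg (planePart (γ t)))
        (ε, ‖planePart (γ t)‖, transCoord f (γ t))) t := by
  obtain ⟨hx, hy, -⟩ := h.space3_components
  have hu : HasDerivAt (fun t => planePart (γ t)) (planePart (halfField f A B ε (γ t))) t :=
    HasDerivAt.complex_of_re_im hx hy
  have hne := Complex.slitPlane_ne_zero hc
  have hlog := (hu.const_mul c).clog_real hc
  rw [mul_div_mul_left _ _ (left_ne_zero_of_mul hne),
    planePart_halfField ε (right_ne_zero_of_mul hne) rfl rfl rfl,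
    mul_div_cancel_right₀ _ (right_ne_zero_of_mul hne)] at hlog
  have harg : (fun t => Complex.arg (c * planePart (γ t))) =
      Complex.imCLM ∘ fun t => Complex.log (c * planePart (γ t)) := by
    ext s
    simp [Complex.log_im]
  rw [harg]
  exact Complex.imCLM.hasFDerivAt.comp_hasDerivAt t hlog

theorem hasDerivAt_norm_planePart {γ : ℝ → Space3} {ε t : ℝ}
    (h : HasDerivAt γ (halfField f A B ε (γ t)) t) (hne : planePart (γ t) ≠ 0) :
    HasDerivAt (fun t => ‖planePart (γ t)‖)
      (ε * radialPart f A B (Complex.arg (planePart (γ t)))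
        (ε, ‖planePart (γ t)‖, transCoord f (γ t))) t := by
  obtain ⟨hx, hy, -⟩ := h.space3_components
  set R := ‖planePart (γ t)‖ with hR
  set θ := Complex.arg (planePart (γ t)) with hθ
  have hR0 : 0 < R := norm_pos_iff.2 hne
  have hsq : (γ t).1 ^ 2 + (γ t).2.1 ^ 2 = R ^ 2 := by
    rw [hR, norm_planePart, Real.sq_sqrt (by positivity)]
  have h1 := ((hx.fun_pow 2).add (hy.fun_pow 2)).sqrt (by
    simp only [Pi.add_apply]
    rw [hsq]
    positivity)
  simp_rw [norm_planePart]
  refine h1.congr_deriv ?_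
  simp only [Pi.add_apply]
  rw [hsq, Real.sqrt_sq hR0.le]
  have hp := halfField_polarPoint (f := f) (A := A) (B := B) hR0 ε θ (transCoord f (γ t))
  have hpp : polarPoint f θ R (transCoord f (γ t)) = γ t := polarPoint_arg f (γ t)
  have hx' : (γ t).1 = R * cos θ := by rw [← hpp]; rfl
  have hy' : (γ t).2.1 = R * sin θ := by rw [← hpp]; rfl
  rw [hpp] at hp
  rw [hp, hx', hy']
  have := sin_sq_add_cos_sq θ
  field_simp
  simp only [Nat.cast_ofNat, Nat.add_one_sub_one, pow_one]
  linear_combination (2 * ε * R * radialPart f A B θ (ε, R, transCoord f (γ t))) * this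

/-- The term `-y f'` in the forcing cancels the unperturbed motion of `f x`, leaving pure decay plus
`O(ε)`. -/
theorem hasDerivAt_transCoord {γ : ℝ → Space3} {ε t : ℝ} (hf : Differentiable ℝ f)
    (h : HasDerivAt γ (halfField f A B ε (γ t)) t) :
    HasDerivAt (fun t => transCoord f (γ t))
      (-transCoord f (γ t) - ε * (deriv f (γ t).1 * A (ε, (γ t).2.2))) t := by
  obtain ⟨hx, -, hz⟩ := h.space3_components
  refine (hz.sub ((hf _).hasDerivAt.comp t hx)).congr_deriv ?_
  simp only [halfField, forcing_eq, transCoord]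
  ring

/-- The coordinates of a trajectory in terms of the rates with respect to the angle. -/
theorem hasDerivAt_polar_rates {γ : ℝ → Space3} {ε t : ℝ} (hf : Differentiable ℝ f)
    (h : HasDerivAt γ (halfField f A B ε (γ t)) t) (hne : planePart (γ t) ≠ 0) {θ : ℝ}
    {q : ℝ × ℝ × ℝ} (hθ : θ = Complex.arg (planePart (γ t)))
    (hq : q = (ε, ‖planePart (γ t)‖, transCoord f (γ t))) (hΩ : 0 < angularSpeed f A B θ q) :
    HasDerivAt (fun t => ‖planePart (γ t)‖)
      (ε * radialRate f A B θ q * angularSpeed f A B θ q) t ∧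
    HasDerivAt (fun t => transCoord f (γ t))
      ((-transCoord f (γ t) + ε * transRate f A B θ q) * angularSpeed f A B θ q) t := by
  constructor
  · refine (hasDerivAt_norm_planePart h hne).congr_deriv ?_
    rw [← hθ, ← hq, radialRate]
    field_simp
  · refine (hasDerivAt_transCoord hf h).congr_deriv ?_
    have hpp : polarPoint f θ q.2.1 q.2.2 = γ t := by
      rw [hθ, hq]
      exact polarPoint_arg f (γ t)
    have hx : (γ t).1 = q.2.1 * cos θ := by rw [← hpp]; rfl
    have hz : (γ t).2.2 = polarHeight f θ q := by rw [← hpp]; rfl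
    have hw : transCoord f (γ t) = q.2.2 := by rw [hq]
    have hε : ε = q.1 := by rw [hq]
    rw [hx, hz, hw, transRate, hε]
    field_simp
    unfold angularSpeed
    ring

end

/-! ### Crossing orbits in polar coordinates -/

section

variable {Xp Xm : Space3 → Space3} {η : ℝ → Space3}

theorem IsCrossingOrbit.continuous (h : IsCrossingOrbit Xp Xm η) : Continuous η := by
  refine continuous_iff_continuousAt.2 fun t => ?_
  rcases lt_trichotomy (η t).2.1 0 with hy | hy | hy
  · exact (h.lower t hy).continuousAt
  · have hc := (h.crossing t hy).2
    rcases lt_trichotomy (Xp (η t)).2.1 0 with hX | hX | hX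
    · obtain ⟨h1, h2⟩ := h.downward t hy hX
      exact continuousAt_iff_continuous_left_right.2
        ⟨h1.continuousWithinAt, h2.continuousWithinAt⟩
    · simp [hX] at hc
    · obtain ⟨h1, h2⟩ := h.upward t hy hX
      exact continuousAt_iff_continuous_left_right.2
        ⟨h1.continuousWithinAt, h2.continuousWithinAt⟩
  · exact (h.upper t hy).continuousAt

theorem eventually_ne_of_hasDerivWithinAt {v w : Space3} {t : ℝ}
    (h1 : HasDerivWithinAt η v (Iic t) t) (h2 : HasDerivWithinAt η w (Ici t) t)
    (hv : v.2.1 ≠ 0) (hw : w.2.1 ≠ 0) : ∀ᶠ s in 𝓝[≠] t, (η s).2.1 ≠ 0 := by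
  have key : ∀ {S : Set ℝ} {v : Space3}, HasDerivWithinAt η v S t → v.2.1 ≠ 0 →
      ∀ᶠ s in 𝓝[S \ {t}] t, (η s).2.1 ≠ 0 := fun {S v} h hv => by
    have h3 := (ContinuousLinearMap.snd ℝ ℝ (ℝ × ℝ)).hasFDerivAt.comp_hasDerivWithinAt t h
    have h4 : HasDerivWithinAt (fun s => (η s).2.1) v.2.1 S t :=
      (ContinuousLinearMap.fst ℝ ℝ ℝ).hasFDerivAt.comp_hasDerivWithinAt t h3
    exact h4.eventually_ne hv
  have h3 := key h1 hv
  have h4 := key h2 hw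
  rw [Iic_sdiff_right] at h3
  rw [Ici_sdiff_left] at h4
  rw [← nhdsLT_sup_nhdsGT]
  exact eventually_sup.2 ⟨h3, h4⟩

/-- Crossing times are isolated. -/
theorem IsCrossingOrbit.eventually_ne (h : IsCrossingOrbit Xp Xm η) (t : ℝ) :
    ∀ᶠ s in 𝓝[≠] t, (η s).2.1 ≠ 0 := by
  by_cases hy : (η t).2.1 = 0
  · have hc := (h.crossing t hy).2
    have hp := left_ne_zero_of_mul hc.ne'
    have hm := right_ne_zero_of_mul hc.ne'
    rcases hp.lt_or_gt with hX | hX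
    · obtain ⟨h1, h2⟩ := h.downward t hy hX
      exact eventually_ne_of_hasDerivWithinAt h1 h2 hp hm
    · obtain ⟨h1, h2⟩ := h.upward t hy hX
      exact eventually_ne_of_hasDerivWithinAt h1 h2 hm hp
  · have h1 : ContinuousAt (fun s => (η s).2.1) t := by
      have := h.continuous
      fun_prop
    exact (h1.eventually_ne hy).filter_mono nhdsWithin_le_nhds

end

theorem sin_arg_planePart_pos {p : Space3} (hp : 0 < p.2.1) :
    0 < sin (Complex.arg (planePart p)) := by
  have hne : planePart p ≠ 0 := fun h => hp.ne' (congrArg Complex.im h)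
  have h := Complex.norm_mul_sin_arg (planePart p)
  exact (mul_pos_iff_of_pos_left (norm_pos_iff.2 hne)).1 (h.symm ▸ hp)

theorem sin_arg_planePart_neg {p : Space3} (hp : p.2.1 < 0) :
    sin (Complex.arg (planePart p)) < 0 := by
  have h := Complex.norm_mul_sin_arg (planePart p)
  by_contra! hs
  have h1 := mul_nonneg (norm_nonneg (planePart p)) hs
  rw [h] at h1
  exact not_lt.2 h1 hp

section

variable {f : ℝ → ℝ} {Ap Bp Am Bm : ℝ × ℝ → ℝ}

/-- Off the switching plane a crossing orbit satisfies the polar equations. -/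
theorem IsCrossingOrbit.hasDerivAt_polar {ε : ℝ} {η : ℝ → Space3} (hf : Differentiable ℝ f)
    (h : IsCrossingOrbit (halfField f Ap Bp ε) (halfField f Am Bm ε) η)
    (hΩp : ∀ t, 0 < angularSpeed f Ap Bp (Complex.arg (planePart (η t)))
      (ε, ‖planePart (η t)‖, transCoord f (η t)))
    (hΩm : ∀ t, 0 < angularSpeed f Am Bm (Complex.arg (planePart (η t)))
      (ε, ‖planePart (η t)‖, transCoord f (η t))) {s : ℝ} (hs : (η s).2.1 ≠ 0) :
    sin (Complex.arg (planePart (η s))) ≠ 0 ∧ ∃ Ω, 0 < Ω ∧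
      (∀ c : ℂ, c * planePart (η s) ∈ Complex.slitPlane →
        HasDerivAt (fun t => Complex.arg (c * planePart (η t))) Ω s) ∧
      HasDerivAt (fun t => ‖planePart (η t)‖) (ε * piecewiseAngle (radialRate f Ap Bp)
        (radialRate f Am Bm) (Complex.arg (planePart (η s)))
        (ε, ‖planePart (η s)‖, transCoord f (η s)) * Ω) s ∧
      HasDerivAt (fun t => transCoord f (η t)) ((-transCoord f (η s) + ε * piecewiseAngle
        (transRate f Ap Bp) (transRate f Am Bm) (Complex.arg (planePart (η s)))
        (ε, ‖planePart (η s)‖, transCoord f (η s))) * Ω) s := by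
  have hne : planePart (η s) ≠ 0 := fun h => hs (congrArg Complex.im h)
  rcases hs.lt_or_gt with hy | hy
  · have hsin := sin_arg_planePart_neg hy
    have hd := h.lower s hy
    obtain ⟨h1, h2⟩ := hasDerivAt_polar_rates hf hd hne rfl rfl (hΩm s)
    refine ⟨hsin.ne, _, hΩm s, fun c hc => hasDerivAt_arg_mul_planePart hd hc, ?_, ?_⟩
    · simpa [piecewiseAngle, hsin.le.not_gt] using h1
    · simpa [piecewiseAngle, hsin.le.not_gt] using h2
  · have hsin := sin_arg_planePart_pos hy
    have hd := h.upper s hy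
    obtain ⟨h1, h2⟩ := hasDerivAt_polar_rates hf hd hne rfl rfl (hΩp s)
    refine ⟨hsin.ne', _, hΩp s, fun c hc => hasDerivAt_arg_mul_planePart hd hc, ?_, ?_⟩
    · simpa [piecewiseAngle, hsin] using h1
    · simpa [piecewiseAngle, hsin] using h2

theorem IsPeriodicCrossingOrbit.isPolarOrbit {ε T : ℝ} {η : ℝ → Space3} (hf : Differentiable ℝ f)
    (h : IsPeriodicCrossingOrbit (halfField f Ap Bp ε) (halfField f Am Bm ε) η T)
    (hne : ∀ t, planePart (η t) ≠ 0)
    (hΩp : ∀ t, 0 < angularSpeed f Ap Bp (Complex.arg (planePart (η t)))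
      (ε, ‖planePart (η t)‖, transCoord f (η t)))
    (hΩm : ∀ t, 0 < angularSpeed f Am Bm (Complex.arg (planePart (η t)))
      (ε, ‖planePart (η t)‖, transCoord f (η t))) :
    IsPolarOrbit (radialRate f Ap Bp) (radialRate f Am Bm) (transRate f Ap Bp)
      (transRate f Am Bm) ε (fun t => Complex.arg (planePart (η t)))
      (fun t => ‖planePart (η t)‖) (fun t => transCoord f (η t)) T where
  pos := h.pos
  continuous_comp φ hφ hp := continuous_iff_continuousAt.2 fun t =>
    (continuousAt_periodic_comp_arg hφ hp (hne t)).comp (f := fun t => planePart (η t))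
      (continuous_planePart.comp h.orbit.continuous).continuousAt
  continuous_radius := (continuous_planePart.comp h.orbit.continuous).norm
  continuous_trans := by
    have := h.orbit.continuous
    have := hf.continuous
    unfold transCoord
    fun_prop
  periodic_angle t := by simp only [h.periodic t]
  periodic_radius t := by simp only [h.periodic t]
  periodic_trans t := by simp only [h.periodic t]
  hasDerivAt t := by
    filter_upwards [h.orbit.eventually_ne t] with s hs
    obtain ⟨h1, Ω, hΩ, h2, h3⟩ := h.orbit.hasDerivAt_polar hf hΩp hΩm hs
    refine ⟨h1, Ω, hΩ, ?_, h3⟩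
    simpa using h2 1 (by
      rw [one_mul]
      exact Complex.mem_slitPlane_iff.2 (Or.inr hs))

/-- A periodic crossing orbit that rotates about the axis and lies on a closed curve transverse
to the half-planes through the axis covers the whole curve. -/
theorem IsPeriodicCrossingOrbit.exists_arg_eq {ε T : ℝ} {η : ℝ → Space3} (hf : Differentiable ℝ f)
    (h : IsPeriodicCrossingOrbit (halfField f Ap Bp ε) (halfField f Am Bm ε) η T)
    (hne : ∀ t, planePart (η t) ≠ 0)
    (hΩp : ∀ t, 0 < angularSpeed f Ap Bp (Complex.arg (planePart (η t)))
      (ε, ‖planePart (η t)‖, transCoord f (η t)))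
    (hΩm : ∀ t, 0 < angularSpeed f Am Bm (Complex.arg (planePart (η t)))
      (ε, ‖planePart (η t)‖, transCoord f (η t))) (a : ℝ) :
    ∃ t, planePart (η t) = ‖planePart (η t)‖ * Complex.exp (a * Complex.I) := by
  by_contra! hcon
  -- Multiplication by `c` turns the ray of angle `a` onto the negative real axis. If the orbit
  -- misses that ray, its rotated argument is continuous and periodic with positive derivative off
  -- the crossing times, which is impossible at a maximum.
  set c : ℂ := -Complex.exp (-(a * Complex.I)) with hc
  have hslit : ∀ t, c * planePart (η t) ∈ Complex.slitPlane := by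
    intro t
    rw [Complex.mem_slitPlane_iff_arg]
    refine ⟨fun harg => hcon t ?_, mul_ne_zero (by simp [hc, Complex.exp_ne_zero]) (hne t)⟩
    have h1 := Complex.norm_mul_exp_arg_mul_I (c * planePart (η t))
    rw [harg, Complex.exp_pi_mul_I, norm_mul] at h1
    have h2 : ‖c‖ = 1 := by
      rw [hc, norm_neg, ← neg_mul, ← Complex.ofReal_neg, Complex.norm_exp_ofReal_mul_I]
    rw [h2, one_mul, hc, neg_mul, mul_neg_one, neg_inj] at h1
    rw [h1, mul_right_comm, ← Complex.exp_add]
    simp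
  have hcont : Continuous fun t => Complex.arg (c * planePart (η t)) :=
    continuous_iff_continuousAt.2 fun t => (Complex.continuousAt_arg (hslit t)).comp
      (f := fun t => c * planePart (η t))
      (continuous_const.mul (continuous_planePart.comp h.orbit.continuous)).continuousAt
  obtain ⟨t₀, hmax⟩ := exists_isMax_of_periodic hcont h.pos fun t => by simp only [h.periodic t]
  refine false_of_isMax_of_deriv_pos hcont hmax ?_
  filter_upwards [h.orbit.eventually_ne t₀] with s hs
  obtain ⟨-, Ω, hΩ, h2, -⟩ := h.orbit.hasDerivAt_polar hf hΩp hΩm hs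
  exact ⟨Ω, h2 c (hslit s), hΩ⟩

end

/-! ### From periodic solutions to crossing orbits -/

/-- Inversion of the time `t(θ) = ∫ p` for a periodic density `p` close to `1`. -/
theorem exists_clock {p : ℝ → ℝ} {c : ℝ} (hm : Measurable p) (hc : ∀ s, |p s - 1| ≤ c)
    (hc2 : c ≤ 1 / 2) (hp : Function.Periodic p (2 * π)) :
    ∃ (ϑ : ℝ → ℝ) (T : ℝ), Continuous ϑ ∧ StrictMono ϑ ∧ Function.Surjective ϑ ∧
      ϑ 0 = 0 ∧ 0 < T ∧
      (∀ t, ϑ (t + T) = ϑ t + 2 * π) ∧ |T - 2 * π| ≤ c * (2 * π) ∧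
      (∀ t, |ϑ t - t| ≤ c * |ϑ t|) ∧
      ∀ t, ContinuousAt p (ϑ t) → HasDerivAt ϑ (p (ϑ t))⁻¹ t := by
  have hlow : ∀ s, 1 / 2 ≤ p s := fun s => by
    have := (abs_le.1 (hc s)).1
    linarith
  have hi : ∀ a b, IntervalIntegrable p volume a b :=
    intervalIntegrable_of_measurable_of_bound (B := 1 + c) hm fun s => by
      have := abs_le.1 (hc s)
      rw [abs_le]
      constructor <;> linarith [this.1, this.2, hlow s]
  set τ := fun θ => ∫ s in (0 : ℝ)..θ, p s with hτ
  have hτc : Continuous τ := intervalIntegral.continuous_primitive hi 0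
  have hτ0 : τ 0 = 0 := intervalIntegral.integral_same
  have hdiff : ∀ a b, τ b - τ a = ∫ s in a..b, p s := fun a b =>
    integral_interval_sub_left (hi _ _) (hi _ _)
  have hclose : ∀ a b, |τ b - τ a - (b - a)| ≤ c * |b - a| := by
    intro a b
    have h1 : τ b - τ a - (b - a) = ∫ s in a..b, (p s - 1) := by
      rw [integral_sub (hi _ _) intervalIntegrable_const, hdiff]
      simp
    rw [h1]
    exact intervalIntegral.norm_integral_le_of_norm_le_const
      (f := fun s => p s - 1) fun s _ => hc s
  have hgrow : ∀ a b, a ≤ b → (b - a) / 2 ≤ τ b - τ a := by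
    intro a b hab
    have h1 := (abs_le.1 (hclose a b)).1
    rw [abs_of_nonneg (sub_nonneg.2 hab)] at h1
    nlinarith
  have hmono : StrictMono τ := fun a b hab => by
    have := hgrow a b hab.le
    linarith
  have htop : Tendsto τ atTop atTop := by
    refine tendsto_atTop_mono' _ ?_ (tendsto_id.atTop_div_const (two_pos : (0 : ℝ) < 2))
    filter_upwards [eventually_ge_atTop 0] with x hx
    have := hgrow 0 x hx
    simp only [id, hτ0] at this ⊢
    linarith
  have hbot : Tendsto τ atBot atBot := by
    refine tendsto_atBot_mono' _ ?_ (tendsto_id.atBot_div_const (two_pos : (0 : ℝ) < 2))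
    filter_upwards [eventually_le_atBot 0] with x hx
    have := hgrow x 0 hx
    simp only [id, hτ0] at this ⊢
    linarith
  set e := hmono.orderIsoOfSurjective τ (hτc.surjective htop hbot) with he
  have h1 : ∀ t, τ (e.symm t) = t := fun t => e.apply_symm_apply t
  have h2 : ∀ θ, e.symm (τ θ) = θ := fun θ => e.symm_apply_apply θ
  have hper : ∀ θ, τ (θ + 2 * π) = τ θ + τ (2 * π) := by
    intro θ
    have h := hp.intervalIntegral_add_eq θ 0
    rw [zero_add, ← hdiff] at h
    linarith
  refine ⟨e.symm, τ (2 * π), e.symm.continuous, e.symm.strictMono, e.symm.surjective, ?_, ?_, ?_, ?_, ?_, ?_⟩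
  · rw [← hτ0, h2, hτ0]
  · have := hgrow 0 (2 * π) two_pi_pos.le
    rw [hτ0] at this
    linarith [pi_pos]
  · intro t
    rw [← h2 (e.symm t + 2 * π), hper, h1]
  · have := hclose 0 (2 * π)
    rwa [hτ0, sub_zero, sub_zero, abs_of_pos two_pi_pos] at this
  · intro t
    have := hclose 0 (e.symm t)
    rwa [h1, hτ0, sub_zero, sub_zero, abs_sub_comm] at this
  · intro t ht
    have hd := intervalIntegral.integral_hasDerivAt_right (hi 0 (e.symm t))
      hm.stronglyMeasurable.stronglyMeasurableAtFilter ht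
    exact HasDerivAt.of_local_left_inverse e.symm.continuous.continuousAt hd
      (by linarith [hlow (e.symm t)]) (Eventually.of_forall h1)

theorem eventually_sin_mul_cos_pos {a : ℝ} (ha : sin a = 0) :
    (∀ᶠ x in 𝓝[>] a, ∃ m, 0 < m ∧ sin x = m * cos a) ∧
      ∀ᶠ x in 𝓝[<] a, ∃ m, 0 < m ∧ sin x = -m * cos a := by
  have key : ∀ x, sin x = sin (x - a) * cos a := fun x => by
    conv_lhs => rw [← sub_add_cancel x a, sin_add, ha, mul_zero, add_zero]
  constructor
  · filter_upwards [Ioo_mem_nhdsGT (by linarith [pi_pos] : a < a + π)] with x hx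
    exact ⟨sin (x - a), sin_pos_of_pos_of_lt_pi (by linarith [hx.1]) (by linarith [hx.2]), key x⟩
  · filter_upwards [Ioo_mem_nhdsLT (by linarith [pi_pos] : a - π < a)] with x hx
    refine ⟨-sin (x - a), ?_, by rw [neg_neg]; exact key x⟩
    rw [← sin_neg]
    exact sin_pos_of_pos_of_lt_pi (by linarith [hx.2]) (by linarith [hx.1])

/-- The equation holds just after `t` and the field is continuous, so the derivative has a limit at
`t`, which is then the one-sided derivative. This supplies the concatenation conditions at
crossings. -/
theorem hasDerivWithinAt_Ici_of_eventually {γ : ℝ → Space3} {X : Space3 → Space3} {t : ℝ}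
    (hγ : Continuous γ) (hX : Continuous X) (h : ∀ᶠ s in 𝓝[>] t, HasDerivAt γ (X (γ s)) s) :
    HasDerivWithinAt γ (X (γ t)) (Ici t) t := by
  refine hasDerivWithinAt_Ici_of_tendsto_deriv (s := {s | HasDerivAt γ (X (γ s)) s})
    (fun s hs => HasDerivAt.differentiableAt hs |>.differentiableWithinAt)
    hγ.continuousWithinAt h ?_
  refine (((hX.comp hγ).tendsto t).mono_left nhdsWithin_le_nhds).congr' ?_
  filter_upwards [h] with s hs using hs.deriv.symm

theorem hasDerivWithinAt_Iic_of_eventually {γ : ℝ → Space3} {X : Space3 → Space3} {t : ℝ}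
    (hγ : Continuous γ) (hX : Continuous X) (h : ∀ᶠ s in 𝓝[<] t, HasDerivAt γ (X (γ s)) s) :
    HasDerivWithinAt γ (X (γ t)) (Iic t) t := by
  refine hasDerivWithinAt_Iic_of_tendsto_deriv (s := {s | HasDerivAt γ (X (γ s)) s})
    (fun s hs => HasDerivAt.differentiableAt hs |>.differentiableWithinAt)
    hγ.continuousWithinAt h ?_
  refine (((hX.comp hγ).tendsto t).mono_left nhdsWithin_le_nhds).congr' ?_
  filter_upwards [h] with s hs using hs.deriv.symm

section

variable {f : ℝ → ℝ} {A B Ap Bp Am Bm : ℝ × ℝ → ℝ}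

theorem continuous_halfField (hf : ContDiff ℝ 2 f) (hA : Continuous A) (hB : Continuous B)
    (ε : ℝ) : Continuous (halfField f A B ε) := by
  have h1 := hf.continuous
  have h2 := hf.continuous_deriv (by norm_num)
  unfold halfField
  simp_rw [forcing_eq]
  fun_prop

theorem hasDerivAt_polarPoint {ϑ R w : ℝ → ℝ} {ε t : ℝ} (hf : Differentiable ℝ f)
    (hR0 : 0 < R t) {q : ℝ × ℝ × ℝ} (hq : q = (ε, R t, w t))
    (hΩ : 0 < angularSpeed f A B (ϑ t) q)
    (hϑ : HasDerivAt ϑ (angularSpeed f A B (ϑ t) q) t)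
    (hR : HasDerivAt R (ε * radialRate f A B (ϑ t) q * angularSpeed f A B (ϑ t) q) t)
    (hw : HasDerivAt w
      ((-w t + ε * transRate f A B (ϑ t) q) * angularSpeed f A B (ϑ t) q) t) :
    HasDerivAt (fun t => polarPoint f (ϑ t) (R t) (w t))
      (halfField f A B ε (polarPoint f (ϑ t) (R t) (w t))) t := by
  have hr : R t ≠ 0 := hR0.ne'
  have hR' : ε * radialRate f A B (ϑ t) q * angularSpeed f A B (ϑ t) q =
      ε * radialPart f A B (ϑ t) q := by
    rw [radialRate]
    field_simp
  have hw' : (-w t + ε * transRate f A B (ϑ t) q) * angularSpeed f A B (ϑ t) q =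
      -w t - ε * (deriv f (R t * cos (ϑ t)) * A (ε, polarHeight f (ϑ t) q)) := by
    rw [transRate]
    field_simp
    rw [angularSpeed, hq]
    ring_nf
  rw [hR'] at hR
  rw [hw'] at hw
  have hx := hR.fun_mul hϑ.cos
  have hy := hR.fun_mul hϑ.sin
  have hz := hw.fun_add ((hf (R t * cos (ϑ t))).hasDerivAt.comp t hx)
  refine (hx.prodMk (hy.prodMk hz)).congr_deriv ?_
  rw [halfField_polarPoint hR0, ← hq]
  refine Prod.ext ?_ (Prod.ext ?_ ?_)
  · simp only
    ring
  · simp only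
    ring
  · have h1 := sin_sq_add_cos_sq (ϑ t)
    simp only [angularSpeed, angularPart, radialPart]
    rw [hq]
    field_simp
    linear_combination (deriv f (R t * cos (ϑ t)) * ε *
      A (ε, polarHeight f (ϑ t) (ε, R t, w t))) * h1

/-- A periodic solution of the polar system, run through by a clock, is a crossing orbit. -/
theorem isPeriodicCrossingOrbit_polarPoint {ε T : ℝ} {R w ϑ : ℝ → ℝ} (hf : ContDiff ℝ 2 f)
    (hAp : Continuous Ap) (hBp : Continuous Bp) (hAm : Continuous Am) (hBm : Continuous Bm)
    (hs : IsPeriodicSolution (radialRate f Ap Bp) (radialRate f Am Bm) (transRate f Ap Bp)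
      (transRate f Am Bm) ε R w) (hR0 : ∀ θ, 0 < R θ)
    (hΩp : ∀ θ, 0 < angularSpeed f Ap Bp θ (ε, R θ, w θ))
    (hΩm : ∀ θ, 0 < angularSpeed f Am Bm θ (ε, R θ, w θ))
    (hϑc : Continuous ϑ) (hϑm : StrictMono ϑ) (hϑ0 : ϑ 0 = 0) (hT : 0 < T)
    (hϑT : ∀ t, ϑ (t + T) = ϑ t + 2 * π)
    (hϑd : ∀ t, sin (ϑ t) ≠ 0 → HasDerivAt ϑ (piecewiseAngle (angularSpeed f Ap Bp)
      (angularSpeed f Am Bm) (ϑ t) (ε, R (ϑ t), w (ϑ t))) t) :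
    IsPeriodicCrossingOrbit (halfField f Ap Bp ε) (halfField f Am Bm ε)
      (fun t => polarPoint f (ϑ t) (R (ϑ t)) (w (ϑ t))) T := by
  have hfd : Differentiable ℝ f := hf.differentiable (by norm_num)
  set γ := fun t => polarPoint f (ϑ t) (R (ϑ t)) (w (ϑ t)) with hγ
  have hγc : Continuous γ := by
    have h1 := hs.continuous_fst
    have h2 := hs.continuous_snd
    have h3 := hfd.continuous
    unfold γ polarPoint
    fun_prop
  have hy : ∀ t, (γ t).2.1 = R (ϑ t) * sin (ϑ t) := fun t => rfl
  have hup : ∀ t, 0 < sin (ϑ t) → HasDerivAt γ (halfField f Ap Bp ε (γ t)) t := by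
    intro t ht
    have h1 := hϑd t ht.ne'
    have h2 := (hs.hasDerivAt_fst _ ht.ne').comp t h1
    have h3 := (hs.hasDerivAt_snd _ ht.ne').comp t h1
    simp only [piecewiseAngle, if_pos ht] at h1 h2 h3
    exact hasDerivAt_polarPoint hfd (hR0 _) rfl (hΩp _) h1 h2 h3
  have hlow : ∀ t, sin (ϑ t) < 0 → HasDerivAt γ (halfField f Am Bm ε (γ t)) t := by
    intro t ht
    have h1 := hϑd t ht.ne
    have h2 := (hs.hasDerivAt_fst _ ht.ne).comp t h1
    have h3 := (hs.hasDerivAt_snd _ ht.ne).comp t h1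
    simp only [piecewiseAngle, if_neg ht.le.not_gt] at h1 h2 h3
    exact hasDerivAt_polarPoint hfd (hR0 _) rfl (hΩm _) h1 h2 h3
  have hsin0 : ∀ t, (γ t).2.1 = 0 → sin (ϑ t) = 0 := fun t ht => by
    rw [hy] at ht
    exact (mul_eq_zero.1 ht).resolve_left (hR0 _).ne'
  have hXp : ∀ t, (γ t).2.1 = 0 → (halfField f Ap Bp ε (γ t)).2.1 =
      angularSpeed f Ap Bp (ϑ t) (ε, R (ϑ t), w (ϑ t)) * (R (ϑ t) * cos (ϑ t)) := fun t ht => by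
    simp only [hγ]
    rw [halfField_polarPoint (hR0 _)]
    simp [hsin0 t ht]
  have hXm : ∀ t, (γ t).2.1 = 0 → (halfField f Am Bm ε (γ t)).2.1 =
      angularSpeed f Am Bm (ϑ t) (ε, R (ϑ t), w (ϑ t)) * (R (ϑ t) * cos (ϑ t)) := fun t ht => by
    simp only [hγ]
    rw [halfField_polarPoint (hR0 _)]
    simp [hsin0 t ht]
  have hright : ∀ t, Tendsto ϑ (𝓝[>] t) (𝓝[>] (ϑ t)) := fun t =>
    tendsto_nhdsWithin_of_tendsto_nhds_of_eventually_within _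
      ((hϑc.tendsto t).mono_left nhdsWithin_le_nhds)
      (by filter_upwards [self_mem_nhdsWithin] with s hs using hϑm hs)
  have hleft : ∀ t, Tendsto ϑ (𝓝[<] t) (𝓝[<] (ϑ t)) := fun t =>
    tendsto_nhdsWithin_of_tendsto_nhds_of_eventually_within _
      ((hϑc.tendsto t).mono_left nhdsWithin_le_nhds)
      (by filter_upwards [self_mem_nhdsWithin] with s hs using hϑm hs)
  have hcp := continuous_halfField hf hAp hBp ε
  have hcm := continuous_halfField hf hAm hBm ε
  refine ⟨⟨fun t ht => ?_, fun t ht => ?_, fun t ht => ⟨ht, ?_⟩, fun t ht hX => ?_,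
    fun t ht hX => ?_⟩, hT, fun t => ?_, fun S hS hSp => ?_⟩
  · rw [hy] at ht
    exact hup t ((mul_pos_iff_of_pos_left (hR0 _)).1 ht)
  · rw [hy] at ht
    exact hlow t (by nlinarith [hR0 (ϑ t)])
  -- On the switching plane both second components are positive multiples of `R cos ϑ`, which is
  -- nonzero since `sin ϑ = 0`.
  · rw [hXp t ht, hXm t ht]
    have h1 : cos (ϑ t) ≠ 0 := fun h => by
      have := sin_sq_add_cos_sq (ϑ t)
      rw [h, hsin0 t ht] at this
      norm_num at this
    have h2 : 0 < (R (ϑ t) * cos (ϑ t)) ^ 2 :=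
      pow_two_pos_of_ne_zero (mul_ne_zero (hR0 _).ne' h1)
    have := mul_pos (mul_pos (hΩp (ϑ t)) (hΩm (ϑ t))) h2
    linarith
  · rw [hXp t ht] at hX
    have hcos : 0 < cos (ϑ t) := (mul_pos_iff_of_pos_left (hR0 _)).1
      ((mul_pos_iff_of_pos_left (hΩp _)).1 hX)
    obtain ⟨h1, h2⟩ := eventually_sin_mul_cos_pos (hsin0 t ht)
    constructor
    · refine hasDerivWithinAt_Iic_of_eventually hγc hcm ?_
      filter_upwards [(hleft t).eventually h2] with s ⟨m, hm, hms⟩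
      exact hlow s (by rw [hms]; nlinarith [mul_pos hm hcos])
    · refine hasDerivWithinAt_Ici_of_eventually hγc hcp ?_
      filter_upwards [(hright t).eventually h1] with s ⟨m, hm, hms⟩
      exact hup s (by rw [hms]; exact mul_pos hm hcos)
  · rw [hXp t ht] at hX
    have hcos : cos (ϑ t) < 0 := by
      by_contra! hge
      exact not_lt.2 (mul_nonneg (hΩp _).le (mul_nonneg (hR0 _).le hge)) hX
    obtain ⟨h1, h2⟩ := eventually_sin_mul_cos_pos (hsin0 t ht)
    constructor
    · refine hasDerivWithinAt_Iic_of_eventually hγc hcp ?_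
      filter_upwards [(hleft t).eventually h2] with s ⟨m, hm, hms⟩
      exact hup s (by rw [hms]; nlinarith [mul_pos hm (neg_pos.2 hcos)])
    · refine hasDerivWithinAt_Ici_of_eventually hγc hcm ?_
      filter_upwards [(hright t).eventually h1] with s ⟨m, hm, hms⟩
      exact hlow s (by rw [hms]; nlinarith [mul_pos hm (neg_pos.2 hcos)])
  · simp only [hγ, polarPoint, hϑT, hs.periodic_fst _, hs.periodic_snd _, cos_add_two_pi,
      sin_add_two_pi]
  -- A shorter period would bring the angle, strictly between `0` and `2π`, back to the positive
  -- `x`-axis.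
  · by_contra! hST
    have h0 : γ S = γ 0 := by simpa using hSp 0
    have hpos : 0 < ϑ S := by rw [← hϑ0]; exact hϑm hS
    have hlt : ϑ S < 2 * π := by
      have := hϑm hST
      have h2 := hϑT 0
      rw [zero_add, hϑ0, zero_add] at h2
      rwa [h2] at this
    have hsin : sin (ϑ S) = 0 := hsin0 S (by rw [h0, hy, hϑ0]; simp)
    have hcos : 0 < cos (ϑ S) := by
      have h1 : R (ϑ S) * cos (ϑ S) = R (ϑ 0) * cos (ϑ 0) := congrArg Prod.fst h0
      rw [hϑ0, cos_zero, mul_one] at h1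
      exact (mul_pos_iff_of_pos_left (hR0 (ϑ S))).1 (h1 ▸ hR0 0)
    rcases lt_trichotomy (ϑ S) π with h | h | h
    · exact (sin_pos_of_pos_of_lt_pi hpos h).ne' hsin
    · rw [h, cos_pi] at hcos
      linarith
    · have := sin_pos_of_pos_of_lt_pi (by linarith : 0 < ϑ S - π) (by linarith)
      rw [sin_sub_pi, hsin] at this
      simp at this

end

/-! ### The bifurcation theorem and its error estimates -/

section

variable {f : ℝ → ℝ} {A B Ap Bp Am Bm : ℝ × ℝ → ℝ} {r : ℝ}

theorem norm_planePart_polarPoint (f : ℝ → ℝ) (θ w : ℝ) (hr : 0 ≤ r) :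
    ‖planePart (polarPoint f θ r w)‖ = r := by
  rw [norm_planePart]
  simp only [polarPoint]
  have : (r * cos θ) ^ 2 + (r * sin θ) ^ 2 = r ^ 2 := by
    linear_combination r ^ 2 * sin_sq_add_cos_sq θ
  rw [this, Real.sqrt_sq hr]

theorem transCoord_polarPoint (f : ℝ → ℝ) (θ r w : ℝ) :
    transCoord f (polarPoint f θ r w) = w := by
  simp [transCoord, polarPoint]

/-- Compare with the same point at `ε = 0`, where the speed is exactly `1`; the Lipschitz bound then
depends only on the first coordinate. -/
theorem exists_angularSpeed_bound (hf : ContDiff ℝ 2 f) (hA : ContDiff ℝ 1 A)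
    (hB : ContDiff ℝ 1 B) (hr : r ≠ 0) : ∃ δ L, 0 < δ ∧ 0 < L ∧ ∀ θ (q : ℝ × ℝ × ℝ),
      ‖q - (0, r, 0)‖ ≤ δ → |angularSpeed f A B θ q - 1| ≤ L * |q.1| := by
  obtain ⟨L, hL, h, -⟩ := (smoothAlong_angularSpeed hf hA hB hr).exists_bound
  obtain ⟨δ, hδ, h⟩ := exists_forall_norm_le_of_eventually_prod h
  refine ⟨δ, L, hδ, hL, fun θ q hq => ?_⟩
  have hq' : ‖((0, q.2) : ℝ × ℝ × ℝ) - (0, r, 0)‖ ≤ δ := by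
    refine le_trans ?_ hq
    simp only [Prod.norm_def, Prod.fst_sub, Prod.snd_sub, sub_zero, norm_zero]
    exact max_le (le_max_of_le_left (norm_nonneg _)) (le_max_right _ _)
  have h1 := h q (0, q.2) hq hq' θ
  have h2 : ‖q - ((0, q.2) : ℝ × ℝ × ℝ)‖ = |q.1| := by
    simp [Prod.norm_def]
  rwa [h2, show ((0, q.2) : ℝ × ℝ × ℝ) = (0, q.2.1, q.2.2) from rfl, angularSpeed_zero] at h1

theorem exists_lipschitz_on_ball (hf : ContDiff ℝ 2 f) (b : ℝ) :
    ∃ K, 0 ≤ K ∧ ∀ x y, |x| ≤ b → |y| ≤ b → |f x - f y| ≤ K * |x - y| := by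
  obtain ⟨K, hK⟩ := (isCompact_Icc (a := -b) (b := b)).exists_bound_of_continuousOn
    (hf.continuous_deriv (by norm_num)).continuousOn
  refine ⟨|K|, abs_nonneg _, fun x y hx hy => ?_⟩
  exact Convex.norm_image_sub_le_of_norm_deriv_le (𝕜 := ℝ)
    (fun z _ => (hf.differentiable (by norm_num)) z)
    (fun z hz => (hK z hz).trans (le_abs_self _)) (convex_Icc _ _) (abs_le.1 hy) (abs_le.1 hx)

theorem abs_mul_sub_mul_le {R r x y : ℝ} (hr : 0 ≤ r) (hx : |x| ≤ 1) :
    |R * x - r * y| ≤ |R - r| + r * |x - y| := by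
  calc |R * x - r * y| = |(R - r) * x + r * (x - y)| := by ring_nf
    _ ≤ |R - r| * |x| + r * |x - y| := by
        refine (abs_add_le _ _).trans ?_
        rw [abs_mul, abs_mul, abs_of_nonneg hr]
    _ ≤ _ := by
        gcongr
        exact mul_le_of_le_one_right (abs_nonneg _) hx

theorem norm_polarPoint_sub_le {K θ t R w : ℝ} (hr : 0 ≤ r) (hR : |R - r| ≤ r)
    (hK0 : 0 ≤ K) (hK : ∀ x y, |x| ≤ 2 * r → |y| ≤ 2 * r → |f x - f y| ≤ K * |x - y|) :
    ‖polarPoint f θ R w - ((r * cos t, r * sin t, f (r * cos t)) : Space3)‖ ≤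
      |w| + (1 + K) * (|R - r| + r * |θ - t|) := by
  have h1 : |R * cos θ - r * cos t| ≤ |R - r| + r * |θ - t| :=
    (abs_mul_sub_mul_le hr (abs_cos_le_one _)).trans
      (add_le_add_right (mul_le_mul_of_nonneg_left (abs_cos_sub_cos_le _ _) hr) _)
  have h2 : |R * sin θ - r * sin t| ≤ |R - r| + r * |θ - t| :=
    (abs_mul_sub_mul_le hr (abs_sin_le_one _)).trans
      (add_le_add_right (mul_le_mul_of_nonneg_left (abs_sin_sub_sin_le _ _) hr) _)
  have hRle : |R| ≤ 2 * r := by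
    have := abs_le.1 hR
    rw [abs_le]
    constructor <;> linarith [this.1, this.2]
  have h3 : |f (R * cos θ) - f (r * cos t)| ≤ K * (|R - r| + r * |θ - t|) := by
    refine (hK _ _ ?_ ?_).trans (by gcongr)
    · rw [abs_mul]
      exact (mul_le_of_le_one_right (abs_nonneg _) (abs_cos_le_one _)).trans hRle
    · rw [abs_mul, abs_of_nonneg hr]
      exact (mul_le_of_le_one_right hr (abs_cos_le_one _)).trans (by linarith)
  have hS : 0 ≤ |R - r| + r * |θ - t| := by positivity
  simp only [polarPoint, Prod.mk_sub_mk, Prod.norm_def, Real.norm_eq_abs]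
  refine max_le ?_ (max_le ?_ ?_)
  · nlinarith [abs_nonneg w]
  · nlinarith [abs_nonneg w]
  · rw [add_sub_assoc]
    refine (abs_add_le _ _).trans ?_
    linarith

theorem exists_int_of_planePart_eq {p : Space3} (hp : planePart p ≠ 0) {a : ℝ}
    (h : planePart p = ‖planePart p‖ * Complex.exp (a * Complex.I)) :
    ∃ n : ℤ, Complex.arg (planePart p) = a + n * (2 * π) := by
  have h1 := Complex.norm_mul_exp_arg_mul_I (planePart p)
  rw [h] at h1
  have h2 : (‖planePart p‖ : ℂ) ≠ 0 := by simpa using hp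
  rw [← h] at h1
  have h3 := h1.trans h
  have h4 := mul_left_cancel₀ h2 h3
  obtain ⟨n, hn⟩ := Complex.exp_eq_exp_iff_exists_int.1 h4
  refine ⟨n, ?_⟩
  have h5 := congrArg Complex.im hn
  simpa using h5

/-- The first order bifurcation theorem for a general piecewise smooth perturbation. -/
theorem exists_crossingLimitCycle (hf : ContDiff ℝ 2 f) (hAp : ContDiff ℝ 1 Ap)
    (hBp : ContDiff ℝ 1 Bp) (hAm : ContDiff ℝ 1 Am) (hBm : ContDiff ℝ 1 Bm) (hr : 0 < r) {d : ℝ}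
    (hd : d ≠ 0) (hderiv : HasDerivAt (fun ρ => ∫ s in (0 : ℝ)..(2 * π),
      piecewiseAngle (radialRate f Ap Bp) (radialRate f Am Bm) s (0, ρ, 0)) d r)
    (hzero : ∫ s in (0 : ℝ)..(2 * π),
      piecewiseAngle (radialRate f Ap Bp) (radialRate f Am Bm) s (0, r, 0) = 0) :
    ∃ C ε₀, 0 < ε₀ ∧ ∀ ε, ε ≠ 0 → |ε| < ε₀ → ∃ (γ : ℝ → Space3) (T : ℝ),
      IsCrossingLimitCycle (halfField f Ap Bp ε) (halfField f Am Bm ε) γ T ∧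
      |T - 2 * π| ≤ C * |ε| ∧ ∀ t ∈ Icc (0 : ℝ) T,
        ‖γ t - ((r * cos t, r * sin t, f (r * cos t)) : Space3)‖ ≤ C * |ε| := by
  have hfd : Differentiable ℝ f := hf.differentiable (by norm_num)
  have hFp := smoothAlong_radialRate hf hAp hBp hr.ne'
  have hFm := smoothAlong_radialRate hf hAm hBm hr.ne'
  have hGp := smoothAlong_transRate hf hAp hBp hr.ne'
  have hGm := smoothAlong_transRate hf hAm hBm hr.ne'
  obtain ⟨C₁, ε₁, hC₁, hε₁, hex⟩ := exists_isPeriodicSolution hFp hFm hGp hGm hd hderiv hzero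
  have hD := (hasDerivAt_integral_piecewiseAngle hFp hFm).unique hderiv
  obtain ⟨δ₁, hδ₁, huniq⟩ := IsPolarOrbit.eq_isPeriodicSolution hFp hFm hGp hGm (hD ▸ hd)
  obtain ⟨δ₂, L₂, hδ₂, hL₂, hΩp⟩ := exists_angularSpeed_bound hf hAp hBp hr.ne'
  obtain ⟨δ₃, L₃, hδ₃, hL₃, hΩm⟩ := exists_angularSpeed_bound hf hAm hBm hr.ne'
  obtain ⟨δ₄, L₄, hδ₄, hL₄, hΩ⟩ := exists_uniformOn
    (smoothAlong_angularSpeed hf hAp hBp hr.ne') (smoothAlong_angularSpeed hf hAm hBm hr.ne')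
  obtain ⟨K, hK0, hK⟩ := exists_lipschitz_on_ball hf (2 * r)
  set δ := min (min δ₁ δ₂) (min (min δ₃ δ₄) (r / 2)) with hδdef
  have hδ : 0 < δ := by positivity
  have hd₁ : δ ≤ δ₁ := (min_le_left _ _).trans (min_le_left _ _)
  have hd₂ : δ ≤ δ₂ := (min_le_left _ _).trans (min_le_right _ _)
  have hd₃ : δ ≤ δ₃ := (min_le_right _ _).trans ((min_le_left _ _).trans (min_le_left _ _))
  have hd₄ : δ ≤ δ₄ := (min_le_right _ _).trans ((min_le_left _ _).trans (min_le_right _ _))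
  have hdr : δ ≤ r / 2 := (min_le_right _ _).trans (min_le_right _ _)
  set L := max L₂ L₃ with hLdef
  have hL : 0 < L := lt_max_of_lt_left hL₂
  -- The reciprocal speed is within `2 L |ε|` of `1`; over one turn this shifts the clock by at most
  -- `κ |ε|`.
  set κ := 2 * L * (2 * π) with hκ
  have hκ0 : 0 < κ := by have := pi_pos; positivity
  -- `κ` bounds the period and the rest the distance of the curves. The bound `1 / 4 / L` keeps the
  -- angular speed at least `1/2` and the reciprocal speed within `1/2` of `1`, as the clock needs.
  refine ⟨κ + (C₁ + (1 + K) * (C₁ + r * κ)), min (min ε₁ δ) (min (δ / C₁) (1 / 4 / L)),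
    by positivity, fun ε hε0 hε => ?_⟩
  simp only [lt_min_iff] at hε
  obtain ⟨⟨hε₁', hεδ⟩, hεC, hεL⟩ := hε
  rw [lt_div_iff₀ hC₁, mul_comm] at hεC
  rw [lt_div_iff₀ hL, mul_comm] at hεL
  obtain ⟨R, w, hs, hR, hw⟩ := hex ε hε₁'
  have hball : ∀ {x y : ℝ}, |x - r| ≤ δ → |y| ≤ δ →
      ‖((ε, x, y) : ℝ × ℝ × ℝ) - (0, r, 0)‖ ≤ δ := fun h1 h2 => by
    simp only [Prod.mk_sub_mk, sub_zero, Prod.norm_def, Real.norm_eq_abs]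
    exact max_le hεδ.le (max_le h1 h2)
  have hspeedp : ∀ {x y : ℝ} (θ : ℝ), |x - r| ≤ δ → |y| ≤ δ →
      |angularSpeed f Ap Bp θ (ε, x, y) - 1| ≤ L * |ε| := fun θ h1 h2 =>
    (hΩp θ _ ((hball h1 h2).trans hd₂)).trans (by gcongr; exact le_max_left _ _)
  have hspeedm : ∀ {x y : ℝ} (θ : ℝ), |x - r| ≤ δ → |y| ≤ δ →
      |angularSpeed f Am Bm θ (ε, x, y) - 1| ≤ L * |ε| := fun θ h1 h2 =>
    (hΩm θ _ ((hball h1 h2).trans hd₃)).trans (by gcongr; exact le_max_right _ _)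
  have hposp : ∀ {x y : ℝ} (θ : ℝ), |x - r| ≤ δ → |y| ≤ δ →
      0 < angularSpeed f Ap Bp θ (ε, x, y) := fun θ h1 h2 => by
    linarith [(abs_le.1 (hspeedp θ h1 h2)).1]
  have hposm : ∀ {x y : ℝ} (θ : ℝ), |x - r| ≤ δ → |y| ≤ δ →
      0 < angularSpeed f Am Bm θ (ε, x, y) := fun θ h1 h2 => by
    linarith [(abs_le.1 (hspeedm θ h1 h2)).1]
  have hRδ : ∀ θ, |R θ - r| < δ := fun θ => (hR θ).trans_lt hεC
  have hwδ : ∀ θ, |w θ| < δ := fun θ => (hw θ).trans_lt hεC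
  have hR0 : ∀ θ, 0 < R θ := fun θ => by
    linarith [(abs_le.1 (hRδ θ).le).1]
  set Ω := fun θ => piecewiseAngle (angularSpeed f Ap Bp) (angularSpeed f Am Bm) θ
    (ε, R θ, w θ) with hΩdef
  have hu : Continuous fun θ => ((ε, R θ, w θ) : ℝ × ℝ × ℝ) :=
    continuous_const.prodMk (hs.continuous_fst.prodMk hs.continuous_snd)
  have hub : ∀ θ, ‖((ε, R θ, w θ) : ℝ × ℝ × ℝ) - (0, r, 0)‖ ≤ δ₄ := fun θ =>
    (hball (hRδ θ).le (hwδ θ).le).trans hd₄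
  have hΩ1 : ∀ θ, |Ω θ - 1| ≤ L * |ε| := fun θ => by
    simp only [hΩdef, piecewiseAngle]
    split_ifs
    · exact hspeedp θ (hRδ θ).le (hwδ θ).le
    · exact hspeedm θ (hRδ θ).le (hwδ θ).le
  have hΩlow : ∀ θ, 1 / 2 ≤ Ω θ := fun θ => by linarith [(abs_le.1 (hΩ1 θ)).1]
  have hΩinv : ∀ θ, |(Ω θ)⁻¹ - 1| ≤ 2 * (L * |ε|) := fun θ => by
    have h0 : 0 < Ω θ := by linarith [hΩlow θ]
    have h1 : (Ω θ)⁻¹ - 1 = -(Ω θ - 1) / Ω θ := by field_simp; ring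
    rw [h1, abs_div, abs_neg, abs_of_pos h0, div_le_iff₀ h0]
    nlinarith [hΩ1 θ, hΩlow θ, abs_nonneg (Ω θ - 1)]
  have hΩper : Function.Periodic Ω (2 * π) := fun θ => by
    simp only [hΩdef, hs.periodic_fst θ, hs.periodic_snd θ]
    rw [piecewiseAngle_periodic (angularSpeed_periodic f Ap Bp) (angularSpeed_periodic f Am Bm) θ]
  obtain ⟨ϑ, T, hϑc, hϑm, hϑs, hϑ0, hT, hϑT, hTclose, hϑclose, hϑd⟩ :=
    exists_clock (p := fun θ => (Ω θ)⁻¹) (hΩ.measurable_comp hu hub).inv hΩinv (by linarith)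
      (fun θ => by simp only [hΩper θ])
  set γ := fun t => polarPoint f (ϑ t) (R (ϑ t)) (w (ϑ t)) with hγ
  have horbit := isPeriodicCrossingOrbit_polarPoint hf hAp.continuous hBp.continuous
    hAm.continuous hBm.continuous hs hR0 (fun θ => hposp θ (hRδ θ).le (hwδ θ).le)
    (fun θ => hposm θ (hRδ θ).le (hwδ θ).le) hϑc hϑm hϑ0 hT hϑT (fun t ht => by
      have h1 := hϑd t ((hΩ.continuousAt_comp hu hub ht).inv₀ (by
        have := hΩlow (ϑ t)
        simp only [hΩdef] at this
        linarith))
      simpa using h1)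
  -- The isolating neighbourhood is a solid torus whose width `δ` does not depend on `ε`. It avoids
  -- the axis, so every orbit inside has polar coordinates and rotates in the positive sense.
  refine ⟨γ, T, ⟨horbit, {p | |‖planePart p‖ - r| < δ ∧ |transCoord f p| < δ}, ?_, ?_, ?_⟩,
    ?_, ?_⟩
  · have h1 := continuous_planePart
    have h2 : Continuous (transCoord f) := by
      have := hfd.continuous
      unfold transCoord
      fun_prop
    exact (isOpen_lt (h1.norm.sub continuous_const).abs continuous_const).inter
      (isOpen_lt h2.abs continuous_const)
  · rintro _ ⟨t, rfl⟩
    simp only [hγ, mem_ofPred_eq]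
    rw [norm_planePart_polarPoint f _ _ (hR0 _).le, transCoord_polarPoint]
    exact ⟨hRδ _, hwδ _⟩
  · intro η S hη hηU
    have hηR : ∀ t, |‖planePart (η t)‖ - r| < δ := fun t => (hηU ⟨t, rfl⟩).1
    have hηw : ∀ t, |transCoord f (η t)| < δ := fun t => (hηU ⟨t, rfl⟩).2
    have hne : ∀ t, planePart (η t) ≠ 0 := fun t h => by
      have := hηR t
      rw [h, norm_zero, zero_sub, abs_neg, abs_of_pos hr] at this
      linarith
    have hp := fun t => hposp (Complex.arg (planePart (η t))) (hηR t).le (hηw t).le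
    have hm := fun t => hposm (Complex.arg (planePart (η t))) (hηR t).le (hηw t).le
    have heq := huniq ε hε0 (hεδ.le.trans hd₁) R w hs (fun θ => (hRδ θ).le.trans hd₁)
      (fun θ => (hwδ θ).le.trans hd₁) _ _ _ _ (hη.isPolarOrbit hfd hne hp hm)
      (fun t => (hηR t).le.trans hd₁) (fun t => (hηw t).le.trans hd₁)
    have hηeq : ∀ t, η t = polarPoint f (Complex.arg (planePart (η t)))
        (R (Complex.arg (planePart (η t)))) (w (Complex.arg (planePart (η t)))) := fun t => by
      conv_lhs => rw [← polarPoint_arg f (η t)]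
      rw [(heq t).1, (heq t).2]
    refine Subset.antisymm ?_ ?_
    · rintro _ ⟨t, rfl⟩
      obtain ⟨s, hs'⟩ := hϑs (Complex.arg (planePart (η t)))
      refine ⟨s, ?_⟩
      simp only [hγ]
      rw [hs', ← hηeq t]
    · rintro _ ⟨s, rfl⟩
      obtain ⟨t, ht⟩ := hη.exists_arg_eq hfd hne hp hm (ϑ s)
      refine ⟨t, ?_⟩
      obtain ⟨n, hn⟩ := exists_int_of_planePart_eq (hne t) ht
      rw [hηeq t, hn]
      simp only [hγ, polarPoint, cos_add_int_mul_two_pi, sin_add_int_mul_two_pi,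
        (hs.periodic_fst.int_mul n) _, (hs.periodic_snd.int_mul n) _]
  · refine hTclose.trans ?_
    have : 0 ≤ (C₁ + (1 + K) * (C₁ + r * κ)) * |ε| := by positivity
    rw [hκ] at this ⊢
    linarith
  · intro t ht
    have hϑ2 : |ϑ t| ≤ 2 * π := by
      have h1 : 0 ≤ ϑ t := hϑ0 ▸ hϑm.monotone ht.1
      have h2 := hϑm.monotone ht.2
      have h3 := hϑT 0
      rw [zero_add, hϑ0, zero_add] at h3
      rw [abs_of_nonneg h1]
      linarith
    have hϑt : |ϑ t - t| ≤ κ * |ε| := by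
      refine (hϑclose t).trans ?_
      calc _ ≤ 2 * (L * |ε|) * (2 * π) := by gcongr
        _ = κ * |ε| := by rw [hκ]; ring
    refine (norm_polarPoint_sub_le hr.le ((hRδ _).le.trans (by linarith)) hK0 hK).trans ?_
    calc _ ≤ C₁ * |ε| + (1 + K) * (C₁ * |ε| + r * (κ * |ε|)) := by
          gcongr
          · exact hw _
          · exact hR _
      _ ≤ _ := by
          have : 0 ≤ κ * |ε| := by positivity
          linarith

end

/-! ### The affine perturbation and the two examples -/

/-- The coefficient `a₀ + a₁ z + ε (a₂ + a₃ z)`. -/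
def affineCoeff (a₀ a₁ a₂ a₃ : ℝ) (p : ℝ × ℝ) : ℝ := a₀ + a₁ * p.2 + p.1 * (a₂ + a₃ * p.2)

theorem contDiff_affineCoeff (a₀ a₁ a₂ a₃ : ℝ) : ContDiff ℝ 1 (affineCoeff a₀ a₁ a₂ a₃) := by
  unfold affineCoeff
  fun_prop

theorem upperField_eq_halfField (f : ℝ → ℝ) (a₀ a₁ a₂ a₃ ε : ℝ) :
    upperField (fun x _ => f x) a₀ a₁ a₂ a₃ ε =
      halfField f (affineCoeff a₀ a₁ a₂ a₃) (affineCoeff 0 0 0 0) ε := by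
  ext p
  · simp only [upperField, halfField, affineCoeff]
    ring
  · simp [upperField, halfField, affineCoeff]
  · simp [upperField, halfField]

theorem lowerField_eq_halfField (f : ℝ → ℝ) (b₁ b₂ b₃ ε : ℝ) :
    lowerField (fun x _ => f x) b₁ b₂ b₃ ε =
      halfField f (affineCoeff 0 0 0 0) (affineCoeff 0 b₁ b₂ b₃) ε := by
  ext p
  · simp [lowerField, halfField, affineCoeff]
  · simp only [lowerField, halfField, affineCoeff]
    ring
  · simp [lowerField, halfField]

/-- At `ε = w = 0` the angular speed is `1` and `z = f (r cos θ)`, so only the first order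
coefficients remain. The constant `a₀` drops out because the cosine has integral zero over `[0, π]`.
-/
theorem integral_radialRate_eq_bifurcationFunction {f : ℝ → ℝ} (hf : ContDiff ℝ 2 f)
    (a₀ a₁ a₂ a₃ b₁ b₂ b₃ : ℝ) {r : ℝ} (hr : r ≠ 0) : ∫ s in (0 : ℝ)..(2 * π), piecewiseAngle
      (radialRate f (affineCoeff a₀ a₁ a₂ a₃) (affineCoeff 0 0 0 0))
      (radialRate f (affineCoeff 0 0 0 0) (affineCoeff 0 b₁ b₂ b₃)) s (0, r, 0) =
      bifurcationFunction (fun x _ => f x) a₁ b₁ r := by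
  have h0 := contDiff_affineCoeff 0 0 0 0
  obtain ⟨δ, L, hδ, -, h⟩ := exists_uniformOn
    (smoothAlong_radialRate hf (contDiff_affineCoeff a₀ a₁ a₂ a₃) h0 hr)
    (smoothAlong_radialRate hf h0 (contDiff_affineCoeff 0 b₁ b₂ b₃) hr)
  have hb : ‖((0, r, 0) : ℝ × ℝ × ℝ) - (0, r, 0)‖ ≤ δ := by simp [hδ.le]
  have hi := intervalIntegrable_of_measurable_of_bound (B := L)
    (h.measurable_comp (u := fun _ => (0, r, 0)) continuous_const fun _ => hb)
    (fun s => h.bound s _ hb)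
  have hfc := hf.continuous
  rw [← integral_add_adjacent_intervals (hi 0 π) (hi π (2 * π)), bifurcationFunction]
  congr 1
  · have h1 : ∫ s in (0 : ℝ)..π, piecewiseAngle
        (radialRate f (affineCoeff a₀ a₁ a₂ a₃) (affineCoeff 0 0 0 0))
        (radialRate f (affineCoeff 0 0 0 0) (affineCoeff 0 b₁ b₂ b₃)) s (0, r, 0) =
        ∫ s in (0 : ℝ)..π, (a₀ * cos s + a₁ * (f (r * cos s) * cos s)) := by
      refine integral_congr_Ioo_of_le pi_pos.le fun s hs => ?_
      simp only [piecewiseAngle, if_pos (sin_pos_of_mem_Ioo hs), radialRate, angularSpeed_zero,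
        radialPart, affineCoeff, polarHeight]
      ring
    rw [h1, integral_add (Continuous.intervalIntegrable (by fun_prop) _ _)
      (Continuous.intervalIntegrable (by fun_prop) _ _), intervalIntegral.integral_const_mul,
      intervalIntegral.integral_const_mul, integral_cos]
    simp
  · rw [← intervalIntegral.integral_const_mul]
    refine integral_congr_Ioo_of_le (by linarith [pi_pos]) fun s hs => ?_
    have hsin : ¬ 0 < sin s := by
      have := sin_pos_of_pos_of_lt_pi (by linarith [hs.1] : 0 < s - π) (by linarith [hs.2])
      rw [sin_sub_pi] at this
      linarith
    simp only [piecewiseAngle, if_neg hsin, radialRate, angularSpeed_zero, radialPart,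
      affineCoeff, polarHeight]
    ring

/-- A limit cycle bifurcates at each simple positive zero of the bifurcation function. -/
theorem limitCycleBifurcatesAt_of_simple_zero {f : ℝ → ℝ} (hf : ContDiff ℝ 2 f)
    (a₀ a₁ a₂ a₃ b₁ b₂ b₃ : ℝ) {r d : ℝ} (hr : 0 < r) (hd : d ≠ 0)
    (hderiv : HasDerivAt (bifurcationFunction (fun x _ => f x) a₁ b₁) d r)
    (hzero : bifurcationFunction (fun x _ => f x) a₁ b₁ r = 0) :
    LimitCycleBifurcatesAt (fun x _ => f x) a₀ a₁ a₂ a₃ b₁ b₂ b₃ r := by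
  have h0 := contDiff_affineCoeff 0 0 0 0
  obtain ⟨C, ε₀, hε₀, h⟩ := exists_crossingLimitCycle hf (contDiff_affineCoeff a₀ a₁ a₂ a₃) h0 h0
    (contDiff_affineCoeff 0 b₁ b₂ b₃) hr hd (hderiv.congr_of_eventuallyEq (by
      filter_upwards [eventually_ne_nhds hr.ne'] with ρ hρ
      exact integral_radialRate_eq_bifurcationFunction hf a₀ a₁ a₂ a₃ b₁ b₂ b₃ hρ))
    ((integral_radialRate_eq_bifurcationFunction hf a₀ a₁ a₂ a₃ b₁ b₂ b₃ hr.ne').trans hzero)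
  choose! φ T hφ using h
  refine ⟨φ, T, C, ε₀, hε₀, fun ε hε hε' => ?_⟩
  rw [upperField_eq_halfField, lowerField_eq_halfField]
  exact hφ ε hε hε'

theorem mainTheorem5 (a₀ a₁ a₂ a₃ b₁ b₂ b₃ : ℝ) :
    ((∀ r : ℝ, 0 < r →
        bifurcationFunction (fun x _ => Real.cos x) a₁ b₁ r = -(2 * b₁ * Real.sin r) / r) ∧
      (b₁ ≠ 0 → ∀ n : ℕ, 1 ≤ n →
        LimitCycleBifurcatesAt (fun x _ => Real.cos x) a₀ a₁ a₂ a₃ b₁ b₂ b₃ (n * Real.pi))) ∧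
    ((∀ r : ℝ, 0 < r →
        bifurcationFunction (fun x _ => Real.sin x) a₁ b₁ r = a₁ * Real.pi * besselJ 1 r) ∧
      (∃ ρ : ℕ → ℝ, StrictMono ρ ∧ Set.range ρ = {r : ℝ | 0 < r ∧ besselJ 1 r = 0} ∧
        (a₁ ≠ 0 → ∀ n : ℕ,
          LimitCycleBifurcatesAt (fun x _ => Real.sin x) a₀ a₁ a₂ a₃ b₁ b₂ b₃ (ρ n)))) := by
  refine ⟨⟨fun r hr => bifurcationFunction_cos hr.ne' a₁ b₁, fun hb n hn => ?_⟩,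
    fun r _ => ?_, ?_⟩
  · have hr : 0 < (n : ℝ) * π := mul_pos (by exact_mod_cast hn) pi_pos
    have hcos : cos ((n : ℝ) * π) ≠ 0 := by
      rw [cos_nat_mul_pi]
      positivity
    -- Where the sine vanishes, only its derivative contributes to the derivative of the quotient,
    -- which gives `d`.
    refine limitCycleBifurcatesAt_of_simple_zero contDiff_cos a₀ a₁ a₂ a₃ b₁ b₂ b₃ hr
      (d := -(2 * b₁ * cos (n * π)) / (n * π)) ?_ ?_ ?_
    · exact div_ne_zero (neg_ne_zero.2 (mul_ne_zero (mul_ne_zero two_ne_zero hb) hcos)) hr.ne'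
    · have h1 := (((hasDerivAt_sin (n * π)).const_mul (2 * b₁)).fun_neg).fun_div
        (hasDerivAt_id (n * π)) hr.ne'
      refine (h1.congr_deriv ?_).congr_of_eventuallyEq ?_
      · simp only [id, sin_nat_mul_pi]
        have := hr.ne'
        field_simp
        ring
      · filter_upwards [eventually_ne_nhds hr.ne'] with ρ hρ
        exact bifurcationFunction_cos hρ a₁ b₁
    · rw [bifurcationFunction_cos hr.ne', sin_nat_mul_pi]
      simp
  · rw [bifurcationFunction_sin, besselIntegralOne_eq_pi_mul_besselJ]
    ring
  · obtain ⟨ρ, hmono, hrange⟩ := exists_strictMono_range_eq_besselJ_one_zeros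
    refine ⟨ρ, hmono, hrange, fun ha n => ?_⟩
    obtain ⟨hpos, hzero⟩ : 0 < ρ n ∧ besselJ 1 (ρ n) = 0 := hrange.subset ⟨n, rfl⟩
    have h0 : besselIntegralOne (ρ n) = 0 := by
      rw [besselIntegralOne_eq_pi_mul_besselJ, hzero, mul_zero]
    obtain ⟨d, hd, hderiv⟩ := hasDerivAt_besselIntegralOne_of_eq_zero hpos.le h0
    refine limitCycleBifurcatesAt_of_simple_zero contDiff_sin a₀ a₁ a₂ a₃ b₁ b₂ b₃ hpos
      (mul_ne_zero ha hd) ?_ ?_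
    · rw [funext (bifurcationFunction_sin a₁ b₁)]
      exact hderiv.const_mul a₁
    · rw [bifurcationFunction_sin, h0, mul_zero]
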